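/- Let $K$ be a field of characteristic zero, let $L\supseteq K$ be an algebraically closed field, let $n\ge 2$ and $R=K[X_1,\dots,X_n]$. For a left module $N$ over the Weyl algebra $A_n(K)=K\langle X_1,\dots,X_n,\partial_1,\dots,\partial_n\rangle$, write $H^i(\partial;N)$ for the $i$-th de Rham cohomology of $N$, i.e. the $i$-th cohomology of the Koszul cochain complex $0\to N\to N^{n}\to\cdots\to N^{\binom{n}{p}}\to\cdots\to N\to 0$ of the commuting $K$-linear operators $\partial_1,\dots,\partial_n$ on $N$ (so $H^0(\partial;N)=\bigcap_i\ker\partial_i$ and $H^n(\partial;N)=N/\sum_i\partial_iN$). Let $I\subset R$ be a homogeneous ideal of height $n-1$, and let $V^*(I)_L=\{\mathbf a\in\mathbb P^{n-1}(L) : f(\mathbf a)=0 \text{ for all } f\in I\}$. The local cohomology module $H^{n-1}_I(R)$ is regarded as an $A_n(K)$-module in the usual way: it is the cohomology in degree $n-1$ of the Čech complex $0\to R\to\prod_i R_{a_i}\to\prod_{i<j}R_{a_ia_j}\to\cdots\to R_{a_1\cdots a_s}\to 0$ of any finite system $a_1,\dots,a_s$ of generators of $I$, where each $\partial_i$ acts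 on the localizations of $R$ by the quotient rule. Then $V^*(I)_L$ is finite and non-empty, the $K$-vector spaces $H^n(\partial;H^{n-1}_I(R))$ and $H^{n-1}(\partial;H^{n-1}_I(R))$ are finite-dimensional, and \begin{align*} \dim_K H^n\bigl(\partial;H^{n-1}_I(R)\bigr) &= \sharp V^*(I)_L-1,\\ \dim_K H^{n-1}\bigl(\partial;H^{n-1}_I(R)\bigr) &= \sharp V^*(I)_L,\\ H^i\bigl(\partial;H^{n-1}_I(R)\bigr) &= 0\quad\text{for all } 0\le i\le n-2. \end{align*} -/

import Mathlib

universe u v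

attribute [local instance] MvPolynomial.gradedAlgebra

noncomputable section

open CategoryTheory

/-! ### Complexes indexed by the subsets of a finite linearly ordered set

Both the Koszul (de Rham) complex and the Čech complex have as their degree `p` term the product,
over the `p`-element subsets `S` of a finite index set, of modules `M S`, and as differential the
alternating sum of maps `M (T \ {i}) → M T`. -/

/-- A commutative cube of `K`-modules: a module `M S` for each finite subset `S`, and linear maps
`φ i : M S → M (S ∪ {i})`, such that adding `i` and then `j` is the same as adding `j` and then
`i`. (The target of `φ i` is called `T`, with a proof of `insert i S = T`, to avoid casts.) -/
structure ModuleCube (K : Type u) [Field K] (ι : Type) [LinearOrder ι] where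
  M : Finset ι → Type u
  [grp : ∀ S, AddCommGroup (M S)]
  [mod : ∀ S, Module K (M S)]
  φ : ∀ {S T : Finset ι} (i : ι), insert i S = T → (M S →ₗ[K] M T)
  comm : ∀ {S A B T : Finset ι} (i j : ι) (hA : insert i S = A) (hAT : insert j A = T)
    (hB : insert j S = B) (hBT : insert i B = T) (x : M S), φ j hAT (φ i hA x) = φ i hBT (φ j hB x)

attribute [instance] ModuleCube.grp ModuleCube.mod

namespace ModuleCube

variable {K : Type u} [Field K] {ι : Type} [LinearOrder ι]

/-- The sign `(-1)^{#{j ∈ T : j < i}}`. -/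
def sgn (T : Finset ι) (i : ι) : ℤ := (-1) ^ (T.filter (· < i)).card

lemma sgn_erase_mul (T : Finset ι) {i j : ι} (hi : i ∈ T) (hj : j ∈ T) (hij : i ≠ j) :
    sgn T i * sgn (T.erase i) j + sgn T j * sgn (T.erase j) i = 0 := by
  wlog h : i < j generalizing i j
  · rw [add_comm]
    exact this hj hi hij.symm (lt_of_le_of_ne (not_lt.mp h) hij.symm)
  have h1 : ((T.erase j).filter (· < i)) = T.filter (· < i) := by
    ext k
    simp only [Finset.mem_filter, Finset.mem_erase]
    constructor
    · rintro ⟨⟨_, h2⟩, h3⟩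
      exact ⟨h2, h3⟩
    · rintro ⟨h2, h3⟩
      exact ⟨⟨(h3.trans h).ne, h2⟩, h3⟩
  have h2 : ((T.erase i).filter (· < j)) = (T.filter (· < j)).erase i := by
    ext k
    simp only [Finset.mem_filter, Finset.mem_erase]
    tauto
  have hm : i ∈ T.filter (· < j) := by simp [hi, h]
  have h3 := Finset.card_erase_add_one hm
  unfold sgn
  rw [h1, h2, ← h3, pow_succ]
  ring

variable (C : ModuleCube K ι)

/-- The term of degree `p`: the product of the `M S` over the `p`-element subsets `S`. -/
abbrev Term (p : ℕ) : Type u := ∀ S : {S : Finset ι // S.card = p}, C.M S.1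

/-- The differential `(d f)_T = ∑_{i ∈ T} (-1)^{#{j ∈ T : j < i}} φ_i (f_{T \ {i}})`. -/
def diff {p q : ℕ} (h : p + 1 = q) : C.Term p →ₗ[K] C.Term q :=
  LinearMap.pi fun T => ∑ i : {i // i ∈ T.1},
    sgn T.1 i.1 • (C.φ i.1 (Finset.insert_erase i.2) ∘ₗ
      LinearMap.proj (R := K) (φ := fun S : {S : Finset ι // S.card = p} => C.M S.1)
        ⟨T.1.erase i.1, by
          rw [Finset.card_erase_of_mem i.2, T.2, ← h, Nat.add_sub_cancel]⟩)

lemma diff_apply {p q : ℕ} (h : p + 1 = q) (f : C.Term p) (T : {S : Finset ι // S.card = q}) :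
    C.diff h f T = ∑ i : {i // i ∈ T.1}, sgn T.1 i.1 • C.φ i.1 (Finset.insert_erase i.2)
      (f ⟨T.1.erase i.1, by
          rw [Finset.card_erase_of_mem i.2, T.2, ← h, Nat.add_sub_cancel]⟩) := by
  simp [diff, LinearMap.sum_apply]

lemma φ_congr {S S' T : Finset ι} {p : ℕ} (f : C.Term p) (i : ι) (hS : S.card = p)
    (hS' : S'.card = p) (e : S = S') (h : insert i S = T) (h' : insert i S' = T) :
    C.φ i h (f ⟨S, hS⟩) = C.φ i h' (f ⟨S', hS'⟩) := by
  subst e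
  rfl

lemma diff_diff {p q r : ℕ} (h : p + 1 = q) (h' : q + 1 = r) (f : C.Term p) :
    C.diff h' (C.diff h f) = 0 := by
  funext T
  rw [diff_apply]
  simp only [diff_apply, map_sum, Finset.smul_sum, map_zsmul, smul_smul, Pi.zero_apply]
  rw [← Fintype.sum_sigma']
  refine Finset.sum_involution
    (fun x _ => ⟨⟨x.2.1, Finset.mem_of_mem_erase x.2.2⟩,
      ⟨x.1.1, Finset.mem_erase.2 ⟨(Finset.ne_of_mem_erase x.2.2).symm, x.1.2⟩⟩⟩) ?_ ?_ ?_ ?_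
  · rintro ⟨⟨i, hi⟩, ⟨j, hj⟩⟩ -
    have hj' := Finset.mem_of_mem_erase hj
    have hij := (Finset.ne_of_mem_erase hj).symm
    have key := C.comm j i (Finset.insert_erase hj) (Finset.insert_erase hi)
      (B := T.1.erase j) (by
        rw [Finset.erase_right_comm]
        exact Finset.insert_erase (Finset.mem_erase.2 ⟨hij, hi⟩)) (Finset.insert_erase hj')
      (f ⟨(T.1.erase i).erase j, by
        rw [Finset.card_erase_of_mem hj, Finset.card_erase_of_mem hi, T.2]
        omega⟩)
    have key2 := C.φ_congr (T := T.1.erase j) f i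
      (S := (T.1.erase i).erase j) (S' := (T.1.erase j).erase i) (by
        rw [Finset.card_erase_of_mem hj, Finset.card_erase_of_mem hi, T.2]
        omega) (by
        rw [Finset.erase_right_comm, Finset.card_erase_of_mem hj, Finset.card_erase_of_mem hi, T.2]
        omega) Finset.erase_right_comm (by
        rw [Finset.erase_right_comm]
        exact Finset.insert_erase (Finset.mem_erase.2 ⟨hij, hi⟩))
        (Finset.insert_erase (Finset.mem_erase.2 ⟨hij, hi⟩))
    dsimp only
    rw [key, key2, ← add_smul, sgn_erase_mul T.1 hi hj' hij, zero_smul]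
  · rintro ⟨⟨i, hi⟩, ⟨j, hj⟩⟩ - - h
    have := congrArg (fun x => x.1.1) h
    exact Finset.ne_of_mem_erase hj this
  · intros
    exact Finset.mem_univ _
  · intros
    rfl

/-- The cochain complex of a commutative cube. -/
def complex : CochainComplex (ModuleCat.{u} K) ℕ where
  X p := ModuleCat.of K (C.Term p)
  d p q := if h : p + 1 = q then ModuleCat.ofHom (C.diff h) else 0
  shape p q h := dif_neg h
  d_comp_d' p q r h h' := by
    have h1 : p + 1 = q := h
    have h2 : q + 1 = r := h'
    rw [dif_pos h1, dif_pos h2]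
    refine ModuleCat.hom_ext (LinearMap.ext fun f => ?_)
    exact C.diff_diff h1 h2 f

/-- The endomorphism of the complex of a commutative cube given by a family of endomorphisms
of the modules `M S` which commutes with the maps of the cube. -/
def complexEnd (ψ : ∀ S, C.M S →ₗ[K] C.M S)
    (hψ : ∀ {S T : Finset ι} (i : ι) (h : insert i S = T) (x : C.M S),
      ψ T (C.φ i h x) = C.φ i h (ψ S x)) : C.complex ⟶ C.complex where
  f p := ModuleCat.ofHom (LinearMap.pi fun S => ψ S.1 ∘ₗ LinearMap.proj S)
  comm' p q h := by
    have h1 : p + 1 = q := h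
    simp only [complex, dif_pos h1]
    refine ModuleCat.hom_ext (LinearMap.ext fun f => funext fun T => ?_)
    change C.diff h1 (fun S => ψ S.1 (f S)) T = ψ T.1 (C.diff h1 f T)
    rw [diff_apply, diff_apply, map_sum]
    refine Finset.sum_congr rfl fun i _ => ?_
    rw [map_zsmul, hψ]

end ModuleCube

/-! ### The de Rham complex of a family of commuting operators -/

section DeRham

variable {K : Type u} [Field K] {n : ℕ} {N : Type u} [AddCommGroup N] [Module K N]

/-- The constant cube on `N`, where adding the index `i` is the operator `∂ i`. -/
def deRhamCube (D : Fin n → N →ₗ[K] N) (hD : ∀ i j x, D i (D j x) = D j (D i x)) :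
    ModuleCube K (Fin n) where
  M _ := N
  φ i _ := D i
  comm i j _ _ _ _ x := hD j i x

/-- The de Rham complex `K(∂; N)`, that is the Koszul cochain complex
`0 → N → N^n → ⋯ → N^(n choose p) → ⋯ → N → 0` of pairwise commuting operators `∂₁, …, ∂ₙ`. -/
def deRhamComplex (D : Fin n → N →ₗ[K] N) (hD : ∀ i j x, D i (D j x) = D j (D i x)) :
    CochainComplex (ModuleCat.{u} K) ℕ :=
  (deRhamCube D hD).complex

/-- The de Rham cohomology `H^i(∂; N)`; `H^0` is the common kernel of the operators and `H^n` is
`N / ∑ ∂ᵢ N`. -/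
abbrev deRhamCohomology (D : Fin n → N →ₗ[K] N) (hD : ∀ i j x, D i (D j x) = D j (D i x)) (i : ℕ) :
    ModuleCat.{u} K :=
  (deRhamComplex D hD).homology i

end DeRham

/-! ### Extension of derivations to localizations -/

section LocDer

variable {K : Type v} {R : Type u} [CommRing K] [CommRing R] [Algebra K R]

/-- The quotient rule `D (r / s) = (s D r - r D s) / s²` on `M⁻¹R`. -/
def locDerivationFun (M : Submonoid R) (D : Derivation K R R) (x : Localization M) :
    Localization M :=
  Localization.liftOn x (fun r s => Localization.mk (s * D r - r * D s) (s ^ 2)) (by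
    intro r r' s s' h
    obtain ⟨c, hc⟩ := Localization.r_iff_exists.1 h
    have hD := congrArg D hc
    simp only [Derivation.leibniz, smul_eq_mul] at hD
    refine Localization.mk_eq_mk_iff.2 (Localization.r_iff_exists.2 ⟨c ^ 2, ?_⟩)
    push_cast
    linear_combination (s * s' * c : R) * hD - (s * s' * D c + c * s' * D s + c * s * D s' : R) * hc)

lemma locDerivationFun_mk (M : Submonoid R) (D : Derivation K R R) (r : R) (s : M) :
    locDerivationFun M D (Localization.mk r s) =
      Localization.mk (s * D r - r * D s) (s ^ 2) := by
  rw [locDerivationFun, Localization.liftOn_mk]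

/-- The derivation of `M⁻¹R` which extends the derivation `D` of `R`. -/
def locDerivation (M : Submonoid R) (D : Derivation K R R) :
    Derivation K (Localization M) (Localization M) :=
  Derivation.mk'
    { toFun := locDerivationFun M D
      map_add' := by
        intro x y
        induction x using Localization.induction_on with | _ x
        induction y using Localization.induction_on with | _ y
        obtain ⟨r, s⟩ := x
        obtain ⟨r', s'⟩ := y
        simp only [Localization.add_mk, locDerivationFun_mk]
        refine Localization.mk_eq_mk_iff.2 (Localization.r_iff_exists.2 ⟨1, ?_⟩)
        push_cast
        simp only [map_add, Derivation.leibniz, smul_eq_mul]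
        ring
      map_smul' := by
        intro c x
        induction x using Localization.induction_on with | _ x
        obtain ⟨r, s⟩ := x
        simp only [Localization.smul_mk, locDerivationFun_mk, RingHom.id_apply, Derivation.map_smul]
        congr 1
        rw [smul_sub, mul_smul_comm, smul_mul_assoc] }
    (by
      intro x y
      induction x using Localization.induction_on with | _ x
      induction y using Localization.induction_on with | _ y
      obtain ⟨r, s⟩ := x
      obtain ⟨r', s'⟩ := y
      simp only [LinearMap.coe_mk, AddHom.coe_mk, smul_eq_mul, Localization.mk_mul,
        locDerivationFun_mk, Localization.add_mk]
      refine Localization.mk_eq_mk_iff.2 (Localization.r_iff_exists.2 ⟨1, ?_⟩)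
      push_cast
      simp only [Derivation.leibniz, smul_eq_mul]
      ring)

lemma locDerivation_mk (M : Submonoid R) (D : Derivation K R R) (r : R) (s : M) :
    locDerivation M D (Localization.mk r s) = Localization.mk (s * D r - r * D s) (s ^ 2) :=
  locDerivationFun_mk M D r s

lemma locDerivation_algebraMap (M : Submonoid R) (D : Derivation K R R) (r : R) :
    locDerivation M D (algebraMap R _ r) = algebraMap R _ (D r) := by
  rw [← Localization.mk_one_eq_algebraMap, locDerivation_mk, ← Localization.mk_one_eq_algebraMap]
  simp

lemma locDerivation_comm (M : Submonoid R) (D E : Derivation K R R)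
    (h : ∀ r, D (E r) = E (D r)) (x : Localization M) :
    locDerivation M D (locDerivation M E x) = locDerivation M E (locDerivation M D x) := by
  induction x using Localization.induction_on with | _ x
  obtain ⟨r, s⟩ := x
  simp only [locDerivation_mk]
  refine Localization.mk_eq_mk_iff.2 (Localization.r_iff_exists.2 ⟨1, ?_⟩)
  push_cast
  simp only [map_sub, Derivation.leibniz, Derivation.leibniz_pow, smul_eq_mul, nsmul_eq_mul, h]
  push_cast
  ring

end LocDer

/-! ### Local cohomology by the Čech complex, with its partial derivatives -/

section Cech

variable {K : Type u} {R : Type u} [Field K] [CommRing R] [Algebra K R]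

/-- The canonical map `R_f → R_g` of `R`-algebras, for `f ∣ g`. -/
def awayToAway {f g : R} (h : f ∣ g) : Localization.Away f →ₐ[R] Localization.Away g :=
  IsLocalization.Away.liftAlgHom f (f := Algebra.ofId R (Localization.Away g))
    (IsLocalization.Away.isUnit_of_dvd g h)

lemma awayToAway_comp {f g h : R} (hfg : f ∣ g) (hgh : g ∣ h) (x : Localization.Away f) :
    awayToAway hgh (awayToAway hfg x) = awayToAway (hfg.trans hgh) x := by
  have : (awayToAway hgh).comp (awayToAway hfg) = awayToAway (hfg.trans hgh) :=
    IsLocalization.algHom_ext (Submonoid.powers f) (by ext)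
  exact DFunLike.congr_fun this x

lemma awayToAway_derivation {f g : R} (h : f ∣ g) (D : Derivation K R R)
    (x : Localization.Away f) :
    locDerivation (Submonoid.powers g) D (awayToAway h x) =
      awayToAway h (locDerivation (Submonoid.powers f) D x) := by
  obtain ⟨⟨r, t⟩, hx⟩ := IsLocalization.surj (Submonoid.powers f) x
  dsimp only at hx
  have h1 := congrArg (fun y => locDerivation (Submonoid.powers g) D (awayToAway h y)) hx
  have h2 := congrArg (fun y => awayToAway h (locDerivation (Submonoid.powers f) D y)) hx
  simp only [map_mul, map_add, Derivation.leibniz, smul_eq_mul, AlgHom.commutes,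
    locDerivation_algebraMap] at h1 h2
  have hu : IsUnit (algebraMap R (Localization.Away g) t) := by
    have := (IsLocalization.map_units (Localization.Away f) t).map (awayToAway h)
    rwa [AlgHom.commutes] at this
  refine hu.mul_left_cancel ?_
  linear_combination h1 - h2

variable {s : ℕ}

/-- The cube `S ↦ R_{a_S}`, `a_S = ∏_{i ∈ S} a_i`, with the canonical maps `R_{a_S} → R_{a_T}`. -/
def cechCube (K : Type u) [Field K] [Algebra K R] (a : Fin s → R) : ModuleCube K (Fin s) where
  M S := Localization.Away (∏ i ∈ S, a i)
  φ i h := ((awayToAway (Finset.prod_dvd_prod_of_subset _ _ a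
    (h ▸ Finset.subset_insert i _))).restrictScalars K).toLinearMap
  comm i j _ _ _ _ x := by
    simp only [AlgHom.toLinearMap_apply, AlgHom.restrictScalars_apply, awayToAway_comp]

/-- The Čech complex `0 → R → ∏ R_{a_i} → ∏_{i < j} R_{a_i a_j} → ⋯ → R_{a_1 ⋯ a_s} → 0`. -/
def cechComplex (K : Type u) [Field K] [Algebra K R] (a : Fin s → R) :
    CochainComplex (ModuleCat.{u} K) ℕ :=
  (cechCube K a).complex

/-- The local cohomology `H^p_I(R)` for `I = (a_1, …, a_s)`. -/
abbrev cechCohomology (K : Type u) [Field K] [Algebra K R] (a : Fin s → R) (p : ℕ) :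
    ModuleCat.{u} K :=
  (cechComplex K a).homology p

/-- The action of a derivation `D` of `R` on the Čech complex, componentwise by the extension of
`D` to the localizations of `R`. -/
def cechDerivation (a : Fin s → R) (D : Derivation K R R) : cechComplex K a ⟶ cechComplex K a :=
  (cechCube K a).complexEnd
    (fun S => (locDerivation (Submonoid.powers (∏ i ∈ S, a i)) D).toLinearMap)
    (fun i h x => awayToAway_derivation (Finset.prod_dvd_prod_of_subset _ _ a
      (h ▸ Finset.subset_insert i _)) D x)

lemma cechDerivation_comm (a : Fin s → R) (D E : Derivation K R R)
    (h : ∀ r, D (E r) = E (D r)) :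
    cechDerivation a D ≫ cechDerivation a E = cechDerivation a E ≫ cechDerivation a D := by
  refine HomologicalComplex.hom_ext _ _ fun p => ModuleCat.hom_ext (LinearMap.ext fun f =>
    funext fun S => ?_)
  exact (locDerivation_comm (Submonoid.powers (∏ i ∈ S.1, a i)) D E h (f S)).symm

/-- The action of a derivation of `R` on the local cohomology. -/
def cechCohomologyDerivation (a : Fin s → R) (p : ℕ) (D : Derivation K R R) :
    cechCohomology K a p →ₗ[K] cechCohomology K a p :=
  (HomologicalComplex.homologyMap (cechDerivation a D) p).hom

lemma cechCohomologyDerivation_comm (a : Fin s → R) (p : ℕ) (D E : Derivation K R R)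
    (h : ∀ r, D (E r) = E (D r)) (x : cechCohomology K a p) :
    cechCohomologyDerivation a p D (cechCohomologyDerivation a p E x) =
      cechCohomologyDerivation a p E (cechCohomologyDerivation a p D x) := by
  have := congrArg (fun f : cechComplex K a ⟶ cechComplex K a =>
    HomologicalComplex.homologyMap f p) (cechDerivation_comm a E D fun r => (h r).symm)
  simp only [HomologicalComplex.homologyMap_comp] at this
  exact LinearMap.congr_fun (congrArg ModuleCat.Hom.hom this) x

end Cech

/-! ### The objects of the theorem -/

section Main

variable {K : Type u} [Field K] {n s : ℕ}

lemma pderiv_comm (i j : Fin n) (f : MvPolynomial (Fin n) K) :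
    MvPolynomial.pderiv i (MvPolynomial.pderiv j f) =
      MvPolynomial.pderiv j (MvPolynomial.pderiv i f) := by
  have : ⁅(MvPolynomial.pderiv i : Derivation K (MvPolynomial (Fin n) K) _),
      (MvPolynomial.pderiv j : Derivation K (MvPolynomial (Fin n) K) _)⁆ = 0 := by
    refine MvPolynomial.derivation_ext fun k => ?_
    simp [Derivation.commutator_apply, MvPolynomial.pderiv_X, Pi.single_apply, apply_ite]
  have := DFunLike.congr_fun this f
  rwa [Derivation.commutator_apply, Derivation.zero_apply, sub_eq_zero] at this

/-- The operators `∂₁, …, ∂ₙ` of the Weyl algebra on `H^p_I(K[X_1, …, X_n])`,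
`I = (a_1, …, a_s)`. -/
def localCohomologyPartial (a : Fin s → MvPolynomial (Fin n) K) (p : ℕ) (i : Fin n) :
    cechCohomology K a p →ₗ[K] cechCohomology K a p :=
  cechCohomologyDerivation a p (MvPolynomial.pderiv i)

/-- The de Rham cohomology `H^j(∂₁, …, ∂ₙ; H^p_I(K[X_1, …, X_n]))`, `I = (a_1, …, a_s)`. -/
abbrev deRhamLocalCohomology (a : Fin s → MvPolynomial (Fin n) K) (p j : ℕ) : ModuleCat.{u} K :=
  deRhamCohomology (localCohomologyPartial a p)
    (fun i k x => cechCohomologyDerivation_comm a p _ _ (pderiv_comm i k) x) j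

/-- The projective variety of a homogeneous ideal `I` of `K[X_1, …, X_n]` in `P^{n-1}(L)`. As `I`
is homogeneous, vanishing does not depend on the vector `p.rep` of homogeneous coordinates. -/
def projVariety (L : Type v) [Field L] [Algebra K L] (I : Ideal (MvPolynomial (Fin n) K)) :
    Set (Projectivization L (Fin n → L)) :=
  {p | ∀ f ∈ I, MvPolynomial.aeval p.rep f = 0}

end Main

end

/-! Write n = r + 1. The zero set of I over L is a finite non-empty union of lines through the
origin. The prime of such a line has height at most r and contains the extension of I to L, whose
height is at least r by flatness; so it is one of finitely many minimal primes. If there were no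
line, the Nullstellensatz would put every variable into the radical of I and force height r + 1.
(`finite_projVariety`, `nonempty_projVariety`.) Čech and de Rham cohomology are compatible with the
extension K → L (`IsScalarExt`), so the dimensions may be computed over L, where Čech cohomology
depends only on zero sets (`projOp_bijective`).

All dimensions below are those of de Rham cohomology in degrees (r, r + 1); the lower degrees always
vanish. There are two local computations. In linear coordinates y adapted to a line, or to the
origin, Čech cohomology lives in a single degree and, by partial fractions, has a basis of products
of (-1)^a a! / y^(a+1) for the inverted coordinates and y^a for the others. There ∂/∂y acts as
multiplication by a variable on the first kind and as a derivative on the second (a Fourier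
transform). So the de Rham complex becomes the Koszul complex of a polynomial ring with operators
X_i for i ≠ k and, up to a linear combination of these, ∂_k for the line or X_k for the origin. A
Cartan homotopy with the Euler operator in the variables other than X_k reduces it to constants: the
line has dimensions (1, 0), the origin (0, 1) (`hasDims_resOp_erase`, `hasDims_resOp_univ`).

The theorem follows by induction on the points (`hasDims_add_point`, `coneDims`). Let N_Z be the
local cohomology of degree r at the cone over Z, let p be a new point, and let h vanish on the cone
over Z but on the line ℓ of p only at the origin. Then 0 → N_Z → N_{Z ∪ p} → (N_ℓ)_h → 0 and 0 → N_ℓ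
→ (N_ℓ)_h → H^{r+1}_{origin} → 0 are exact. The second gives (N_ℓ)_h the dimensions (1, 1), and
shows that N_ℓ → (N_ℓ)_h is onto on de Rham cohomology of degree r. This map factors through N_{Z ∪
p}, so the connecting map of the first sequence vanishes and dimensions add. Each point after the
first therefore adds (1, 1) to (1, 0), which gives (#Z, #Z - 1). -/

noncomputable section
open CategoryTheory

/-! ### Maps of cubes and cohomology -/

namespace ModuleCube

variable {K : Type u} [Field K] {ι : Type} [LinearOrder ι]

/-- A map of commutative cubes. -/
structure Hom (C C' : ModuleCube K ι) where
  app : ∀ S, C.M S →ₗ[K] C'.M S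
  naturality : ∀ {S T : Finset ι} (i : ι) (h : insert i S = T) (x : C.M S),
    app T (C.φ i h x) = C'.φ i h (app S x)

namespace Hom

variable {C C' C'' : ModuleCube K ι}

/-- The map of complexes induced by a map of cubes. -/
def map (α : Hom C C') : C.complex ⟶ C'.complex where
  f p := ModuleCat.ofHom (LinearMap.pi fun S => α.app S.1 ∘ₗ LinearMap.proj S)
  comm' p q h := by
    have h1 : p + 1 = q := h
    simp only [complex, dif_pos h1]
    refine ModuleCat.hom_ext (LinearMap.ext fun f => funext fun T => ?_)
    change C'.diff h1 (fun S => α.app S.1 (f S)) T = α.app T.1 (C.diff h1 f T)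
    rw [diff_apply, diff_apply, map_sum]
    refine Finset.sum_congr rfl fun i _ => ?_
    rw [map_zsmul, α.naturality]

/-- The composition of maps of cubes. -/
def comp (α : Hom C C') (β : Hom C' C'') : Hom C C'' where
  app S := β.app S ∘ₗ α.app S
  naturality i h x := by simp [α.naturality, β.naturality]

lemma map_comp (α : Hom C C') (β : Hom C' C'') : (α.comp β).map = α.map ≫ β.map := rfl

lemma map_congr {α β : Hom C C'} (h : ∀ S x, α.app S x = β.app S x) : α.map = β.map := by
  refine HomologicalComplex.hom_ext _ _ fun p => ModuleCat.hom_ext (LinearMap.ext fun f =>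
    funext fun S => ?_)
  exact h _ _

end Hom

/-- The cohomology of the complex of a cube. -/
abbrev H (C : ModuleCube K ι) (p : ℕ) : ModuleCat.{u} K := C.complex.homology p

namespace Hom

variable {C C' C'' D D' : ModuleCube K ι}

/-- The map in cohomology induced by a map of cubes. -/
def H (α : Hom C C') (p : ℕ) : C.H p →ₗ[K] C'.H p := (HomologicalComplex.homologyMap α.map p).hom

lemma H_comp (α : Hom C C') (β : Hom C' C'') (p : ℕ) (x : C.H p) :
    (α.comp β).H p x = β.H p (α.H p x) := by
  simp only [H, map_comp, HomologicalComplex.homologyMap_comp, ModuleCat.hom_comp,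
    LinearMap.comp_apply]

lemma H_congr {α β : Hom C C'} (h : ∀ S x, α.app S x = β.app S x) (p : ℕ) (x : C.H p) :
    α.H p x = β.H p x := by
  rw [H, H, map_congr h]

lemma H_id (α : Hom C C) (h : ∀ S x, α.app S x = x) (p : ℕ) (x : C.H p) : α.H p x = x := by
  have : α.map = 𝟙 _ := by
    refine HomologicalComplex.hom_ext _ _ fun p => ModuleCat.hom_ext (LinearMap.ext fun f =>
      funext fun S => ?_)
    exact h _ _
  rw [H, this, HomologicalComplex.homologyMap_id]
  rfl

/-- Commutative squares of maps of cubes give commutative squares in cohomology. -/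
lemma H_comm {α : Hom C C'} {β : Hom C' D'} {γ : Hom C D} {δ : Hom D D'}
    (h : ∀ S x, β.app S (α.app S x) = δ.app S (γ.app S x)) (p : ℕ) (x : C.H p) :
    β.H p (α.H p x) = δ.H p (γ.H p x) := by
  rw [← H_comp, ← H_comp]
  exact H_congr h p x

end Hom

/-! ### The long exact sequence -/

/-- A short exact sequence of cubes. -/
structure SES (C₁ C₂ C₃ : ModuleCube K ι) where
  f : Hom C₁ C₂
  g : Hom C₂ C₃
  inj : ∀ S, Function.Injective (f.app S)
  exact : ∀ S, Function.Exact (f.app S) (g.app S)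
  surj : ∀ S, Function.Surjective (g.app S)

namespace SES

variable {C₁ C₂ C₃ C₁' C₂' C₃' : ModuleCube K ι} (s : SES C₁ C₂ C₃)

/-- The short complex of cochain complexes. -/
def sc : ShortComplex (CochainComplex (ModuleCat.{u} K) ℕ) :=
  ShortComplex.mk s.f.map s.g.map (by
    refine HomologicalComplex.hom_ext _ _ fun p => ModuleCat.hom_ext (LinearMap.ext fun f =>
      funext fun S => ?_)
    exact (s.exact S.1).apply_apply_eq_zero (f S))

lemma shortExact : s.sc.ShortExact := by
  refine HomologicalComplex.shortExact_of_degreewise_shortExact _ fun p => ?_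
  refine ModuleCat.shortComplex_shortExact _ ?_ ?_ ?_
  · intro x
    constructor
    · intro hx
      have : ∀ S, ∃ y, s.f.app S.1 y = x S := fun S =>
        (s.exact S.1 (x S)).1 (congrFun hx S)
      choose y hy using this
      exact ⟨y, funext hy⟩
    · rintro ⟨y, rfl⟩
      funext S
      exact (s.exact S.1).apply_apply_eq_zero (y S)
  · intro x y h
    funext S
    exact s.inj S.1 (congrFun h S)
  · intro x
    choose y hy using fun S : {S : Finset ι // S.card = p} => s.surj S.1 (x S)
    exact ⟨y, funext hy⟩

/-- The connecting homomorphism. -/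
def δ (p : ℕ) : C₃.H p →ₗ[K] C₁.H (p + 1) := (s.shortExact.δ p (p + 1) rfl).hom

lemma exact₁ (p : ℕ) : Function.Exact (s.δ p) (s.f.H (p + 1)) :=
  (ShortComplex.ShortExact.moduleCat_exact_iff_function_exact _).1
    (s.shortExact.homology_exact₁ p (p + 1) rfl)

lemma exact₂ (p : ℕ) : Function.Exact (s.f.H p) (s.g.H p) :=
  (ShortComplex.ShortExact.moduleCat_exact_iff_function_exact _).1
    (s.shortExact.homology_exact₂ p)

lemma exact₃ (p : ℕ) : Function.Exact (s.g.H p) (s.δ p) :=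
  (ShortComplex.ShortExact.moduleCat_exact_iff_function_exact _).1
    (s.shortExact.homology_exact₃ p (p + 1) rfl)

variable (s' : SES C₁' C₂' C₃')

/-- Applied to a sequence and itself, with the action of a derivation as vertical maps, this makes
the connecting map linear over the ∂_i; applied to projections it compares the sequences of two
families of equations. -/
lemma δ_naturality (α : Hom C₁ C₁') (β : Hom C₂ C₂') (γ : Hom C₃ C₃')
    (h : ∀ S x, s'.f.app S (α.app S x) = β.app S (s.f.app S x))
    (h' : ∀ S x, s'.g.app S (β.app S x) = γ.app S (s.g.app S x)) (p : ℕ) (x : C₃.H p) :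
    α.H (p + 1) (s.δ p x) = s'.δ p (γ.H p x) := by
  let Φ : s.sc ⟶ s'.sc :=
    { τ₁ := α.map
      τ₂ := β.map
      τ₃ := γ.map
      comm₁₂ := Hom.map_congr (α := α.comp s'.f) (β := s.f.comp β) h
      comm₂₃ := Hom.map_congr (α := β.comp s'.g) (β := s.g.comp γ) h' }
  have := HomologicalComplex.HomologySequence.δ_naturality Φ s.shortExact s'.shortExact p (p + 1) rfl
  exact LinearMap.congr_fun (congrArg ModuleCat.Hom.hom this) x

end SES

end ModuleCube
end

noncomputable section
open CategoryTheory

namespace ModuleCube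

variable {K : Type u} [Field K] {ι : Type} [LinearOrder ι]

/-! ### Cocycles and coboundaries -/

section Cocycles

variable (C : ModuleCube K ι)

/-- The cocycles of degree `p`. -/
abbrev Z (p : ℕ) : Submodule K (C.Term p) := LinearMap.ker (C.diff (rfl : p + 1 = p + 1))

/-- The coboundaries of degree `p`. -/
def bd : (p : ℕ) → Submodule K (C.Term p)
  | 0 => ⊥
  | p + 1 => LinearMap.range (C.diff (rfl : p + 1 = p + 1))

lemma complex_d_succ (p : ℕ) : C.complex.d p (p + 1) = ModuleCat.ofHom (C.diff rfl) := dif_pos rfl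

/-- The cohomology class of a cocycle. -/
def cls (p : ℕ) : C.Z p →ₗ[K] C.H p :=
  (C.complex.liftCycles (A := ModuleCat.of K (C.Z p)) (ModuleCat.ofHom (C.Z p).subtype) (p + 1)
    (CochainComplex.next ℕ p) (by
      rw [complex_d_succ]
      exact ModuleCat.hom_ext (LinearMap.ext fun z => z.2)) ≫ C.complex.homologyπ p).hom

lemma cls_surjective (p : ℕ) : Function.Surjective (C.cls p) := by
  intro x
  obtain ⟨c, rfl⟩ := (ModuleCat.epi_iff_surjective (C.complex.homologyπ p)).1 inferInstance x
  have hz : C.complex.iCycles p c ∈ C.Z p := by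
    have := LinearMap.congr_fun (congrArg ModuleCat.Hom.hom (C.complex.iCycles_d p (p + 1))) c
    rwa [complex_d_succ] at this
  refine ⟨⟨_, hz⟩, ?_⟩
  simp only [cls, ModuleCat.hom_comp, LinearMap.comp_apply]
  refine congrArg _ ((ModuleCat.mono_iff_injective (C.complex.iCycles p)).1 inferInstance ?_)
  exact LinearMap.congr_fun (congrArg ModuleCat.Hom.hom (C.complex.liftCycles_i
    (A := ModuleCat.of K (C.Z p)) (ModuleCat.ofHom (C.Z p).subtype) (p + 1)
    (CochainComplex.next ℕ p) _)) ⟨_, hz⟩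

/-- The predecessor of degree 0 is degree 0 itself, with zero differential, so a free q with `prev p
= q` covers both cases. -/
lemma cls_eq_zero_iff_prev (p q : ℕ) (hq : (ComplexShape.up ℕ).prev p = q) (z : C.Z p) :
    C.cls p z = 0 ↔ ∃ y : C.Term q, C.complex.d q p y = z.1 := by
  have hex : (ShortComplex.mk (C.complex.toCycles q p) (C.complex.homologyπ p)
      (C.complex.toCycles_comp_homologyπ q p)).Exact :=
    ShortComplex.exact_of_g_is_cokernel _ (C.complex.homologyIsCokernel q p hq)
  have hex := (ShortComplex.ShortExact.moduleCat_exact_iff_function_exact _).1 hex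
  simp only [cls, ModuleCat.hom_comp, LinearMap.comp_apply]
  refine (hex _).trans ?_
  have hi := (ModuleCat.mono_iff_injective (C.complex.iCycles p)).1 inferInstance
  refine exists_congr fun y => ?_
  rw [← hi.eq_iff]
  have h1 := LinearMap.congr_fun (congrArg ModuleCat.Hom.hom (C.complex.toCycles_i q p)) y
  have h2 := LinearMap.congr_fun (congrArg ModuleCat.Hom.hom (C.complex.liftCycles_i
    (A := ModuleCat.of K (C.Z p)) (ModuleCat.ofHom (C.Z p).subtype) (p + 1)
    (CochainComplex.next ℕ p) (by
      rw [complex_d_succ]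
      exact ModuleCat.hom_ext (LinearMap.ext fun z => z.2)))) z
  exact Eq.congr h1 h2

lemma cls_eq_zero_iff (p : ℕ) (z : C.Z p) : C.cls p z = 0 ↔ z.1 ∈ C.bd p := by
  cases p with
  | zero =>
    rw [cls_eq_zero_iff_prev C 0 0 CochainComplex.prev_nat_zero]
    have : C.complex.d 0 0 = 0 := C.complex.shape _ _ (by simp)
    rw [this]
    simp only [bd, Submodule.mem_bot]
    exact ⟨fun ⟨_, h⟩ => h.symm, fun h => ⟨0, h.symm⟩⟩
  | succ p =>
    rw [cls_eq_zero_iff_prev C (p + 1) p (CochainComplex.prev_nat_succ p), complex_d_succ]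
    rfl

lemma subsingleton_H_iff (p : ℕ) : Subsingleton (C.H p) ↔ C.Z p ≤ C.bd p := by
  constructor
  · intro h z hz
    exact (C.cls_eq_zero_iff p ⟨z, hz⟩).1 (Subsingleton.elim _ _)
  · intro h
    refine subsingleton_of_forall_eq 0 fun x => ?_
    obtain ⟨z, rfl⟩ := C.cls_surjective p x
    exact (C.cls_eq_zero_iff p z).2 (h z.2)

variable {C} in
lemma Hom.H_cls {C' : ModuleCube K ι} (α : Hom C C') (p : ℕ) (z : C.Z p) (z' : C'.Z p)
    (h : ∀ S, z'.1 S = α.app S.1 (z.1 S)) : α.H p (C.cls p z) = C'.cls p z' := by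
  simp only [cls, ModuleCat.hom_comp, LinearMap.comp_apply, Hom.H]
  have h1 := LinearMap.congr_fun (congrArg ModuleCat.Hom.hom
    (HomologicalComplex.homologyπ_naturality α.map p)) (C.complex.liftCycles
      (A := ModuleCat.of K (C.Z p)) (ModuleCat.ofHom (C.Z p).subtype) (p + 1)
      (CochainComplex.next ℕ p) (by
        rw [complex_d_succ]
        exact ModuleCat.hom_ext (LinearMap.ext fun z => z.2)) z)
  refine h1.trans ?_
  simp only [ModuleCat.hom_comp, LinearMap.comp_apply]
  refine congrArg _ ((ModuleCat.mono_iff_injective (C'.complex.iCycles p)).1 inferInstance ?_)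
  have h2 := LinearMap.congr_fun (congrArg ModuleCat.Hom.hom (C'.complex.liftCycles_i
    (A := ModuleCat.of K (C'.Z p)) (ModuleCat.ofHom (C'.Z p).subtype) (p + 1)
    (CochainComplex.next ℕ p) (by
      rw [complex_d_succ]
      exact ModuleCat.hom_ext (LinearMap.ext fun z => z.2)))) z'
  have h3 := LinearMap.congr_fun (congrArg ModuleCat.Hom.hom (C.complex.liftCycles_i
    (A := ModuleCat.of K (C.Z p)) (ModuleCat.ofHom (C.Z p).subtype) (p + 1)
    (CochainComplex.next ℕ p) (by
      rw [complex_d_succ]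
      exact ModuleCat.hom_ext (LinearMap.ext fun z => z.2)))) z
  have h4 := fun c => LinearMap.congr_fun (congrArg ModuleCat.Hom.hom
    (HomologicalComplex.cyclesMap_i α.map p)) c
  refine (h4 _).trans (Eq.trans ?_ h2.symm)
  refine (congrArg (α.map.f p) h3).trans ?_
  funext S
  exact (h S).symm

/-- A map of cubes sends cocycles to cocycles. -/
lemma Hom.mem_Z {C C' : ModuleCube K ι} (α : Hom C C') (p : ℕ) {z : C.Term p} (hz : z ∈ C.Z p) :
    (fun S => α.app S.1 (z S) : C'.Term p) ∈ C'.Z p := by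
  rw [LinearMap.mem_ker] at hz ⊢
  funext T
  have := congrArg (α.app T.1) (congrFun hz T)
  rw [diff_apply] at this ⊢
  rw [map_sum] at this
  simp only [map_zsmul, α.naturality] at this
  rw [this]
  simp

end Cocycles

/-! ### Cochains on all subsets -/

section Cochains

variable (C : ModuleCube K ι)

/-- The differential on families indexed by all finite subsets. -/
def d (f : ∀ S, C.M S) (T : Finset ι) : C.M T :=
  ∑ i : {i // i ∈ T}, sgn T i.1 • C.φ i.1 (Finset.insert_erase i.2) (f (T.erase i.1))

/-- The extension by zero of a cochain of degree `p`. -/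
def extend {p : ℕ} (f : C.Term p) (S : Finset ι) : C.M S :=
  if h : S.card = p then f ⟨S, h⟩ else 0

variable {C}

lemma extend_apply {p : ℕ} (f : C.Term p) (S : {S : Finset ι // S.card = p}) :
    C.extend f S.1 = f S := dif_pos S.2

lemma extend_of_ne {p : ℕ} (f : C.Term p) {S : Finset ι} (h : S.card ≠ p) :
    C.extend f S = 0 := dif_neg h

lemma d_extend {p q : ℕ} (h : p + 1 = q) (f : C.Term p) (T : {S : Finset ι // S.card = q}) :
    C.d (C.extend f) T.1 = C.diff h f T := by
  rw [diff_apply, d]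
  refine Finset.sum_congr rfl fun i _ => ?_
  rw [← extend_apply f]

lemma d_restrict {p q : ℕ} (h : p + 1 = q) (f : ∀ S, C.M S) (T : {S : Finset ι // S.card = q}) :
    C.diff h (fun S : {S : Finset ι // S.card = p} => f S.1) T = C.d f T.1 := by
  rw [diff_apply, d]

end Cochains

/-! ### Subquotients of a cube given by an interval of subsets -/

section Res

variable {C' : ModuleCube K ι} (C : ModuleCube K ι)

/-- The submodule of `C.M S` which is everything if `B ⊆ S ⊆ U` and zero otherwise. -/
def resSub (B U S : Finset ι) : Submodule K (C.M S) where
  carrier := {x | ¬ (B ⊆ S ∧ S ⊆ U) → x = 0}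
  add_mem' hx hy h := by rw [hx h, hy h, add_zero]
  zero_mem' _ := rfl
  smul_mem' c x hx h := by rw [hx h, smul_zero]

/-- The cube which agrees with `C` on the interval of subsets `B ⊆ S ⊆ U` and is zero on the
other subsets. -/
def res (B U : Finset ι) : ModuleCube K ι where
  M S := C.resSub B U S
  -- Subsets containing B are closed under enlargement, so they form a subcube; only leaving U has
  -- to be cut off, as in a quotient.
  φ {S T} i h := LinearMap.codRestrict _ ((if T ⊆ U then C.φ i h else 0) ∘ₗ Submodule.subtype _)
    (by
      intro x hx
      by_cases hT : T ⊆ U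
      · have : x.1 = 0 := x.2 fun h' => hx ⟨h'.1.trans (h ▸ Finset.subset_insert i S), hT⟩
        simp [this]
      · simp [hT])
  comm {S A B' T} i j hA hAT hB hBT x := by
    refine Subtype.ext ?_
    by_cases hT : T ⊆ U
    · have h1 : A ⊆ U := (hAT ▸ Finset.subset_insert j A : A ⊆ T).trans hT
      have h2 : B' ⊆ U := (hBT ▸ Finset.subset_insert i B' : B' ⊆ T).trans hT
      simpa [hT, h1, h2] using C.comm i j hA hAT hB hBT x.1
    · simp [hT]

variable {C}

/-- The inclusion of the terms of a subquotient cube. -/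
def resVal {B U S : Finset ι} : (C.res B U).M S →ₗ[K] C.M S := (C.resSub B U S).subtype

/-- A linear map into `C.M S` which vanishes unless `B ⊆ S ⊆ U` takes values in the subquotient. -/
def resLift {V : Type*} [AddCommGroup V] [Module K V] {B U S : Finset ι} (f : V →ₗ[K] C.M S)
    (h : ∀ v, ¬ (B ⊆ S ∧ S ⊆ U) → f v = 0) : V →ₗ[K] (C.res B U).M S :=
  LinearMap.codRestrict (C.resSub B U S) f h

/-- An element of `C.M S`, which vanishes unless `B ⊆ S ⊆ U`, as an element of the subquotient. -/
def resMk {B U S : Finset ι} (x : C.M S) (h : ¬ (B ⊆ S ∧ S ⊆ U) → x = 0) : (C.res B U).M S :=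
  ⟨x, h⟩

@[simp] lemma resVal_lift {V : Type*} [AddCommGroup V] [Module K V] {B U S : Finset ι}
    (f : V →ₗ[K] C.M S) (h : ∀ v, ¬ (B ⊆ S ∧ S ⊆ U) → f v = 0) (v : V) :
    resVal (resLift f h v) = f v := rfl

@[simp] lemma resVal_mk {B U S : Finset ι} (x : C.M S) (h : ¬ (B ⊆ S ∧ S ⊆ U) → x = 0) :
    resVal (resMk x h) = x := rfl

lemma resVal_injective {B U S : Finset ι} :
    Function.Injective (resVal : (C.res B U).M S →ₗ[K] C.M S) := Subtype.val_injective

lemma resVal_eq_zero {B U S : Finset ι} (hS : ¬ (B ⊆ S ∧ S ⊆ U)) (x : (C.res B U).M S) :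
    resVal x = 0 := x.2 hS

lemma res_eq_zero {B U S : Finset ι} (hS : ¬ (B ⊆ S ∧ S ⊆ U)) (x : (C.res B U).M S) : x = 0 :=
  resVal_injective (by rw [resVal_eq_zero hS, map_zero])

lemma resVal_φ {B U S T : Finset ι} (i : ι) (h : insert i S = T) (hT : T ⊆ U)
    (x : (C.res B U).M S) : resVal ((C.res B U).φ i h x) = C.φ i h (resVal x) := by
  change (if T ⊆ U then C.φ i h else 0) (resVal x) = _
  rw [if_pos hT]

/-- The map of subquotient cubes induced by a map of cubes. -/
def resMap (α : Hom C C') (B U : Finset ι) : Hom (C.res B U) (C'.res B U) where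
  app S := resLift (α.app S ∘ₗ resVal) fun x h => by
    rw [LinearMap.comp_apply, resVal_eq_zero h, map_zero]
  naturality {S T} i h x := by
    by_cases hT : T ⊆ U
    · refine resVal_injective ?_
      rw [resVal_φ i h hT, resVal_lift, resVal_lift, LinearMap.comp_apply, LinearMap.comp_apply,
        resVal_φ i h hT, α.naturality]
    · rw [res_eq_zero (fun h => hT h.2) ((C'.res B U).φ i h _)]
      exact res_eq_zero (fun h => hT h.2) _

/-- The inclusion, for `B ⊆ B'`. -/
def resIncl {B B' : Finset ι} (h : B ⊆ B') (U : Finset ι) : Hom (C.res B' U) (C.res B U) where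
  app S := resLift resVal fun x h' => resVal_eq_zero (fun h'' => h' ⟨h.trans h''.1, h''.2⟩) x
  naturality {S T} i h x := by
    by_cases hT : T ⊆ U
    · refine resVal_injective ?_
      rw [resVal_φ i h hT, resVal_lift, resVal_lift, resVal_φ i h hT]
    · rw [res_eq_zero (fun h => hT h.2) ((C.res B U).φ i h _)]
      exact res_eq_zero (fun h => hT h.2) _

/-- The projection, for `U' ⊆ U`. -/
def resProj (B : Finset ι) {U U' : Finset ι} (h : U' ⊆ U) : Hom (C.res B U) (C.res B U') where
  app S := resLift ((if S ⊆ U' then LinearMap.id else 0) ∘ₗ resVal) fun x hx => by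
    by_cases hS : S ⊆ U'
    · rw [LinearMap.comp_apply, resVal_eq_zero (fun h' => hx ⟨h'.1, hS⟩), map_zero]
    · rw [if_neg hS, LinearMap.zero_comp, LinearMap.zero_apply]
  naturality {S T} i hi x := by
    by_cases hT : T ⊆ U'
    · have hS : S ⊆ U' := (hi ▸ Finset.subset_insert i S : S ⊆ T).trans hT
      refine resVal_injective ?_
      rw [resVal_φ i hi hT, resVal_lift, resVal_lift, if_pos hT, if_pos hS, LinearMap.id_comp,
        LinearMap.id_comp, resVal_φ i hi (hT.trans h)]
    · rw [res_eq_zero (fun h => hT h.2) ((C.res B U').φ i hi _)]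
      exact res_eq_zero (fun h => hT h.2) _

@[simp] lemma resVal_resMap (α : Hom C C') (B U S : Finset ι) (x : (C.res B U).M S) :
    resVal ((resMap α B U).app S x) = α.app S (resVal x) := rfl

@[simp] lemma resVal_resIncl {B B' : Finset ι} (h : B ⊆ B') (U S : Finset ι)
    (x : (C.res B' U).M S) : resVal ((resIncl h U).app S x) = resVal x := rfl

lemma resVal_resProj (B : Finset ι) {U U' : Finset ι} (h : U' ⊆ U) (S : Finset ι)
    (x : (C.res B U).M S) : resVal ((resProj B h).app S x) = if S ⊆ U' then resVal x else 0 := by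
  change ((if S ⊆ U' then LinearMap.id else 0) ∘ₗ resVal) x = _
  split_ifs <;> rfl

/-- The short exact sequence which separates the subsets containing `k` from the others. -/
def resSES (C : ModuleCube K ι) (B U : Finset ι) (k : ι) (hk : k ∉ U) :
    SES (C.res (insert k B) (insert k U)) (C.res B (insert k U)) (C.res B U) where
  f := resIncl (Finset.subset_insert k B) _
  g := resProj B (Finset.subset_insert k U)
  inj S x y h := resVal_injective (by simpa using congrArg resVal h)
  exact S x := by
    constructor
    · intro hx
      refine ⟨resMk (resVal x) fun h => ?_, resVal_injective rfl⟩
      by_cases hS : S ⊆ U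
      · have := congrArg resVal hx
        rwa [resVal_resProj, if_pos hS, map_zero] at this
      · refine resVal_eq_zero (fun h' => h ⟨Finset.insert_subset ?_ h'.1, h'.2⟩) x
        by_contra hkS
        refine hS fun j hj => ?_
        rcases Finset.mem_insert.1 (h'.2 hj) with rfl | hj'
        · exact absurd hj hkS
        · exact hj'
    · rintro ⟨y, rfl⟩
      refine resVal_injective ?_
      rw [resVal_resProj, map_zero]
      split_ifs with hS
      · exact resVal_eq_zero (fun h => hk (hS (h.1 (Finset.mem_insert_self k B)))) y
      · rfl
  surj S x := by
    refine ⟨resMk (resVal x) fun h => resVal_eq_zero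
      (fun h' => h ⟨h'.1, h'.2.trans (Finset.subset_insert k U)⟩) x, resVal_injective ?_⟩
    rw [resVal_resProj]
    split_ifs with hS
    · rfl
    · exact (resVal_eq_zero (fun h => hS h.2) x).symm

lemma resVal_d {B U : Finset ι} (f : ∀ S, (C.res B U).M S) (T : Finset ι) (hT : T ⊆ U) :
    resVal ((C.res B U).d f T) = C.d (fun S => resVal (f S)) T := by
  rw [d, d, map_sum]
  refine Finset.sum_congr rfl fun i _ => ?_
  rw [map_zsmul, resVal_φ i.1 (Finset.insert_erase i.2) hT]

lemma d_extend_of_ne {p : ℕ} (z : C.Term p) {T : Finset ι} (hc : T.card ≠ p + 1) :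
    C.d (C.extend z) T = 0 := by
  rw [d]
  refine Finset.sum_eq_zero fun i _ => ?_
  rw [extend_of_ne z, map_zero, smul_zero]
  rw [Finset.card_erase_of_mem i.2]
  have := Finset.card_pos.2 ⟨i.1, i.2⟩
  omega

/-- Criterion for the vanishing of the cohomology of a subquotient cube. -/
lemma subsingleton_res_H (B U : Finset ι) (p : ℕ)
    (H : ∀ f : ∀ S, C.M S, (∀ S, ¬ (B ⊆ S ∧ S ⊆ U) → f S = 0) → (∀ S, S.card ≠ p → f S = 0) →
      (∀ T, T ⊆ U → C.d f T = 0) →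
      ∃ g : ∀ S, C.M S, (∀ S, ¬ (B ⊆ S ∧ S ⊆ U) → g S = 0) ∧ (∀ S, S.card + 1 ≠ p → g S = 0) ∧
        ∀ T, T ⊆ U → C.d g T = f T) : Subsingleton ((C.res B U).H p) := by
  rw [subsingleton_H_iff]
  intro z hz
  obtain ⟨g, hg1, hg2, hg3⟩ := H (fun S => resVal ((C.res B U).extend z S))
    (fun S hS => resVal_eq_zero hS _)
    (fun S hS => by rw [extend_of_ne z hS, map_zero])
    (fun T hT => by
      rw [← resVal_d _ T hT]
      by_cases hc : T.card = p + 1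
      · rw [d_extend rfl z ⟨T, hc⟩, LinearMap.mem_ker.1 hz, Pi.zero_apply, map_zero]
      · rw [d_extend_of_ne z hc, map_zero])
  cases p with
  | zero =>
    have h0 : g = 0 := funext fun S => hg2 S (by omega)
    rw [bd, Submodule.mem_bot]
    funext S
    refine resVal_injective ?_
    rw [Pi.zero_apply, map_zero]
    by_cases hS : S.1 ⊆ U
    · have := hg3 S.1 hS
      rw [extend_apply z S] at this
      rw [← this, h0, d]
      exact Finset.sum_eq_zero fun i _ => by simp
    · exact resVal_eq_zero (fun h => hS h.2) _
  | succ p =>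
    let g' : ∀ S, (C.res B U).M S := fun S => resMk (g S) (hg1 S)
    refine ⟨fun S => g' S.1, funext fun T => resVal_injective ?_⟩
    by_cases hT : T.1 ⊆ U
    · rw [d_restrict rfl g' T, resVal_d _ _ hT]
      refine (hg3 T.1 hT).trans ?_
      rw [extend_apply z T]
    · rw [resVal_eq_zero (fun h => hT h.2), resVal_eq_zero (fun h => hT h.2)]

/-- The converse of `subsingleton_res_H`. -/
lemma exists_of_subsingleton_res_H (B U : Finset ι) (p : ℕ) (h : Subsingleton ((C.res B U).H p))
    (f : ∀ S, C.M S) (hf1 : ∀ S, ¬ (B ⊆ S ∧ S ⊆ U) → f S = 0) (hf2 : ∀ S, S.card ≠ p → f S = 0)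
    (hf3 : ∀ T, T ⊆ U → C.d f T = 0) :
    ∃ g : ∀ S, C.M S, (∀ S, ¬ (B ⊆ S ∧ S ⊆ U) → g S = 0) ∧ (∀ S, S.card + 1 ≠ p → g S = 0) ∧
        ∀ T, T ⊆ U → C.d g T = f T := by
  rw [subsingleton_H_iff] at h
  let f' : ∀ S, (C.res B U).M S := fun S => resMk (f S) (hf1 S)
  have hz : (fun S => f' S.1 : (C.res B U).Term p) ∈ (C.res B U).Z p := by
    refine LinearMap.mem_ker.2 (funext fun T => ?_)
    rw [d_restrict rfl f' T]
    by_cases hT : T.1 ⊆ U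
    · refine resVal_injective ?_
      rw [resVal_d _ _ hT, Pi.zero_apply, map_zero]
      exact hf3 _ hT
    · exact res_eq_zero (fun h => hT h.2) _
  have hb := h hz
  cases p with
  | zero =>
    refine ⟨0, fun _ _ => rfl, fun _ _ => rfl, fun T hT => ?_⟩
    have : f T = 0 := by
      by_cases hc : T.card = 0
      · have := congrArg resVal (congrFun ((Submodule.mem_bot K).1 hb) ⟨T, hc⟩)
        rwa [Pi.zero_apply, map_zero] at this
      · exact hf2 T hc
    rw [this, d]
    exact Finset.sum_eq_zero fun i _ => by simp
  | succ p =>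
    obtain ⟨g, hg⟩ := hb
    refine ⟨fun S => resVal ((C.res B U).extend g S), fun S hS => resVal_eq_zero hS _,
      fun S hS => by dsimp only; rw [extend_of_ne g (by omega), map_zero], fun T hT => ?_⟩
    rw [← resVal_d _ _ hT]
    by_cases hc : T.card = p + 1
    · rw [d_extend rfl g ⟨T, hc⟩, hg]
      rfl
    · rw [d_extend_of_ne g hc, map_zero, hf2 T hc]

end Res

end ModuleCube
end

noncomputable section
open CategoryTheory

namespace ModuleCube

variable {K : Type u} [Field K] {ι : Type} [LinearOrder ι]

/-! ### Signs -/

lemma sgn_mul_self (T : Finset ι) (i : ι) : sgn T i * sgn T i = 1 := by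
  rw [sgn, ← pow_add, ← two_mul, pow_mul]
  simp

lemma sgn_insert_self (T : Finset ι) (i : ι) : sgn (insert i T) i = sgn T i := by
  rw [sgn, sgn, Finset.filter_insert, if_neg (lt_irrefl i)]

lemma sgn_erase_self (T : Finset ι) (i : ι) : sgn (T.erase i) i = sgn T i := by
  rw [← sgn_insert_self (T.erase i)]
  by_cases h : i ∈ T
  · rw [Finset.insert_erase h]
  · rw [Finset.erase_eq_of_notMem h, sgn_insert_self]

/-- This is `sgn_erase_mul` for the set T ∪ {i}. It is the sign change which makes the mixed terms
of every homotopy formula below cancel. -/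
lemma sgn_mul_sgn_erase {T : Finset ι} {i j : ι} (hi : i ∉ T) (hj : j ∈ T) :
    sgn T j * sgn (T.erase j) i = -(sgn T i * sgn (insert i T) j) := by
  have hij : i ≠ j := fun h => hi (h ▸ hj)
  have h := sgn_erase_mul (insert i T) (Finset.mem_insert_self i T) (Finset.mem_insert_of_mem hj) hij
  rw [Finset.erase_insert hi, sgn_insert_self, Finset.erase_insert_of_ne hij, sgn_insert_self] at h
  have h1 := sgn_mul_self T i
  have h2 := sgn_mul_self T j
  have h3 := sgn_mul_self (insert i T) j
  have h4 := sgn_mul_self (T.erase j) i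
  calc sgn T j * sgn (T.erase j) i
      = (sgn T i * sgn T j) * (sgn T i * sgn (T.erase j) i) := by
        linear_combination (-(sgn T j * sgn (T.erase j) i)) * h1
    _ = -(sgn T i * sgn (insert i T) j) := by
        linear_combination (sgn T i * sgn (T.erase j) i) * h - (sgn T i * sgn (insert i T) j) * h4

/-! ### Čech cubes -/

section IsCech

variable {R : Type*} [CommRing R]

/-- A cube of `R`-modules in which adding `i` is the localization at `t i`. -/
structure IsCech (C : ModuleCube K ι) [∀ S, Module R (C.M S)] (t : ι → R) : Prop where
  φ_smul : ∀ {S T : Finset ι} (i : ι) (h : insert i S = T) (r : R) (x : C.M S),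
    C.φ i h (r • x) = r • C.φ i h x
  exists_lift : ∀ {S T : Finset ι} (i : ι) (h : insert i S = T) (x : C.M T),
    ∃ (N : ℕ) (y : C.M S), C.φ i h y = t i ^ N • x
  exists_kill : ∀ {S T : Finset ι} (i : ι) (h : insert i S = T) (y : C.M S), C.φ i h y = 0 →
    ∃ N : ℕ, t i ^ N • y = 0
  bijective : ∀ {S : Finset ι} (i : ι), i ∈ S → Function.Bijective fun x : C.M S => t i • x

variable {C : ModuleCube K ι}

lemma φ_family_congr {S S' T : Finset ι} (f : ∀ S, C.M S) (i : ι) (e : S = S')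
    (h : insert i S = T) (h' : insert i S' = T) : C.φ i h (f S) = C.φ i h' (f S') := by
  subst e
  rfl

lemma d_eq_sum (f : ∀ S, C.M S) (T : Finset ι) :
    C.d f T = ∑ j ∈ T, if h : j ∈ T then
      sgn T j • C.φ j (Finset.insert_erase h) (f (T.erase j)) else 0 := by
  rw [d, ← Finset.sum_coe_sort T]
  exact Finset.sum_congr rfl fun i _ => by rw [dif_pos i.2]

lemma d_insert (f : ∀ S, C.M S) {T : Finset ι} {i : ι} (hi : i ∉ T) :
    C.d f (insert i T) = sgn T i • C.φ i rfl (f T) +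
      ∑ j : {j // j ∈ T}, sgn (insert i T) j.1 •
        C.φ j.1 (Finset.insert_erase (Finset.mem_insert_of_mem j.2)) (f ((insert i T).erase j.1)) := by
  rw [d_eq_sum, Finset.sum_insert hi, dif_pos (Finset.mem_insert_self i T), sgn_insert_self,
    φ_family_congr f i (Finset.erase_insert hi) _ rfl, ← Finset.sum_coe_sort T]
  congr 1
  exact Finset.sum_congr rfl fun j _ => by rw [dif_pos (Finset.mem_insert_of_mem j.2)]

lemma d_eq_single (f : ∀ S, C.M S) {T : Finset ι} {i : ι} (hi : i ∈ T)
    (hf : ∀ j ∈ T, j ≠ i → f (T.erase j) = 0) :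
    C.d f T = sgn T i • C.φ i (Finset.insert_erase hi) (f (T.erase i)) := by
  rw [d, Finset.sum_eq_single ⟨i, hi⟩]
  · intro j _ hj
    rw [hf j.1 j.2 fun h => hj (Subtype.ext h), map_zero, smul_zero]
  · intro h
    exact absurd (Finset.mem_univ _) h

lemma d_eq_zero (f : ∀ S, C.M S) {T : Finset ι} (hf : ∀ j ∈ T, f (T.erase j) = 0) :
    C.d f T = 0 := by
  rw [d]
  refine Finset.sum_eq_zero fun j _ => ?_
  rw [hf j.1 j.2, map_zero, smul_zero]

lemma d_add (f g : ∀ S, C.M S) (T : Finset ι) :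
    C.d (fun S => f S + g S) T = C.d f T + C.d g T := by
  simp only [d, map_add, smul_add, Finset.sum_add_distrib]

variable [∀ S, Module R (C.M S)] {t : ι → R} (hC : IsCech C t)

include hC

namespace IsCech

lemma d_smul (r : R) (f : ∀ S, C.M S) (T : Finset ι) :
    C.d (fun S => r • f S) T = r • C.d f T := by
  simp only [d, Finset.smul_sum, hC.φ_smul]
  exact Finset.sum_congr rfl fun i _ => smul_comm _ _ _

/-- Only finitely many S lie in U, so the largest exponent serves all of them; each lift is
multiplied by the missing power of t i. The next lemma uses the same device for annihilators. -/
lemma exists_uniform_lift (U : Finset ι) (i : ι) (f : ∀ S, C.M S) :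
    ∃ (N : ℕ) (y : ∀ S, C.M S), ∀ {S T : Finset ι} (h : insert i S = T), S ⊆ U →
      C.φ i h (y S) = t i ^ N • f T := by
  choose N y hy using fun S => hC.exists_lift (S := S) i rfl (f (insert i S))
  refine ⟨U.powerset.sup N, fun S => t i ^ (U.powerset.sup N - N S) • y S, ?_⟩
  rintro S T rfl hS
  rw [hC.φ_smul, hy, smul_smul, ← pow_add, Nat.sub_add_cancel]
  exact Finset.le_sup (f := N) (Finset.mem_powerset.2 hS)

lemma exists_uniform_kill (U : Finset ι) (i : ι) (e : ∀ S, C.M S)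
    (he : ∀ S, S ⊆ U → C.φ i rfl (e S) = 0) : ∃ N : ℕ, ∀ S, S ⊆ U → t i ^ N • e S = 0 := by
  have : ∀ S, ∃ N : ℕ, S ⊆ U → t i ^ N • e S = 0 := by
    intro S
    by_cases hS : S ⊆ U
    · obtain ⟨N, hN⟩ := hC.exists_kill i rfl (e S) (he S hS)
      exact ⟨N, fun _ => hN⟩
    · exact ⟨0, fun h => absurd h hS⟩
  choose N hN using this
  refine ⟨U.powerset.sup N, fun S hS => ?_⟩
  rw [← Nat.sub_add_cancel (Finset.le_sup (f := N) (Finset.mem_powerset.2 hS)), pow_add, mul_smul,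
    hN S hS, smul_zero]

/-- The homotopy formula for a family `g` which is, up to sign, `r` times `f`, divided by the map
which adds `i`. -/
lemma φ_d_eq {T : Finset ι} {i : ι} (hi : i ∉ T) (f g : ∀ S, C.M S) (r : R)
    (hg : ∀ {S T' : Finset ι} (h : insert i S = T'), S ⊆ T →
      C.φ i h (g S) = sgn S i • r • f T') :
    C.φ i rfl (C.d g T) = r • C.φ i rfl (f T) - sgn T i • r • C.d f (insert i T) := by
  rw [d_insert f hi, d, map_sum, smul_add, smul_add, smul_comm r (sgn T i), smul_smul,
    sgn_mul_self, one_smul, sub_add_cancel_left, Finset.smul_sum, Finset.smul_sum,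
    ← Finset.sum_neg_distrib]
  -- Commuting φ_i past φ_j identifies the j-th term of φ_i(dg) with that of d f at T ∪ {i}, and
  -- `sgn_mul_sgn_erase` supplies the opposite sign.
  refine Finset.sum_congr rfl fun j _ => ?_
  have hij : i ≠ j.1 := fun h => hi (h ▸ j.2)
  have h1 : insert i (T.erase j.1) = (insert i T).erase j.1 :=
    (Finset.erase_insert_of_ne hij).symm
  rw [map_zsmul, C.comm j.1 i (Finset.insert_erase j.2) rfl h1
    (Finset.insert_erase (Finset.mem_insert_of_mem j.2)), hg h1 (Finset.erase_subset _ _),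
    map_zsmul, hC.φ_smul, smul_smul, sgn_mul_sgn_erase hi j.2, neg_smul, smul_comm r, smul_smul]

/-- A cocycle becomes a coboundary after multiplication by a power of `t i`. -/
lemma exists_pow_smul_eq_d (B U : Finset ι) (p : ℕ) {i : ι} (hiU : i ∈ U) (hiB : i ∉ B)
    (f : ∀ S, C.M S) (hf1 : ∀ S, ¬ (B ⊆ S ∧ S ⊆ U) → f S = 0) (hf2 : ∀ S, S.card ≠ p → f S = 0)
    (hf3 : ∀ T, T ⊆ U → C.d f T = 0) :
    ∃ (N : ℕ) (g : ∀ S, C.M S), (∀ S, ¬ (B ⊆ S ∧ S ⊆ U) → g S = 0) ∧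
      (∀ S, S.card + 1 ≠ p → g S = 0) ∧ ∀ T, T ⊆ U → C.d g T = t i ^ N • f T := by
  classical
  obtain ⟨N, y, hy⟩ := hC.exists_uniform_lift U i f
  -- The contraction with i: g_S is, up to sign, f at S ∪ {i} moved back along φ_i after
  -- multiplication by t i ^ N. It is cut off to the admissible subsets not containing i.
  let g : ∀ S, C.M S := fun S =>
    if i ∉ S ∧ (B ⊆ S ∧ S ⊆ U) ∧ S.card + 1 = p then sgn S i • y S else 0
  have hg : ∀ {S T' : Finset ι} (h : insert i S = T'), i ∉ S → S ⊆ U →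
      C.φ i h (g S) = sgn S i • t i ^ N • f T' := by
    rintro S T' rfl hiS hS
    by_cases h : (B ⊆ S ∧ S ⊆ U) ∧ S.card + 1 = p
    · simp only [g]
      rw [if_pos ⟨hiS, h⟩, map_zsmul, hy rfl hS]
    · have : f (insert i S) = 0 := by
        by_contra h0
        have h1 := not_imp_comm.1 (hf1 (insert i S)) h0
        have h2 := not_imp_comm.1 (hf2 (insert i S)) h0
        rw [Finset.card_insert_of_notMem hiS] at h2
        refine h ⟨⟨fun j hj => ?_, hS⟩, h2⟩
        rcases Finset.mem_insert.1 (h1.1 hj) with rfl | hj'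
        · exact absurd hj hiB
        · exact hj'
      simp only [g]
      rw [if_neg (fun h' => h h'.2), this, map_zero, smul_zero, smul_zero]
  -- The identity d g = t_i^N f holds after applying φ_i. If i ∈ T it already holds, since only the
  -- term of i survives in d g; otherwise it is the homotopy formula. The remaining error is killed
  -- by a further power of t i.
  have hkill : ∀ T, T ⊆ U → C.φ i rfl (C.d g T - t i ^ N • f T) = 0 := by
    intro T hT
    by_cases hiT : i ∈ T
    · have : C.d g T = t i ^ N • f T := by
        rw [d_eq_single g hiT, hg (Finset.insert_erase hiT) (Finset.notMem_erase i T)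
          ((Finset.erase_subset _ _).trans hT), smul_smul, sgn_erase_self, sgn_mul_self, one_smul]
        intro j _ hji
        exact if_neg fun h => h.1 (Finset.mem_erase.2 ⟨hji.symm, hiT⟩)
      rw [this, sub_self, map_zero]
    · rw [map_sub, hC.φ_d_eq hiT f g (t i ^ N), hf3 _ (Finset.insert_subset hiU hT), smul_zero,
        smul_zero, sub_zero, hC.φ_smul, sub_self]
      intro S T' h hS
      exact hg h (fun h' => hiT (hS h')) (hS.trans hT)
  obtain ⟨N', hN'⟩ := hC.exists_uniform_kill U i _ hkill
  refine ⟨N' + N, fun S => t i ^ N' • g S, fun S hS => ?_, fun S hS => ?_, fun T hT => ?_⟩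
  · simp only [g]
    rw [if_neg fun h => hS h.2.1, smul_zero]
  · simp only [g]
    rw [if_neg fun h => hS h.2.2, smul_zero]
  · have := hN' T hT
    rw [smul_sub, sub_eq_zero, smul_smul, ← pow_add] at this
    rw [hC.d_smul, this]

lemma bijective_prod_pow {B S : Finset ι} (h : B ⊆ S) (N : ℕ) :
    Function.Bijective fun x : C.M S => (∏ i ∈ B, t i) ^ N • x := by
  have h1 : Function.Bijective fun x : C.M S => (∏ i ∈ B, t i) • x := by
    induction B using Finset.induction_on with
    | empty =>
      simp only [Finset.prod_empty, one_smul]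
      exact Function.bijective_id
    | insert i B hi ih =>
      rw [Finset.prod_insert hi]
      simp only [mul_smul]
      exact (hC.bijective i (h (Finset.mem_insert_self i B))).comp
        (ih ((Finset.subset_insert i B).trans h))
  induction N with
  | zero =>
    simp only [pow_zero, one_smul]
    exact Function.bijective_id
  | succ N ih =>
    simp only [pow_succ, mul_smul]
    exact ih.comp h1

/-- The Čech cohomology vanishes after inverting an element of the radical. -/
theorem subsingleton_res_H_of_mem_radical (B U : Finset ι)
    (h : ∏ i ∈ B, t i ∈ (Ideal.span (t '' {i | i ∈ U ∧ i ∉ B})).radical) (p : ℕ) :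
    Subsingleton ((C.res B U).H p) := by
  classical
  refine subsingleton_res_H B U p fun f hf1 hf2 hf3 => ?_
  -- J consists of the r for which r f is the coboundary of an admissible family. It contains a
  -- power of each t i with i ∈ U \ B, hence a power of the product over B.
  let J : Ideal R :=
    { carrier := {r | ∃ g : ∀ S, C.M S, (∀ S, ¬ (B ⊆ S ∧ S ⊆ U) → g S = 0) ∧
        (∀ S, S.card + 1 ≠ p → g S = 0) ∧ ∀ T, T ⊆ U → C.d g T = r • f T}
      add_mem' := by
        rintro a b ⟨g, h1, h2, h3⟩ ⟨g', h1', h2', h3'⟩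
        refine ⟨fun S => g S + g' S, fun S hS => ?_, fun S hS => ?_, fun T hT => ?_⟩
        · simp only [h1 S hS, h1' S hS, add_zero]
        · simp only [h2 S hS, h2' S hS, add_zero]
        · rw [d_add, h3 T hT, h3' T hT, add_smul]
      zero_mem' := ⟨0, fun _ _ => rfl, fun _ _ => rfl, fun T _ => by
        rw [zero_smul]
        exact d_eq_zero _ fun _ _ => rfl⟩
      smul_mem' := by
        rintro c a ⟨g, h1, h2, h3⟩
        refine ⟨fun S => c • g S, fun S hS => ?_, fun S hS => ?_, fun T hT => ?_⟩
        · simp only [h1 S hS, smul_zero]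
        · simp only [h2 S hS, smul_zero]
        · rw [hC.d_smul, h3 T hT, smul_smul, smul_eq_mul] }
  have hJ : Ideal.span (t '' {i | i ∈ U ∧ i ∉ B}) ≤ J.radical := by
    rw [Ideal.span_le]
    rintro _ ⟨i, ⟨hiU, hiB⟩, rfl⟩
    obtain ⟨N, hN⟩ := hC.exists_pow_smul_eq_d B U p hiU hiB f hf1 hf2 hf3
    exact ⟨N, hN⟩
  obtain ⟨N, g, hg1, hg2, hg3⟩ := J.radical_idem.le (Ideal.radical_mono hJ h)
  -- The product of the t i over B acts bijectively on M S when B ⊆ S, so the primitive of a power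
  -- times f can be divided by that power. The second clause keeps zero components zero.
  have hinv : ∀ S, ∃ y : C.M S, (B ⊆ S → (∏ i ∈ B, t i) ^ N • y = g S) ∧ (g S = 0 → y = 0) := by
    intro S
    by_cases hS : B ⊆ S
    · obtain ⟨y, hy⟩ := (hC.bijective_prod_pow hS N).2 (g S)
      refine ⟨y, fun _ => hy, fun h0 => (hC.bijective_prod_pow hS N).1 ?_⟩
      dsimp only at hy ⊢
      rw [hy, h0, smul_zero]
    · exact ⟨0, fun h => absurd h hS, fun _ => rfl⟩
  choose y hy hy0 using hinv
  refine ⟨y, fun S hS => hy0 S (hg1 S hS), fun S hS => hy0 S (hg2 S hS), fun T hT => ?_⟩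
  by_cases hBT : B ⊆ T
  · refine (hC.bijective_prod_pow hBT N).1 ?_
    dsimp only
    rw [← hg3 T hT, ← hC.d_smul]
    congr 1
    funext S
    by_cases hS : B ⊆ S
    · exact hy S hS
    · rw [hg1 S fun h => hS h.1, hy0 S (hg1 S fun h => hS h.1), smul_zero]
  · rw [hf1 T fun h => hBT h.1]
    exact d_eq_zero _ fun j _ => hy0 _ (hg1 _ fun h => hBT (h.1.trans (Finset.erase_subset _ _)))

/-- Localization at `t k` preserves the vanishing of cohomology. -/
theorem subsingleton_res_insert_H (B U : Finset ι) {k : ι} (hk : k ∉ U) (hkB : k ∉ B)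
    (p : ℕ) (h : Subsingleton ((C.res B U).H p)) :
    Subsingleton ((C.res (insert k B) (insert k U)).H (p + 1)) := by
  classical
  refine subsingleton_res_H _ _ _ fun f hf1 hf2 hf3 => ?_
  obtain ⟨N, y, hy⟩ := hC.exists_uniform_lift U k f
  -- Every subset in the interval for f contains k; removing k and clearing the denominators in t k
  -- gives a cochain of degree p on the interval from B to U.
  let g : ∀ S, C.M S := fun S => if (B ⊆ S ∧ S ⊆ U) ∧ S.card = p then sgn S k • y S else 0
  have hg : ∀ {S T' : Finset ι} (h : insert k S = T'), S ⊆ U →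
      C.φ k h (g S) = sgn S k • t k ^ N • f T' := by
    rintro S T' rfl hS
    have hkS : k ∉ S := fun h => hk (hS h)
    by_cases h : (B ⊆ S ∧ S ⊆ U) ∧ S.card = p
    · simp only [g]
      rw [if_pos h, map_zsmul, hy rfl hS]
    · have : f (insert k S) = 0 := by
        by_contra h0
        have h1 := not_imp_comm.1 (hf1 (insert k S)) h0
        have h2 := not_imp_comm.1 (hf2 (insert k S)) h0
        rw [Finset.card_insert_of_notMem hkS] at h2
        refine h ⟨⟨fun j hj => ?_, hS⟩, by omega⟩
        rcases Finset.mem_insert.1 (h1.1 (Finset.mem_insert_of_mem hj)) with rfl | hj'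
        · exact absurd hj hkB
        · exact hj'
      simp only [g]
      rw [if_neg h, this, map_zero, smul_zero, smul_zero]
  -- f vanishes on T because k ∉ T, so the homotopy formula leaves φ_k(dg) = 0: g is a cocycle up to
  -- t_k-torsion.
  have hkill : ∀ T, T ⊆ U → C.φ k rfl (C.d g T) = 0 := by
    intro T hT
    have hkT : k ∉ T := fun h => hk (hT h)
    rw [hC.φ_d_eq hkT f g (t k ^ N) fun h hS => hg h (hS.trans hT),
      hf3 _ (Finset.insert_subset_insert k hT), hf1 T fun h => hkT (h.1 (Finset.mem_insert_self k B))]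
    simp
  obtain ⟨N', hN'⟩ := hC.exists_uniform_kill U k _ hkill
  obtain ⟨w, hw1, hw2, hw3⟩ := exists_of_subsingleton_res_H B U p h (fun S => t k ^ N' • g S)
    (fun S hS => by
      simp only [g]
      rw [if_neg fun h => hS h.1, smul_zero])
    (fun S hS => by
      simp only [g]
      rw [if_neg fun h => hS h.2, smul_zero])
    (fun T hT => by rw [hC.d_smul, hN' T hT])
  have hpow : ∀ {S : Finset ι}, k ∈ S → Function.Bijective fun x : C.M S => t k ^ (N' + N) • x := by
    intro S hS
    simpa using hC.bijective_prod_pow (Finset.singleton_subset_iff.2 hS) (N' + N)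
  -- With d w = t_k^N' g, the primitive of f is v_S = -sgn · t_k^{-(N'+N)} φ_k(w_{S \ k}), since t k
  -- is invertible on M S for k ∈ S. The minus sign comes from moving k past the other indices.
  have hinv : ∀ S, ∃ v : C.M S, ((h : k ∈ S) → t k ^ (N' + N) • v =
      -(sgn S k • C.φ k (Finset.insert_erase h) (w (S.erase k)))) ∧
      ((k ∉ S ∨ w (S.erase k) = 0) → v = 0) := by
    intro S
    by_cases hS : k ∈ S
    · obtain ⟨v, hv⟩ := (hpow hS).2 (-(sgn S k • C.φ k (Finset.insert_erase hS) (w (S.erase k))))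
      refine ⟨v, fun _ => hv, fun h0 => (hpow hS).1 ?_⟩
      dsimp only at hv ⊢
      rw [hv, h0.resolve_left (fun h => h hS)]
      simp
    · exact ⟨0, fun h => absurd h hS, fun _ => rfl⟩
  choose v hv hv0 using hinv
  refine ⟨v, fun S hS => hv0 S ?_, fun S hS => hv0 S ?_, fun T hT => ?_⟩
  · by_cases hkS : k ∈ S
    · refine Or.inr (hw1 _ fun h => hS ⟨?_, ?_⟩)
      · exact Finset.insert_subset hkS (h.1.trans (Finset.erase_subset _ _))
      · rw [← Finset.insert_erase hkS]
        exact Finset.insert_subset_insert k h.2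
    · exact Or.inl hkS
  · by_cases hkS : k ∈ S
    · refine Or.inr (hw2 _ fun h => hS ?_)
      rw [Finset.card_erase_add_one hkS] at h
      omega
    · exact Or.inl hkS
  · by_cases hkT : k ∈ T
    · obtain ⟨T', hkT', rfl⟩ : ∃ T', k ∉ T' ∧ T = insert k T' :=
        ⟨T.erase k, Finset.notMem_erase k T, (Finset.insert_erase hkT).symm⟩
      have hT' : T' ⊆ U := by
        intro j hj
        rcases Finset.mem_insert.1 (hT (Finset.mem_insert_of_mem hj)) with rfl | hj'
        · exact absurd hj hkT'
        · exact hj'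
      refine (hpow hkT).1 ?_
      dsimp only
      rw [← hC.d_smul, d_insert _ hkT', hv0 T' (Or.inl hkT'), smul_zero, map_zero, smul_zero, zero_add]
      have key : ∀ j : {j // j ∈ T'}, sgn (insert k T') j.1 •
          C.φ j.1 (Finset.insert_erase (Finset.mem_insert_of_mem j.2))
            (t k ^ (N' + N) • v ((insert k T').erase j.1)) =
          sgn T' k • sgn T' j.1 • C.φ k rfl (C.φ j.1 (Finset.insert_erase j.2) (w (T'.erase j.1))) := by
        intro j
        have hkj : k ≠ j.1 := fun h => hkT' (h ▸ j.2)
        have hmem : k ∈ (insert k T').erase j.1 :=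
          Finset.mem_erase.2 ⟨hkj, Finset.mem_insert_self k T'⟩
        have h1 : insert k (T'.erase j.1) = (insert k T').erase j.1 :=
          (Finset.erase_insert_of_ne hkj).symm
        have h2 : ((insert k T').erase j.1).erase k = T'.erase j.1 := by
          rw [← h1, Finset.erase_insert (fun h => hkT' (Finset.mem_of_mem_erase h))]
        rw [hv _ hmem, φ_family_congr w k h2 _ h1, map_neg, map_zsmul,
          ← C.comm j.1 k (Finset.insert_erase j.2) rfl h1
            (Finset.insert_erase (Finset.mem_insert_of_mem j.2)), smul_neg, smul_smul, smul_smul,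
          ← neg_smul, ← h1, sgn_insert_self]
        congr 1
        have e1 := sgn_mul_sgn_erase hkT' j.2
        have e2 := sgn_mul_self T' j.1
        have e3 := sgn_mul_self T' k
        have e4 := sgn_mul_self (insert k T') j.1
        linear_combination (-(sgn (insert k T') j.1 * sgn T' j.1)) * e1 +
          (sgn (insert k T') j.1 * sgn (T'.erase j.1) k) * e2 + (sgn T' k * sgn T' j.1) * e4
      rw [Finset.sum_congr rfl fun j _ => key j, ← Finset.smul_sum]
      have := hw3 T' hT'
      rw [d] at this
      have := congrArg (C.φ k (rfl : insert k T' = _)) this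
      rw [map_sum] at this
      simp only [map_zsmul] at this
      rw [this, hC.φ_smul, hg rfl hT', smul_comm (t k ^ N'), smul_smul, sgn_mul_self, one_smul,
        smul_smul, pow_add]
    · rw [hf1 T fun h => hkT (h.1 (Finset.mem_insert_self k B))]
      exact d_eq_zero _ fun j _ => hv0 _ (Or.inl fun h => hkT (Finset.mem_of_mem_erase h))

end IsCech

end IsCech

end ModuleCube
end

noncomputable section
open CategoryTheory

/-! ### The Čech cube of localizations of a ring -/

section Away

open ModuleCube

variable {K : Type u} {R : Type u} [Field K] [CommRing R] [Algebra K R]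
variable {ι : Type} [LinearOrder ι]

/-- The Čech cube of a family of elements. -/
def awayCube (K : Type u) [Field K] [Algebra K R] (t : ι → R) : ModuleCube K ι where
  M S := Localization.Away (∏ i ∈ S, t i)
  φ i h := ((awayToAway (Finset.prod_dvd_prod_of_subset _ _ t
    (h ▸ Finset.subset_insert i _))).restrictScalars K).toLinearMap
  comm i j _ _ _ _ x := by
    simp only [AlgHom.toLinearMap_apply, AlgHom.restrictScalars_apply, awayToAway_comp]

instance (t : ι → R) (S : Finset ι) : Module R ((awayCube K t).M S) :=
  inferInstanceAs (Module R (Localization.Away (∏ i ∈ S, t i)))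

lemma isUnit_algebraMap_away (f : R) : IsUnit (algebraMap R (Localization.Away f) f) :=
  IsLocalization.Away.algebraMap_isUnit f

/-- Write f h = g c. If x = r / g^N then h^N x = c^N r / f^N, which comes from R_f. The condition g
∣ f h is loose enough to cover an index already present (g = f) as well as a new one (g = f h). -/
lemma away_exists_lift {f g h : R} (hd : f ∣ g) (hg : g ∣ f * h) (x : Localization.Away g) :
    ∃ (N : ℕ) (y : Localization.Away f), awayToAway hd y = h ^ N • x := by
  obtain ⟨c, hc⟩ := hg
  obtain ⟨N, r, hr⟩ := IsLocalization.Away.surj g x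
  obtain ⟨u, hu⟩ := (isUnit_algebraMap_away f).pow N
  refine ⟨N, ↑u⁻¹ * algebraMap R _ (c ^ N * r), ?_⟩
  have hu' : IsUnit (algebraMap R (Localization.Away g) f) := by
    have := (isUnit_algebraMap_away f).map (awayToAway hd)
    rwa [AlgHom.commutes] at this
  refine (hu'.pow N).mul_left_cancel ?_
  have h1 : algebraMap R (Localization.Away g) f ^ N * awayToAway hd (↑u⁻¹ : Localization.Away f) = 1 := by
    have := congrArg (awayToAway hd) (u.mul_inv)
    rwa [hu, map_mul, map_pow, AlgHom.commutes, map_one] at this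
  rw [map_mul, ← mul_assoc, h1, one_mul, AlgHom.commutes, Algebra.smul_def, map_mul, ← hr,
    map_pow, map_pow]
  have h2 := congrArg (algebraMap R (Localization.Away g)) hc
  rw [map_mul, map_mul] at h2
  calc _ = (algebraMap R (Localization.Away g) g * algebraMap R (Localization.Away g) c) ^ N * x := by
        rw [mul_pow]; ring
    _ = _ := by rw [← h2, mul_pow]; ring

/-- If y = r / f^N dies in R_g, some g^k kills r; then (f h)^k = (g c)^k kills r too, and f is
invertible in R_f. -/
lemma away_exists_kill {f g h : R} (hd : f ∣ g) (hg : g ∣ f * h) (y : Localization.Away f)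
    (hy : awayToAway hd y = 0) : ∃ N : ℕ, h ^ N • y = 0 := by
  obtain ⟨c, hc⟩ := hg
  obtain ⟨N, r, hr⟩ := IsLocalization.Away.surj f y
  have h1 := congrArg (awayToAway hd) hr
  rw [map_mul, hy, zero_mul, AlgHom.commutes] at h1
  obtain ⟨⟨_, k, rfl⟩, hk⟩ := (IsLocalization.map_eq_zero_iff (Submonoid.powers g)
    (Localization.Away g) r).1 h1.symm
  dsimp only at hk
  refine ⟨k, ?_⟩
  refine ((isUnit_algebraMap_away f).pow (k + N)).mul_left_cancel ?_
  have h2 : algebraMap R (Localization.Away f) ((f * h) ^ k * r) = 0 := by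
    rw [hc, mul_pow, mul_right_comm, hk, zero_mul, map_zero]
  rw [map_mul, ← hr, map_pow, map_mul] at h2
  rw [mul_zero, Algebra.smul_def, map_pow, ← h2]
  ring

lemma awayToAway_self {f : R} (h : f ∣ f) (x : Localization.Away f) : awayToAway h x = x := by
  have : awayToAway h = AlgHom.id R _ :=
    IsLocalization.algHom_ext (Submonoid.powers f) (by ext)
  rw [this]
  rfl

lemma prod_insert_dvd (t : ι → R) {S T : Finset ι} {i : ι} (h : insert i S = T) :
    ∏ j ∈ T, t j ∣ (∏ j ∈ S, t j) * t i := by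
  subst h
  by_cases hi : i ∈ S
  · rw [Finset.insert_eq_of_mem hi]
    exact dvd_mul_right _ _
  · rw [Finset.prod_insert hi, mul_comm]

theorem isCech_awayCube (t : ι → R) : IsCech (awayCube K t) t where
  φ_smul i h r x := map_smul (awayToAway (Finset.prod_dvd_prod_of_subset _ _ t
    (h ▸ Finset.subset_insert i _))) r x
  exists_lift i h x := away_exists_lift (Finset.prod_dvd_prod_of_subset _ _ t
    (h ▸ Finset.subset_insert i _)) (prod_insert_dvd t h) x
  exists_kill i h y hy := away_exists_kill (Finset.prod_dvd_prod_of_subset _ _ t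
    (h ▸ Finset.subset_insert i _)) (prod_insert_dvd t h) y hy
  bijective {S} i hi := by
    obtain ⟨u, hu⟩ : IsUnit (algebraMap R (Localization.Away (∏ j ∈ S, t j)) (t i)) :=
      IsLocalization.Away.isUnit_of_dvd _ (Finset.dvd_prod_of_mem t hi)
    have := Units.mulLeft_bijective u
    rw [hu] at this
    have e : (fun x : Localization.Away (∏ j ∈ S, t j) => t i • x) =
        fun x => algebraMap R (Localization.Away (∏ j ∈ S, t j)) (t i) * x :=
      funext fun x => Algebra.smul_def (t i) x
    exact (iff_of_eq (congrArg Function.Bijective e)).2 this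

/-- The action of a derivation on the Čech cube. -/
def awayDer (t : ι → R) (D : Derivation K R R) : Hom (awayCube K t) (awayCube K t) where
  app S := (locDerivation (Submonoid.powers (∏ i ∈ S, t i)) D).toLinearMap
  naturality i h x := awayToAway_derivation (Finset.prod_dvd_prod_of_subset _ _ t
      (h ▸ Finset.subset_insert i _)) D x

end Away
end

noncomputable section
open CategoryTheory

namespace ModuleCube

/-! ### Change of the index set -/

section Reindex

variable {K : Type u} [Field K] {ι κ : Type} [LinearOrder ι] [LinearOrder κ]

/-- A comparison of a cube on `ι` with a cube on `κ` along an embedding `e` of `κ` into `ι`. -/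
structure Reindex (e : κ ↪o ι) (C : ModuleCube K ι) (C' : ModuleCube K κ) where
  ρ : ∀ S : Finset κ, C.M (S.map e.toEmbedding) →ₗ[K] C'.M S
  bijective : ∀ S, Function.Bijective (ρ S)
  naturality : ∀ {S T : Finset κ} (i : κ) (h : insert i S = T)
    (h' : insert (e i) (S.map e.toEmbedding) = T.map e.toEmbedding)
    (x : C.M (S.map e.toEmbedding)), ρ T (C.φ (e i) h' x) = C'.φ i h (ρ S x)

variable {e : κ ↪o ι} {C : ModuleCube K ι} {C' : ModuleCube K κ} (ρ : Reindex e C C')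

lemma sgn_map (e : κ ↪o ι) (T : Finset κ) (i : κ) : sgn (T.map e.toEmbedding) (e i) = sgn T i := by
  rw [sgn, sgn, Finset.filter_map, Finset.card_map]
  congr 3
  ext j
  simp

lemma Reindex.ρ_d (F : ∀ S, C.M S) (T : Finset κ) :
    ρ.ρ T (C.d F (T.map e.toEmbedding)) = C'.d (fun S => ρ.ρ S (F (S.map e.toEmbedding))) T := by
  rw [d_eq_sum, d_eq_sum, Finset.sum_map, map_sum]
  refine Finset.sum_congr rfl fun j hj => ?_
  have h1 : e.toEmbedding j ∈ T.map e.toEmbedding := Finset.mem_map_of_mem _ hj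
  have h2 : (T.map e.toEmbedding).erase (e.toEmbedding j) = (T.erase j).map e.toEmbedding :=
    (Finset.map_erase _ _ _).symm
  have h3 : insert (e j) ((T.erase j).map e.toEmbedding) = T.map e.toEmbedding := by
    conv_rhs => rw [← Finset.insert_erase hj, Finset.map_insert]
    rfl
  rw [dif_pos hj, dif_pos h1, map_zsmul, φ_family_congr F _ h2 (Finset.insert_erase h1) h3]
  exact congrArg₂ _ (sgn_map e T j) (ρ.naturality j (Finset.insert_erase hj) h3 _)

variable [Fintype κ]

/-- The comparison map of complexes. -/
def Reindex.map : (C.res ∅ (Finset.univ.map e.toEmbedding)).complex ⟶ C'.complex where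
  f p := ModuleCat.ofHom (LinearMap.pi fun S => ρ.ρ S.1 ∘ₗ resVal ∘ₗ
    LinearMap.proj (R := K)
      (φ := fun S : {S : Finset ι // S.card = p} =>
        (C.res ∅ (Finset.univ.map e.toEmbedding)).M S.1)
      ⟨S.1.map e.toEmbedding, by rw [Finset.card_map, S.2]⟩)
  comm' p q h := by
    have h1 : p + 1 = q := h
    simp only [complex, dif_pos h1]
    refine ModuleCat.hom_ext (LinearMap.ext fun f => funext fun T => ?_)
    let F := (C.res ∅ (Finset.univ.map e.toEmbedding)).extend f
    have hT : T.1.map e.toEmbedding ⊆ Finset.univ.map e.toEmbedding :=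
      Finset.map_subset_map.2 (Finset.subset_univ _)
    have hc : (T.1.map e.toEmbedding).card = q := by rw [Finset.card_map, T.2]
    have l := d_restrict (C := C') h1 (fun S => ρ.ρ S (resVal (F (S.map e.toEmbedding)))) T
    have r := d_extend h1 f ⟨T.1.map e.toEmbedding, hc⟩
    change C'.diff h1 (fun S => ρ.ρ S.1 (resVal (f ⟨S.1.map e.toEmbedding, _⟩))) T =
      ρ.ρ T.1 (resVal ((C.res ∅ (Finset.univ.map e.toEmbedding)).diff h1 f
        ⟨T.1.map e.toEmbedding, _⟩))
    rw [← r, resVal_d _ _ hT]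
    refine Eq.trans ?_ (l.trans (ρ.ρ_d (fun S => resVal (F S)) T.1).symm)
    refine congrArg (fun F => C'.diff h1 F T) (funext fun S => ?_)
    refine congrArg (fun y => ρ.ρ S.1 (resVal y)) ?_
    exact (extend_apply f ⟨S.1.map e.toEmbedding, by rw [Finset.card_map, S.2]⟩).symm

/-- The subsets of the image of e are exactly the images of subsets of κ, and the restricted cube is
zero on all other subsets; so the map is bijective in each degree. -/
instance : IsIso ρ.map := by
  have : ∀ p, IsIso (ρ.map.f p) := by
    intro p
    rw [ConcreteCategory.isIso_iff_bijective]
    constructor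
    · intro f g hfg
      funext ⟨S, hS⟩
      by_cases h : S ⊆ Finset.univ.map e.toEmbedding
      · obtain ⟨S', -, rfl⟩ := Finset.subset_map_iff.1 h
        have := congrFun hfg ⟨S', by rwa [Finset.card_map] at hS⟩
        exact resVal_injective ((ρ.bijective S').1 this)
      · exact (res_eq_zero (fun h' => h h'.2) (f ⟨S, hS⟩)).trans
          (res_eq_zero (fun h' => h h'.2) (g ⟨S, hS⟩)).symm
    · intro g
      choose y hy using fun S => (ρ.bijective S).2 (C'.extend g S)
      -- The component at S is characterized through every presentation of S as an image, so that
      -- the choice below produces a family over all S without transporting along equalities.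
      have key : ∀ S : Finset ι, ∃ x : (C.res ∅ (Finset.univ.map e.toEmbedding)).M S,
          ∀ (S' : Finset κ) (h : S = S'.map e.toEmbedding), ρ.ρ S' (h ▸ resVal x) = C'.extend g S' := by
        intro S
        by_cases h : S ⊆ Finset.univ.map e.toEmbedding
        · obtain ⟨S', -, rfl⟩ := Finset.subset_map_iff.1 h
          refine ⟨resMk (y S') fun h' => absurd ⟨Finset.empty_subset _, h⟩ h', fun S'' h'' => ?_⟩
          obtain rfl := Finset.map_injective _ h''
          exact hy S'
        · refine ⟨0, fun S' h' => absurd ?_ h⟩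
          rw [h']
          exact Finset.map_subset_map.2 (Finset.subset_univ _)
      choose x hx using key
      refine ⟨fun S => x S.1, funext fun S => ?_⟩
      exact (hx _ S.1 rfl).trans (extend_apply g S)
  exact HomologicalComplex.Hom.isIso_of_components _

/-- The comparison isomorphism in cohomology. -/
def Reindex.H (p : ℕ) : (C.res ∅ (Finset.univ.map e.toEmbedding)).H p ≃ₗ[K] C'.H p :=
  (HomologicalComplex.homologyMapIso (asIso ρ.map) p).toLinearEquiv

lemma Reindex.H_comm (α : Hom C C) (α' : Hom C' C')
    (h : ∀ S x, ρ.ρ S (α.app _ x) = α'.app S (ρ.ρ S x)) (p : ℕ)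
    (x : (C.res ∅ (Finset.univ.map e.toEmbedding)).H p) :
    ρ.H p ((resMap α ∅ _).H p x) = α'.H p (ρ.H p x) := by
  have : (resMap α ∅ (Finset.univ.map e.toEmbedding)).map ≫ ρ.map = ρ.map ≫ α'.map := by
    refine HomologicalComplex.hom_ext _ _ fun p => ModuleCat.hom_ext (LinearMap.ext fun f =>
      funext fun S => ?_)
    exact h S.1 _
  have := congrArg (fun f => HomologicalComplex.homologyMap f p) this
  simp only [HomologicalComplex.homologyMap_comp] at this
  exact LinearMap.congr_fun (congrArg ModuleCat.Hom.hom this) x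

end Reindex

end ModuleCube

/-! ### The Čech cube of a subfamily -/

section AwayReindex

open ModuleCube

variable {K : Type u} {R : Type u} [Field K] [CommRing R] [Algebra K R]
variable {ι κ : Type} [LinearOrder ι] [LinearOrder κ]

lemma prod_dvd_of_insert (t : ι → R) {S T : Finset ι} {i : ι} (h : insert i S = T) :
    ∏ j ∈ S, t j ∣ ∏ j ∈ T, t j :=
  Finset.prod_dvd_prod_of_subset _ _ t (h ▸ Finset.subset_insert i _)

lemma prod_map_eq (e : κ ↪o ι) (t : ι → R) (a : κ → R) (h : ∀ i, t (e i) = a i) (S : Finset κ) :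
    ∏ i ∈ S.map e.toEmbedding, t i = ∏ i ∈ S, a i := by
  rw [Finset.prod_map]
  exact Finset.prod_congr rfl fun i _ => h i

/-- The Čech cube of a subfamily. -/
def awayReindex (e : κ ↪o ι) (t : ι → R) (a : κ → R) (h : ∀ i, t (e i) = a i) :
    Reindex e (awayCube K t) (awayCube K a) where
  ρ S := ((awayToAway (dvd_of_eq (prod_map_eq e t a h S))).restrictScalars K).toLinearMap
  bijective S := by
    have e1 := prod_map_eq e t a h S
    refine Function.bijective_iff_has_inverse.2 ⟨awayToAway (dvd_of_eq e1.symm), fun x => ?_,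
      fun x => ?_⟩
    · exact (awayToAway_comp (dvd_of_eq e1) (dvd_of_eq e1.symm) x).trans (awayToAway_self _ x)
    · exact (awayToAway_comp (dvd_of_eq e1.symm) (dvd_of_eq e1) x).trans (awayToAway_self _ x)
  naturality {S T} i hi hi' x :=
    (awayToAway_comp (prod_dvd_of_insert t hi') (dvd_of_eq (prod_map_eq e t a h T)) x).trans
      (awayToAway_comp (dvd_of_eq (prod_map_eq e t a h S)) (prod_dvd_of_insert a hi) x).symm

lemma awayReindex_der (e : κ ↪o ι) (t : ι → R) (a : κ → R) (h : ∀ i, t (e i) = a i)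
    (D : Derivation K R R) (S : Finset κ) (x : (awayCube K t).M (S.map e.toEmbedding)) :
    (awayReindex e t a h).ρ S ((awayDer t D).app _ x) =
      (awayDer a D).app S ((awayReindex (K := K) e t a h).ρ S x) :=
  (awayToAway_derivation (dvd_of_eq (prod_map_eq e t a h S)) D x).symm

end AwayReindex
end

noncomputable section
open CategoryTheory

/-! ### De Rham cohomology of modules with commuting operators -/

/-- A vector space with `n` commuting operators. -/
structure OpModule (K : Type u) [Field K] (n : ℕ) where
  carrier : Type u
  [grp : AddCommGroup carrier]
  [mod : Module K carrier]
  D : Fin n → carrier →ₗ[K] carrier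
  comm : ∀ i j x, D i (D j x) = D j (D i x)

namespace OpModule

attribute [instance] OpModule.grp OpModule.mod

open ModuleCube

variable {K : Type u} [Field K] {n : ℕ}

/-- The cube of the de Rham complex. -/
abbrev cube (N : OpModule K n) : ModuleCube K (Fin n) := deRhamCube N.D N.comm

/-- Linear maps which commute with the operators. -/
structure Hom (N N' : OpModule K n) where
  lin : N.carrier →ₗ[K] N'.carrier
  comm : ∀ i x, lin (N.D i x) = N'.D i (lin x)

variable {N N' N'' : OpModule K n}

/-- The induced map of cubes. -/
def Hom.cube (f : Hom N N') : ModuleCube.Hom N.cube N'.cube where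
  app _ := f.lin
  naturality i _ x := f.comm i x

/-- The composition of maps commuting with the operators. -/
def Hom.comp (f : Hom N N') (g : Hom N' N'') : Hom N N'' where
  lin := g.lin ∘ₗ f.lin
  comm i x := by rw [LinearMap.comp_apply, LinearMap.comp_apply, f.comm, g.comm]

lemma Hom.comp_H (f : Hom N N') (g : Hom N' N'') (p : ℕ) (x : N.cube.H p) :
    (f.comp g).cube.H p x = g.cube.H p (f.cube.H p x) :=
  ModuleCube.Hom.H_comp f.cube g.cube p x

/-- A bijective map commuting with the operators induces an isomorphism on de Rham cohomology. -/
def Hom.equivH (f : Hom N N') (hf : Function.Bijective f.lin) (p : ℕ) :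
    N.cube.H p ≃ₗ[K] N'.cube.H p :=
  let e := LinearEquiv.ofBijective f.lin hf
  let g : Hom N' N :=
    { lin := e.symm
      comm := fun i x => by
        refine hf.1 ?_
        rw [f.comm]
        change e (e.symm _) = N'.D i (e (e.symm x))
        rw [e.apply_symm_apply, e.apply_symm_apply] }
  LinearEquiv.ofLinearMap (f.cube.H p) (g.cube.H p)
    (LinearMap.ext fun x => by
      rw [LinearMap.comp_apply, ← comp_H]
      exact ModuleCube.Hom.H_id (g.comp f).cube (fun _ y => e.apply_symm_apply y) p x)
    (LinearMap.ext fun x => by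
      rw [LinearMap.comp_apply, ← comp_H]
      exact ModuleCube.Hom.H_id (f.comp g).cube (fun _ y => e.symm_apply_apply y) p x)

lemma Hom.equivH_apply (f : Hom N N') (hf : Function.Bijective f.lin) (p : ℕ) (x : N.cube.H p) :
    f.equivH hf p x = f.cube.H p x := rfl

/-- A short exact sequence of modules with operators gives one of cubes. -/
def ses (f : Hom N N') (g : Hom N' N'') (hf : Function.Injective f.lin)
    (hfg : Function.Exact f.lin g.lin) (hg : Function.Surjective g.lin) :
    SES N.cube N'.cube N''.cube where
  f := f.cube
  g := g.cube
  inj _ := hf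
  exact _ := hfg
  surj _ := hg

lemma subsingleton_H_of_lt (N : OpModule K n) {p : ℕ} (hp : n < p) : Subsingleton (N.cube.H p) := by
  rw [subsingleton_H_iff]
  intro z _
  have : z = 0 := funext fun S => absurd S.2 (by
    have := S.1.card_le_univ
    rw [Fintype.card_fin] at this
    omega)
  rw [this]
  exact Submodule.zero_mem _

/-- The de Rham cohomology of `N` is concentrated in the two top degrees, where it has
dimensions `α` and `β`. -/
structure HasDims {r : ℕ} (N : OpModule K (r + 1)) (α β : ℕ) : Prop where
  low : ∀ p < r, Subsingleton (N.cube.H p)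
  finite : Module.Finite K (N.cube.H r)
  finrank : Module.finrank K (N.cube.H r) = α
  finite_top : Module.Finite K (N.cube.H (r + 1))
  finrank_top : Module.finrank K (N.cube.H (r + 1)) = β

variable {r : ℕ} {N₁ N₂ N₃ : OpModule K (r + 1)} {α β α' β' : ℕ}

lemma HasDims.of_bijective (f : Hom N₁ N₂) (hf : Function.Bijective f.lin) (h : N₁.HasDims α β) :
    N₂.HasDims α β where
  low p hp := (f.equivH hf p).symm.toEquiv.subsingleton_congr.2 (h.low p hp)
  finite := have := h.finite; Module.Finite.equiv (f.equivH hf r)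
  finrank := by rw [← h.finrank, (f.equivH hf r).finrank_eq]
  finite_top := have := h.finite_top; Module.Finite.equiv (f.equivH hf (r + 1))
  finrank_top := by rw [← h.finrank_top, (f.equivH hf (r + 1)).finrank_eq]

lemma HasDims.of_bijective' (f : Hom N₁ N₂) (hf : Function.Bijective f.lin) (h : N₂.HasDims α β) :
    N₁.HasDims α β where
  low p hp := (f.equivH hf p).toEquiv.subsingleton_congr.2 (h.low p hp)
  finite := have := h.finite; Module.Finite.equiv (f.equivH hf r).symm
  finrank := by rw [← h.finrank, (f.equivH hf r).finrank_eq]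
  finite_top := have := h.finite_top; Module.Finite.equiv (f.equivH hf (r + 1)).symm
  finrank_top := by rw [← h.finrank_top, (f.equivH hf (r + 1)).finrank_eq]

lemma finite_finrank_of_exact {A B C : Type*} [AddCommGroup A] [AddCommGroup B] [AddCommGroup C]
    [Module K A] [Module K B] [Module K C] [Module.Finite K A] [Module.Finite K C]
    (f : A →ₗ[K] B) (g : B →ₗ[K] C) (hf : Function.Injective f) (hfg : Function.Exact f g)
    (hg : Function.Surjective g) :
    Module.Finite K B ∧ Module.finrank K B = Module.finrank K A + Module.finrank K C := by
  have hB : Module.Finite K B := by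
    have h1 : Module.Finite K (LinearMap.ker g) := by
      rw [hfg.linearMap_ker_eq]
      infer_instance
    have h2 : Module.Finite K (B ⧸ LinearMap.ker g) :=
      Module.Finite.equiv (g.quotKerEquivOfSurjective hg).symm
    exact Module.Finite.of_submodule_quotient (LinearMap.ker g)
  refine ⟨hB, ?_⟩
  rw [← LinearMap.finrank_range_add_finrank_ker g, LinearMap.range_eq_top.2 hg, finrank_top,
    hfg.linearMap_ker_eq, LinearMap.finrank_range_of_inj hf, add_comm]

/-- Additivity of the dimensions in a short exact sequence. -/
theorem HasDims.of_exact (f : Hom N₁ N₂) (g : Hom N₂ N₃) (hf : Function.Injective f.lin)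
    (hfg : Function.Exact f.lin g.lin) (hg : Function.Surjective g.lin)
    (h₁ : N₁.HasDims α β) (h₃ : N₃.HasDims α' β') (hs : Function.Surjective (g.cube.H r)) :
    N₂.HasDims (α + α') (β + β') := by
  let s := ses f g hf hfg hg
  have hinj : ∀ p, Function.Surjective (g.cube.H p) → Function.Injective (f.cube.H (p + 1)) := by
    intro p hp
    rw [injective_iff_map_eq_zero]
    intro x hx
    obtain ⟨y, rfl⟩ := (s.exact₁ p x).1 hx
    obtain ⟨w, rfl⟩ := hp y
    exact (s.exact₃ p).apply_apply_eq_zero w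
  have hsub : ∀ p, Subsingleton (N₃.cube.H p) → Function.Surjective (g.cube.H p) :=
    fun p hp x => ⟨0, Subsingleton.elim _ _⟩
  -- Injectivity in degree r: for r = 0 the cohomology is a common kernel, a left exact functor; for
  -- r > 0 the preceding cohomology of the quotient vanishes.
  have hr : Function.Injective (f.cube.H r) := by
    cases r with
    | zero =>
      intro x y hxy
      obtain ⟨z, rfl⟩ := N₁.cube.cls_surjective 0 x
      obtain ⟨w, rfl⟩ := N₁.cube.cls_surjective 0 y
      rw [← sub_eq_zero, ← map_sub, cls_eq_zero_iff]
      rw [← sub_eq_zero, ← map_sub, ← map_sub,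
        ModuleCube.Hom.H_cls f.cube 0 (z - w) ⟨_, f.cube.mem_Z 0 (z - w).2⟩ (fun _ => rfl),
        cls_eq_zero_iff] at hxy
      refine (Submodule.mem_bot K).2 (funext fun S => hf ?_)
      have := congrFun ((Submodule.mem_bot K).1 hxy) S
      exact this.trans (map_zero _).symm
    | succ r => exact hinj r (hsub r (h₃.low r (Nat.lt_succ_self r)))
  -- With r + 1 operators there is no cohomology in degree r + 2, so the top degree is right exact.
  have hs' : Function.Surjective (g.cube.H (r + 1)) := by
    intro x
    have := N₁.subsingleton_H_of_lt (Nat.lt_succ_self (r + 1))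
    exact (s.exact₃ (r + 1) x).1 (Subsingleton.elim _ _)
  have := h₁.finite
  have := h₁.finite_top
  have := h₃.finite
  have := h₃.finite_top
  have e1 := finite_finrank_of_exact (f.cube.H r) (g.cube.H r) hr (s.exact₂ r) hs
  have e2 := finite_finrank_of_exact (f.cube.H (r + 1)) (g.cube.H (r + 1)) (hinj r hs)
    (s.exact₂ (r + 1)) hs'
  refine ⟨fun p hp => ?_, e1.1, ?_, e2.1, ?_⟩
  · have i1 := h₁.low p hp
    have i3 := h₃.low p hp
    refine subsingleton_of_forall_eq 0 fun x => ?_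
    obtain ⟨y, rfl⟩ := (s.exact₂ p x).1 (Subsingleton.elim _ _)
    rw [Subsingleton.elim y 0, map_zero]
  · rw [e1.2, h₁.finrank, h₃.finrank]
  · rw [e2.2, h₁.finrank_top, h₃.finrank_top]

lemma HasDims.subsingleton (h : N₁.HasDims 0 β) : Subsingleton (N₁.cube.H r) := by
  have := h.finite
  exact Module.finrank_zero_iff.1 h.finrank

/-- The first map of a short exact sequence is surjective on cohomology where the cohomology of
the quotient vanishes. -/
lemma surjective_H_of_exact (f : Hom N₁ N₂) (g : Hom N₂ N₃) (hf : Function.Injective f.lin)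
    (hfg : Function.Exact f.lin g.lin) (hg : Function.Surjective g.lin) (p : ℕ)
    (h₃ : Subsingleton (N₃.cube.H p)) : Function.Surjective (f.cube.H p) := fun x =>
  ((ses f g hf hfg hg).exact₂ p x).1 (Subsingleton.elim _ _)

end OpModule
end

noncomputable section
open CategoryTheory

namespace OpModule

open ModuleCube

variable {K : Type u} [Field K] {n : ℕ}

/-! ### Koszul cochains and homotopies -/

section Koszul

variable {A : Type*} [AddCommGroup A] [Module K A]

/-- The Koszul differential of a family of operators, on cochains of all degrees. -/
def kd (D : Fin n → A →ₗ[K] A) (f : Finset (Fin n) → A) (T : Finset (Fin n)) : A :=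
  ∑ i ∈ T, sgn T i • D i (f (T.erase i))

/-- The Koszul homotopy of a family of operators. -/
def kh (E : Fin n → A →ₗ[K] A) (f : Finset (Fin n) → A) (T : Finset (Fin n)) : A :=
  ∑ i ∈ Tᶜ, sgn T i • E i (f (insert i T))

lemma kd_sub (D : Fin n → A →ₗ[K] A) (f g : Finset (Fin n) → A) (T : Finset (Fin n)) :
    kd D (f - g) T = kd D f T - kd D g T := by
  simp only [kd, Pi.sub_apply, map_sub, smul_sub, Finset.sum_sub_distrib]

/-- Cartan's formula without any commutation hypothesis. Adding and removing the same index gives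
the two diagonal sums; removing j ∈ T and adding i ∉ T in the two possible orders gives opposite
signs, hence a commutator. -/
lemma kd_kh_add_kh_kd (D E : Fin n → A →ₗ[K] A) (f : Finset (Fin n) → A) (T : Finset (Fin n)) :
    kd D (kh E f) T + kh E (kd D f) T = ∑ i ∈ T, D i (E i (f T)) + ∑ i ∈ Tᶜ, E i (D i (f T)) +
      ∑ j ∈ T, ∑ i ∈ Tᶜ, (sgn T j * sgn (T.erase j) i) •
        (D j (E i (f (insert i (T.erase j)))) - E i (D j (f (insert i (T.erase j))))) := by
  have h1 : kd D (kh E f) T = ∑ i ∈ T, D i (E i (f T)) + ∑ j ∈ T, ∑ i ∈ Tᶜ,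
      (sgn T j * sgn (T.erase j) i) • D j (E i (f (insert i (T.erase j)))) := by
    rw [kd, ← Finset.sum_add_distrib]
    refine Finset.sum_congr rfl fun j hj => ?_
    rw [kh, Finset.compl_erase, Finset.sum_insert (by simpa using hj), map_add, smul_add,
      Finset.insert_erase hj, sgn_erase_self, map_zsmul, smul_smul, sgn_mul_self, one_smul,
      map_sum, Finset.smul_sum]
    congr 1
    refine Finset.sum_congr rfl fun i _ => ?_
    rw [map_zsmul, smul_smul]
  have h2 : kh E (kd D f) T = ∑ i ∈ Tᶜ, E i (D i (f T)) - ∑ j ∈ T, ∑ i ∈ Tᶜ,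
      (sgn T j * sgn (T.erase j) i) • E i (D j (f (insert i (T.erase j)))) := by
    rw [Finset.sum_comm, kh, ← Finset.sum_sub_distrib]
    refine Finset.sum_congr rfl fun i hi => ?_
    have hi : i ∉ T := Finset.mem_compl.1 hi
    rw [kd, Finset.sum_insert hi, map_add, smul_add, Finset.erase_insert hi, sgn_insert_self,
      map_zsmul, smul_smul, sgn_mul_self, one_smul, map_sum, Finset.smul_sum, sub_eq_add_neg,
      ← Finset.sum_neg_distrib]
    congr 1
    refine Finset.sum_congr rfl fun j hj => ?_
    rw [map_zsmul, smul_smul, sgn_mul_sgn_erase hi hj, neg_smul, neg_neg,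
      Finset.erase_insert_of_ne (show i ≠ j from fun h => hi (h ▸ hj))]
  rw [h1, h2]
  simp only [smul_sub, Finset.sum_sub_distrib]
  abel

end Koszul

variable (N : OpModule K n)

/-- A cochain of the de Rham complex as a family indexed by all subsets. -/
def fam {p : ℕ} (z : N.cube.Term p) (S : Finset (Fin n)) : N.carrier := N.cube.extend z S

/-- The part of degree `p` of a family, as a cochain of the de Rham complex. -/
def term (p : ℕ) (f : Finset (Fin n) → N.carrier) : N.cube.Term p := fun S => f S.1

variable {N}

lemma fam_apply {p : ℕ} (z : N.cube.Term p) (S : {S : Finset (Fin n) // S.card = p}) :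
    N.fam z S.1 = z S := extend_apply z S

lemma fam_of_ne {p : ℕ} (z : N.cube.Term p) {S : Finset (Fin n)} (h : S.card ≠ p) :
    N.fam z S = 0 := extend_of_ne z h

lemma term_fam {p : ℕ} (z : N.cube.Term p) : N.term p (N.fam z) = z :=
  funext fun S => fam_apply z S

lemma fam_term {p : ℕ} (f : Finset (Fin n) → N.carrier) {S : Finset (Fin n)} (h : S.card = p) :
    N.fam (N.term p f) S = f S := fam_apply (N.term p f) ⟨S, h⟩

lemma diff_term {p : ℕ} (f : Finset (Fin n) → N.carrier) :
    N.cube.diff (rfl : p + 1 = p + 1) (N.term p f) = N.term (p + 1) (kd N.D f) := by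
  funext T
  rw [diff_apply]
  refine Eq.trans ?_ (Finset.sum_coe_sort T.1 fun i => sgn T.1 i • N.D i (f (T.1.erase i)))
  rfl

lemma kd_congr {f g : Finset (Fin n) → N.carrier} {T : Finset (Fin n)}
    (h : ∀ i ∈ T, f (T.erase i) = g (T.erase i)) : kd N.D f T = kd N.D g T :=
  Finset.sum_congr rfl fun i hi => by rw [h i hi]

lemma kd_eq_zero {f : Finset (Fin n) → N.carrier} {T : Finset (Fin n)}
    (h : ∀ i ∈ T, f (T.erase i) = 0) : kd N.D f T = 0 :=
  Finset.sum_eq_zero fun i hi => by rw [h i hi, map_zero, smul_zero]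

lemma kd_kd (f : Finset (Fin n) → N.carrier) (T : Finset (Fin n)) : kd N.D (kd N.D f) T = 0 := by
  by_cases hT : 2 ≤ T.card
  · obtain ⟨p, hp⟩ : ∃ p, T.card = p + 2 := ⟨T.card - 2, by omega⟩
    have := N.cube.diff_diff (rfl : p + 1 = p + 1) (rfl : p + 1 + 1 = p + 2) (N.term p f)
    rw [diff_term, diff_term] at this
    exact congrFun this ⟨T, hp⟩
  · refine kd_eq_zero fun i hi => ?_
    have : T.erase i = ∅ := by
      rw [← Finset.card_eq_zero, Finset.card_erase_of_mem hi]
      omega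
    rw [this, kd, Finset.sum_empty]

lemma kd_fam_eq_zero {p : ℕ} {z : N.cube.Term p} (hz : z ∈ N.cube.Z p) (T : Finset (Fin n)) :
    kd N.D (N.fam z) T = 0 := by
  by_cases hc : T.card = p + 1
  · have := LinearMap.mem_ker.1 hz
    rw [← term_fam z, diff_term] at this
    exact congrFun this ⟨T, hc⟩
  · refine kd_eq_zero fun i hi => fam_of_ne z ?_
    rw [Finset.card_erase_of_mem hi]
    have := Finset.card_pos.2 ⟨i, hi⟩
    omega

lemma term_mem_Z {p : ℕ} {f : Finset (Fin n) → N.carrier}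
    (h : ∀ T, T.card = p + 1 → kd N.D f T = 0) : N.term p f ∈ N.cube.Z p := by
  refine LinearMap.mem_ker.2 ?_
  rw [diff_term]
  exact funext fun T => h T.1 T.2

lemma mem_bd_of_kd {p : ℕ} (z : N.cube.Term p) (g : Finset (Fin n) → N.carrier)
    (hg : ∀ S, S.card + 1 ≠ p → g S = 0) (h : ∀ S, S.card = p → kd N.D g S = N.fam z S) :
    z ∈ N.cube.bd p := by
  cases p with
  | zero =>
    refine (Submodule.mem_bot K).2 (funext fun S => ?_)
    exact (fam_apply z S).symm.trans ((h S.1 S.2).symm.trans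
      (kd_eq_zero fun i _ => hg _ (by omega)))
  | succ p =>
    refine ⟨N.term p g, ?_⟩
    rw [diff_term]
    exact funext fun T => (h T.1 T.2).trans (fam_apply z T)

lemma exists_kd_of_mem_bd {p : ℕ} {z : N.cube.Term (p + 1)} (hz : z ∈ N.cube.bd (p + 1)) :
    ∃ g : Finset (Fin n) → N.carrier, ∀ S, S.card = p + 1 → N.fam z S = kd N.D g S := by
  obtain ⟨g, rfl⟩ := hz
  refine ⟨N.fam g, fun S hS => ?_⟩
  conv_lhs => rw [← term_fam g, diff_term]
  exact fam_term _ hS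

end OpModule
end

noncomputable section
open CategoryTheory

/-! ### De Rham cohomology of polynomial models -/

section PolyModel

open ModuleCube OpModule MvPolynomial

variable {K : Type u} [Field K] {n : ℕ}

/-- The Euler operator in the variables different from `X k`. -/
def euler (k : Fin n) : MvPolynomial (Fin n) K →ₗ[K] MvPolynomial (Fin n) K :=
  ∑ i ∈ Finset.univ.erase k, LinearMap.mulLeft K (X i) ∘ₗ (pderiv i).toLinearMap

/-- The degree in the variables different from `X k`. -/
def degAway (k : Fin n) (s : Fin n →₀ ℕ) : ℕ := ∑ i ∈ Finset.univ.erase k, s i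

lemma euler_apply (k : Fin n) (f : MvPolynomial (Fin n) K) :
    euler k f = ∑ i ∈ Finset.univ.erase k, X i * pderiv i f := by
  simp [euler, LinearMap.sum_apply]

lemma euler_monomial (k : Fin n) (s : Fin n →₀ ℕ) (a : K) :
    euler k (monomial s a) = (degAway k s : K) • monomial s a := by
  rw [euler_apply, degAway, Nat.cast_sum, Finset.sum_smul]
  refine Finset.sum_congr rfl fun i _ => ?_
  rw [X_mul_pderiv_monomial, Nat.cast_smul_eq_nsmul]

lemma coeff_euler (k : Fin n) (s : Fin n →₀ ℕ) (f : MvPolynomial (Fin n) K) :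
    coeff s (euler k f) = degAway k s * coeff s f := by
  induction f using MvPolynomial.induction_on' with
  | monomial t a =>
    rw [euler_monomial, coeff_smul, coeff_monomial, smul_eq_mul]
    split_ifs with h
    · rw [h]
    · simp
  | add p q hp hq => rw [map_add, coeff_add, coeff_add, hp, hq, mul_add]

section Inverse

variable [CharZero K]

/-- The inverse of the Euler operator plus `m`. -/
def eulerInv (k : Fin n) (m : ℕ) : MvPolynomial (Fin n) K →ₗ[K] MvPolynomial (Fin n) K :=
  (basisMonomials (Fin n) K).constr K fun s => monomial s ((degAway k s + m : K)⁻¹)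

/-- On monomials the operator is diagonal with eigenvalue degree plus m, which is nonzero in
characteristic zero as m > 0. -/
lemma euler_eulerInv (k : Fin n) {m : ℕ} (hm : m ≠ 0) (f : MvPolynomial (Fin n) K) :
    euler k (eulerInv k m f) + (m : K) • eulerInv k m f = f := by
  have : (euler k + (m : K) • LinearMap.id) ∘ₗ eulerInv k m =
      (LinearMap.id : MvPolynomial (Fin n) K →ₗ[K] MvPolynomial (Fin n) K) := by
    refine (basisMonomials (Fin n) K).ext fun s => ?_
    have h : (degAway k s + m : K) ≠ 0 := by exact_mod_cast (by omega : degAway k s + m ≠ 0)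
    rw [LinearMap.comp_apply, eulerInv, Module.Basis.constr_basis]
    simp only [LinearMap.add_apply, euler_monomial, LinearMap.smul_apply, LinearMap.id_apply,
      coe_basisMonomials, smul_monomial, smul_eq_mul, ← map_add, ← add_mul, mul_inv_cancel₀ h]
  exact LinearMap.congr_fun this f

lemma eq_zero_of_euler (k : Fin n) {m : ℕ} (hm : m ≠ 0) (f : MvPolynomial (Fin n) K)
    (h : euler k f + (m : K) • f = 0) : f = 0 := by
  ext s
  have := congrArg (coeff s) h
  rw [coeff_add, coeff_euler, coeff_smul, coeff_zero, smul_eq_mul, ← add_mul] at this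
  have h : (degAway k s + m : K) ≠ 0 := by exact_mod_cast (by omega : degAway k s + m ≠ 0)
  exact (mul_eq_zero.1 this).resolve_left h

end Inverse

/-- The operators `X i` for `i ≠ k`, and `G - ∑ c i * X i` for `i = k`. -/
def polyOp (k : Fin n) (c : Fin n → K) (G : MvPolynomial (Fin n) K →ₗ[K] MvPolynomial (Fin n) K)
    (i : Fin n) : MvPolynomial (Fin n) K →ₗ[K] MvPolynomial (Fin n) K :=
  if i = k then G - LinearMap.mulLeft K (∑ j ∈ Finset.univ.erase k, C (c j) * X j)
  else LinearMap.mulLeft K (X i)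

lemma polyOp_self (k : Fin n) (c : Fin n → K) (G f) :
    polyOp k c G k f = G f - (∑ j ∈ Finset.univ.erase k, C (c j) * X j) * f := by
  rw [polyOp, if_pos rfl]
  rfl

lemma polyOp_of_ne {k i : Fin n} (h : i ≠ k) (c : Fin n → K) (G f) :
    polyOp k c G i f = X i * f := by
  rw [polyOp, if_neg h]
  rfl

lemma polyOp_comm (k : Fin n) (c : Fin n → K) (G : MvPolynomial (Fin n) K →ₗ[K] MvPolynomial (Fin n) K)
    (hG : ∀ i ≠ k, ∀ f, G (X i * f) = X i * G f) (i j : Fin n) (f) :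
    polyOp k c G i (polyOp k c G j f) = polyOp k c G j (polyOp k c G i f) := by
  by_cases hi : i = k
  · by_cases hj : j = k
    · rw [hi, hj]
    · rw [hi, polyOp_of_ne hj, polyOp_of_ne hj, polyOp_self, polyOp_self, hG j hj]
      ring
  · by_cases hj : j = k
    · rw [hj, polyOp_of_ne hi, polyOp_of_ne hi, polyOp_self, polyOp_self, hG i hi]
      ring
    · rw [polyOp_of_ne hi, polyOp_of_ne hj, polyOp_of_ne hj, polyOp_of_ne hi]
      ring

/-- The polynomial ring with the operators `polyOp`. -/
abbrev polyModule (k : Fin n) (c : Fin n → K) (G : MvPolynomial (Fin n) K →ₗ[K] MvPolynomial (Fin n) K)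
    (hG : ∀ i ≠ k, ∀ f, G (X i * f) = X i * G f) : OpModule K n where
  carrier := MvPolynomial (Fin n) K
  D := polyOp k c G
  comm := polyOp_comm k c G hG

/-- The partial derivatives with respect to the variables different from `X k`. -/
def pderivAway (k i : Fin n) : MvPolynomial (Fin n) K →ₗ[K] MvPolynomial (Fin n) K :=
  if i = k then 0 else (pderiv i).toLinearMap

section Homotopy

variable {k : Fin n} {c : Fin n → K} {G : MvPolynomial (Fin n) K →ₗ[K] MvPolynomial (Fin n) K}

/-- The operator which is homotopic to zero on the Koszul complex of `polyOp`. -/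
def lieOp (k : Fin n) (c : Fin n → K) (f : Finset (Fin n) → MvPolynomial (Fin n) K)
    (T : Finset (Fin n)) : MvPolynomial (Fin n) K :=
  euler k (f T) + ((Tᶜ.erase k).card : K) • f T +
    if k ∈ T then ∑ i ∈ Tᶜ, (sgn T k * sgn (T.erase k) i) • c i • f (insert i (T.erase k)) else 0

/-- The diagonal part of Cartan's formula gives the Euler operator; each index i ≠ k outside T
contributes X_i ∂_i + 1 instead of X_i ∂_i, whence the cardinality. The only nonzero mixed
commutators pair ∂_i with the linear form in the operator of index k, and they contribute c i. -/
lemma kd_kh_add_eq_lieOp (hG' : ∀ i ≠ k, ∀ f, pderiv i (G f) = G (pderiv i f))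
    (f : Finset (Fin n) → MvPolynomial (Fin n) K) (T : Finset (Fin n)) :
    kd (polyOp k c G) (kh (pderivAway k) f) T + kh (pderivAway k) (kd (polyOp k c G) f) T =
      lieOp k c f T := by
  rw [kd_kh_add_kh_kd, lieOp]
  congr 1
  · have h1 : ∑ i ∈ T, polyOp k c G i (pderivAway k i (f T)) =
        ∑ i ∈ T.erase k, X i * pderiv i (f T) := by
      refine (Finset.sum_subset (Finset.erase_subset k T) fun i hi hi' => ?_) |>.symm.trans ?_
      · have : i = k := by
          by_contra h
          exact hi' (Finset.mem_erase.2 ⟨h, hi⟩)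
        rw [this, pderivAway, if_pos rfl, LinearMap.zero_apply, map_zero]
      · refine Finset.sum_congr rfl fun i hi => ?_
        have h := Finset.ne_of_mem_erase hi
        rw [polyOp_of_ne h, pderivAway, if_neg h]
        rfl
    have h2 : ∑ i ∈ Tᶜ, pderivAway k i (polyOp k c G i (f T)) =
        ∑ i ∈ Tᶜ.erase k, (X i * pderiv i (f T) + f T) := by
      refine (Finset.sum_subset (Finset.erase_subset k Tᶜ) fun i hi hi' => ?_) |>.symm.trans ?_
      · have : i = k := by
          by_contra h
          exact hi' (Finset.mem_erase.2 ⟨h, hi⟩)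
        rw [this, pderivAway, if_pos rfl, LinearMap.zero_apply]
      · refine Finset.sum_congr rfl fun i hi => ?_
        have h := Finset.ne_of_mem_erase hi
        rw [polyOp_of_ne h, pderivAway, if_neg h]
        change pderiv i (X i * f T) = _
        rw [Derivation.leibniz, pderiv_X_self]
        simp
    rw [h1, h2, Finset.sum_add_distrib, ← add_assoc, euler_apply, Finset.sum_const,
      Nat.cast_smul_eq_nsmul]
    congr 1
    rw [← Finset.sum_union]
    · congr 1
      ext i
      simp only [Finset.mem_union, Finset.mem_erase, Finset.mem_compl, Finset.mem_univ, and_true]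
      tauto
    · rw [Finset.disjoint_left]
      intro i hi hi'
      exact (Finset.mem_compl.1 (Finset.mem_of_mem_erase hi')) (Finset.mem_of_mem_erase hi)
  · have hne : ∀ j ∈ T, j ≠ k → ∑ i ∈ Tᶜ, (sgn T j * sgn (T.erase j) i) •
        (polyOp k c G j (pderivAway k i (f (insert i (T.erase j)))) -
          pderivAway k i (polyOp k c G j (f (insert i (T.erase j))))) = 0 := by
      intro j hj hjk
      refine Finset.sum_eq_zero fun i hi => ?_
      have hij : i ≠ j := fun h => Finset.mem_compl.1 hi (h ▸ hj)
      rw [polyOp_of_ne hjk, polyOp_of_ne hjk, pderivAway]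
      split_ifs with hik
      · simp
      · change _ • (X j * pderiv i _ - pderiv i (X j * _)) = _
        rw [Derivation.leibniz, pderiv_X_of_ne hij.symm]
        simp
    split_ifs with hk
    · rw [Finset.sum_eq_single_of_mem k hk fun j hj hjk => hne j hj hjk]
      refine Finset.sum_congr rfl fun i hi => ?_
      have hik : i ≠ k := fun h => Finset.mem_compl.1 hi (h ▸ hk)
      congr 1
      rw [polyOp_self, polyOp_self, pderivAway, if_neg hik]
      change G (pderiv i _) - _ * pderiv i _ - pderiv i (G _ - _ * _) = _
      have hl : pderiv i (∑ j ∈ Finset.univ.erase k, C (c j) * X j) = C (c i) := by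
        rw [map_sum, Finset.sum_eq_single_of_mem i (Finset.mem_erase.2 ⟨hik, Finset.mem_univ i⟩)]
        · rw [pderiv_C_mul, pderiv_X_self]
          simp [C_eq_smul_one]
        · intro j _ hji
          rw [pderiv_C_mul, pderiv_X_of_ne hji]
          simp
      rw [map_sub, Derivation.leibniz, hl, hG' i hik, smul_eq_mul, smul_eq_mul, smul_eq_C_mul]
      ring
    · exact Finset.sum_eq_zero fun j hj => hne j hj fun h => hk (h ▸ hj)

end Homotopy

end PolyModel
end

noncomputable section
open CategoryTheory

/-! ### Vanishing below degree r, and the cocycles of degree r -/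

section PolyModel

open ModuleCube OpModule MvPolynomial

variable {K : Type u} [Field K] {n : ℕ}

lemma lieOp_sub (k : Fin n) (c : Fin n → K) (f g : Finset (Fin n) → MvPolynomial (Fin n) K)
    (T : Finset (Fin n)) : lieOp k c (f - g) T = lieOp k c f T - lieOp k c g T := by
  simp only [lieOp, Pi.sub_apply, map_sub, smul_sub, Finset.sum_sub_distrib]
  split_ifs <;> abel

/-- With d the Koszul differential and η the homotopy, `lieOp` is dη + ηd; since d² = 0, composing
it with d on either side gives dηd. -/
lemma kd_lieOp {k : Fin n} {c : Fin n → K}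
    {G : MvPolynomial (Fin n) K →ₗ[K] MvPolynomial (Fin n) K}
    (hG : ∀ i ≠ k, ∀ f, G (X i * f) = X i * G f)
    (hG' : ∀ i ≠ k, ∀ f, pderiv i (G f) = G (pderiv i f))
    (f : Finset (Fin n) → MvPolynomial (Fin n) K) (T : Finset (Fin n)) :
    kd (polyOp k c G) (lieOp k c f) T = lieOp k c (kd (polyOp k c G) f) T := by
  have hdd : ∀ f : Finset (Fin n) → MvPolynomial (Fin n) K, ∀ T,
      kd (polyOp k c G) (kd (polyOp k c G) f) T = 0 :=
    fun f T => kd_kd (N := polyModule k c G hG) f T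
  have h1 : lieOp k c f = fun T => kd (polyOp k c G) (kh (pderivAway k) f) T +
      kh (pderivAway k) (kd (polyOp k c G) f) T :=
    funext fun T => (kd_kh_add_eq_lieOp hG' f T).symm
  rw [← kd_kh_add_eq_lieOp hG', h1]
  have h2 : kd (polyOp k c G) (kd (polyOp k c G) f) = 0 := funext fun T => hdd f T
  rw [h2]
  have h3 : kh (pderivAway k) (0 : Finset (Fin n) → MvPolynomial (Fin n) K) T = 0 := by
    simp [kh]
  rw [h3, add_zero]
  have h4 := hdd (kh (pderivAway k) f) T
  simp only [kd, map_add, smul_add, Finset.sum_add_distrib] at h4 ⊢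
  rw [h4, zero_add]

/-- This is where the bound r comes from: fewer than r of the r + 1 indices leave out at least two,
hence one different from k, so the scalar added to the Euler operator is nonzero. -/
lemma card_compl_erase_pos {r : ℕ} (k : Fin (r + 1)) {T : Finset (Fin (r + 1))} (h : T.card < r) :
    (Tᶜ.erase k).card ≠ 0 := by
  have h1 := Finset.card_compl T
  have h2 := Finset.pred_card_le_card_erase (s := Tᶜ) (a := k)
  rw [Fintype.card_fin] at h1
  omega

lemma card_insert_erase_of_mem {k i : Fin n} {T : Finset (Fin n)} (hk : k ∈ T) (hi : i ∈ Tᶜ) :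
    (insert i (T.erase k)).card = T.card := by
  rw [Finset.card_insert_of_notMem (fun h => Finset.mem_compl.1 hi (Finset.mem_of_mem_erase h)),
    Finset.card_erase_add_one hk]

lemma notMem_insert_erase {k i : Fin n} {T : Finset (Fin n)} (hk : k ∈ T) (hi : i ∈ Tᶜ) :
    k ∉ insert i (T.erase k) := by
  intro h
  rcases Finset.mem_insert.1 h with rfl | h
  · exact Finset.mem_compl.1 hi hk
  · exact Finset.notMem_erase k T h

section CharZero

variable [CharZero K] {r : ℕ} {k : Fin (r + 1)} {c : Fin (r + 1) → K}

/-- `lieOp` is triangular: for k ∉ T it is Euler plus a positive integer, and for k ∈ T it also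
involves components at sets without k of the same size. One solves first on the sets without k, then
on those containing it. -/
lemma exists_lieOp_eq {q : ℕ} (hq : q < r)
    (w : Finset (Fin (r + 1)) → MvPolynomial (Fin (r + 1)) K) (hw : ∀ S, S.card ≠ q → w S = 0) :
    ∃ g : Finset (Fin (r + 1)) → MvPolynomial (Fin (r + 1)) K, (∀ S, S.card ≠ q → g S = 0) ∧
      ∀ T, lieOp k c g T = w T := by
  classical
  let e : Finset (Fin (r + 1)) → MvPolynomial (Fin (r + 1)) K := fun S =>
    eulerInv k (Sᶜ.erase k).card (w S)
  let g : Finset (Fin (r + 1)) → MvPolynomial (Fin (r + 1)) K := fun S =>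
    if k ∈ S then eulerInv k (Sᶜ.erase k).card (w S - ∑ i ∈ Sᶜ,
      (sgn S k * sgn (S.erase k) i) • c i • e (insert i (S.erase k))) else e S
  have he : ∀ S, S.card ≠ q → e S = 0 := fun S hS => by simp only [e, hw S hS, map_zero]
  have hg : ∀ S, S.card ≠ q → g S = 0 := by
    intro S hS
    simp only [g]
    split_ifs with hk
    · rw [hw S hS, Finset.sum_eq_zero, sub_zero, map_zero]
      intro i hi
      rw [he _ (by rwa [card_insert_erase_of_mem hk hi]), smul_zero, smul_zero]
    · exact he S hS
  refine ⟨g, hg, fun T => ?_⟩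
  by_cases hT : T.card = q
  · have hm := card_compl_erase_pos k (hT ▸ hq)
    rw [lieOp]
    split_ifs with hk
    · have h1 : g T = eulerInv k (Tᶜ.erase k).card (w T - ∑ i ∈ Tᶜ,
          (sgn T k * sgn (T.erase k) i) • c i • e (insert i (T.erase k))) := if_pos hk
      rw [h1, euler_eulerInv k hm, sub_add_eq_add_sub, sub_eq_iff_eq_add]
      congr 1
      refine Finset.sum_congr rfl fun i hi => ?_
      have : g (insert i (T.erase k)) = e (insert i (T.erase k)) :=
        if_neg (notMem_insert_erase hk hi)
      rw [this]
    · have h1 : g T = e T := if_neg hk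
      rw [h1, add_zero]
      exact euler_eulerInv k hm _
  · rw [hw T hT, lieOp, hg T hT, map_zero, smul_zero, zero_add, zero_add]
    split_ifs with hk
    · refine Finset.sum_eq_zero fun i hi => ?_
      rw [hg _ (by rwa [card_insert_erase_of_mem hk hi]), smul_zero, smul_zero]
    · rfl

/-- Injectivity by the same triangularity: components without k vanish first, which removes the
correction in the others. -/
lemma eq_zero_of_lieOp {q : ℕ} (hq : q < r)
    (f : Finset (Fin (r + 1)) → MvPolynomial (Fin (r + 1)) K)
    (h : ∀ T, lieOp k c f T = 0) (T : Finset (Fin (r + 1))) (hT : T.card = q) : f T = 0 := by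
  have h1 : ∀ T : Finset (Fin (r + 1)), T.card = q → k ∉ T → f T = 0 := by
    intro T hT hk
    have := h T
    rw [lieOp, if_neg hk, add_zero] at this
    exact eq_zero_of_euler k (card_compl_erase_pos k (hT ▸ hq)) _ this
  by_cases hk : k ∈ T
  · have := h T
    rw [lieOp, if_pos hk, Finset.sum_eq_zero, add_zero] at this
    · exact eq_zero_of_euler k (card_compl_erase_pos k (hT ▸ hq)) _ this
    · intro i hi
      rw [h1 _ (by rwa [card_insert_erase_of_mem hk hi]) (notMem_insert_erase hk hi), smul_zero,
        smul_zero]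
  · exact h1 T hT hk

variable {G : MvPolynomial (Fin (r + 1)) K →ₗ[K] MvPolynomial (Fin (r + 1)) K}
  (hG : ∀ i ≠ k, ∀ f, G (X i * f) = X i * G f)

/-- Every cocycle of degree at most `r` is cohomologous to one annihilated by `lieOp`. -/
lemma exists_cohomologous (hG' : ∀ i ≠ k, ∀ f, pderiv i (G f) = G (pderiv i f)) {p : ℕ} (hp : p ≤ r)
    {z : (polyModule k c G hG).cube.Term p} (hz : z ∈ (polyModule k c G hG).cube.Z p) :
    ∃ f : Finset (Fin (r + 1)) → MvPolynomial (Fin (r + 1)) K,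
      (∀ S, S.card ≠ p → f S = 0) ∧ (∀ T, kd (polyOp k c G) f T = 0) ∧ (∀ T, lieOp k c f T = 0) ∧
      z - (polyModule k c G hG).term p f ∈ (polyModule k c G hG).cube.bd p := by
  let N := polyModule k c G hG
  let f₀ : Finset (Fin (r + 1)) → MvPolynomial (Fin (r + 1)) K := N.fam z
  have hf₀ : ∀ S, S.card ≠ p → f₀ S = 0 := fun S hS => fam_of_ne z hS
  have hdf₀ : ∀ T, kd (polyOp k c G) f₀ T = 0 := kd_fam_eq_zero hz
  have hkh : ∀ S, S.card + 1 ≠ p → kh (pderivAway k) f₀ S = 0 := by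
    intro S hS
    refine Finset.sum_eq_zero fun i hi => ?_
    rw [hf₀ _ (by rwa [Finset.card_insert_of_notMem (Finset.mem_compl.1 hi)]), map_zero, smul_zero]
  -- Solve L g = η f₀, where L is `lieOp` and η the homotopy; this lives in degree p - 1 < r, where
  -- L is invertible. In degree 0 there is nothing to correct.
  obtain ⟨g, hg1, hg2⟩ : ∃ g : Finset (Fin (r + 1)) → MvPolynomial (Fin (r + 1)) K,
      (∀ S, S.card + 1 ≠ p → g S = 0) ∧ ∀ T, lieOp k c g T = kh (pderivAway k) f₀ T := by
    cases p with
    | zero =>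
      refine ⟨0, fun _ _ => rfl, fun T => ?_⟩
      rw [hkh T (by omega)]
      simp [lieOp]
    | succ p =>
      obtain ⟨g, h1, h2⟩ := exists_lieOp_eq (k := k) (c := c) (show p < r by omega)
        (kh (pderivAway k) f₀) (fun S hS => hkh S (by omega))
      exact ⟨g, fun S hS => h1 S (by omega), h2⟩
  have hdg : ∀ S, S.card ≠ p → kd (polyOp k c G) g S = 0 := by
    intro S hS
    refine Finset.sum_eq_zero fun i hi => ?_
    rw [hg1 _ (by rwa [Finset.card_erase_add_one hi]), map_zero, smul_zero]
  refine ⟨f₀ - kd (polyOp k c G) g, fun S hS => ?_, fun T => ?_, fun T => ?_, ?_⟩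
  · rw [Pi.sub_apply, hf₀ S hS, hdg S hS, sub_zero]
  · rw [kd_sub, hdf₀ T, zero_sub, neg_eq_zero]
    exact kd_kd (N := N) g T
  -- L(f₀ - dg) = (dη + ηd)f₀ - dηf₀ = ηdf₀ = 0.
  · rw [lieOp_sub, ← kd_lieOp hG hG', funext hg2, ← kd_kh_add_eq_lieOp hG', funext hdf₀]
    have : kh (pderivAway k) (fun _ => (0 : MvPolynomial (Fin (r + 1)) K)) T = 0 := by
      simp [kh]
    rw [this, add_zero, sub_self]
  · refine mem_bd_of_kd _ g hg1 fun S hS => ?_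
    have h1 : N.fam (z - N.term p (f₀ - kd (polyOp k c G) g)) S =
        f₀ S - (f₀ S - kd (polyOp k c G) g S) := by
      refine (fam_apply (N := N) _ ⟨S, hS⟩).trans ?_
      have h2 : f₀ S = z ⟨S, hS⟩ := fam_apply (N := N) z ⟨S, hS⟩
      exact congrArg (fun x => x - (f₀ S - kd (polyOp k c G) g S)) h2.symm
    exact ((sub_sub_cancel (f₀ S) _).symm.trans h1.symm)

/-- Every class has a representative killed by `lieOp`, and below degree r this operator is
injective. -/
theorem polyModule_low (hG' : ∀ i ≠ k, ∀ f, pderiv i (G f) = G (pderiv i f)) {p : ℕ} (hp : p < r) :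
    Subsingleton ((polyModule k c G hG).cube.H p) := by
  rw [subsingleton_H_iff]
  intro z hz
  obtain ⟨f, hf1, -, hf3, hf4⟩ := exists_cohomologous hG hG' hp.le hz
  have : (polyModule k c G hG).term p f = 0 :=
    funext fun S => eq_zero_of_lieOp hp f hf3 S.1 S.2
  rwa [this, sub_zero] at hf4

end CharZero

/-- The cocycle of degree `r` determined by a polynomial. -/
def cocyc {r : ℕ} (k : Fin (r + 1)) (c : Fin (r + 1) → K) (u : MvPolynomial (Fin (r + 1)) K)
    (T : Finset (Fin (r + 1))) : MvPolynomial (Fin (r + 1)) K :=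
  if T = Finset.univ.erase k then u
  else if k ∈ T ∧ T.card = r then
    -∑ i ∈ Tᶜ, (sgn T k * sgn (T.erase k) i) • c i • u else 0

/-- The components at the sets containing k are chosen so that, under the operators X_i, they yield
the terms c_i X_i u which cancel the linear form in the operator of index k. What is left is G u, up
to sign. -/
lemma kd_cocyc {r : ℕ} (k : Fin (r + 1)) (c : Fin (r + 1) → K)
    (G : MvPolynomial (Fin (r + 1)) K →ₗ[K] MvPolynomial (Fin (r + 1)) K)
    (u : MvPolynomial (Fin (r + 1)) K) :
    kd (polyOp k c G) (cocyc k c u) Finset.univ = sgn Finset.univ k • G u := by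
  rw [kd, ← Finset.add_sum_erase _ _ (Finset.mem_univ k), polyOp_self]
  have h1 : cocyc k c u (Finset.univ.erase k) = u := if_pos rfl
  have h2 : ∀ i ∈ Finset.univ.erase k, sgn Finset.univ i • polyOp k c G i
      (cocyc k c u (Finset.univ.erase i)) = sgn Finset.univ k • (C (c i) * X i * u) := by
    intro i hi
    have hik := Finset.ne_of_mem_erase hi
    have hne : Finset.univ.erase i ≠ Finset.univ.erase k := by
      intro h
      have : k ∈ Finset.univ.erase i := Finset.mem_erase.2 ⟨hik.symm, Finset.mem_univ k⟩
      rw [h] at this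
      exact Finset.notMem_erase k _ this
    have hcard : (Finset.univ.erase i).card = r := by
      rw [Finset.card_erase_of_mem (Finset.mem_univ i), Finset.card_univ, Fintype.card_fin]
      rfl
    rw [polyOp_of_ne hik, cocyc, if_neg hne,
      if_pos ⟨Finset.mem_erase.2 ⟨hik.symm, Finset.mem_univ k⟩, hcard⟩, Finset.compl_erase,
      Finset.compl_univ, insert_empty_eq, Finset.sum_singleton, mul_neg, mul_smul_comm, smul_neg,
      smul_smul, ← neg_smul]
    have hs : -(sgn Finset.univ i * (sgn (Finset.univ.erase i) k *
        sgn ((Finset.univ.erase i).erase k) i)) = sgn Finset.univ k := by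
      rw [Finset.erase_right_comm, sgn_erase_self]
      have e1 := sgn_erase_mul Finset.univ (Finset.mem_univ i) (Finset.mem_univ k) hik
      have e2 := sgn_mul_self (Finset.univ.erase k) i
      linear_combination (-(sgn (Finset.univ.erase k) i)) * e1 + (sgn Finset.univ k) * e2
    rw [hs, smul_eq_C_mul]
    congr 1
    ring
  rw [Finset.sum_congr rfl h2, h1, ← Finset.smul_sum, ← smul_add, Finset.sum_mul, sub_add_cancel]

section CharZero

variable [CharZero K] {r : ℕ} {k : Fin (r + 1)} {c : Fin (r + 1) → K}

/-- The only r-element set without k omits k alone, so there `lieOp` is the bare Euler operator and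
it kills the component u. At a set containing k exactly one other index is missing, so `lieOp` is
Euler plus one, together with a term in u that Euler kills; injectivity of Euler plus one determines
that component. -/
lemma eq_cocyc (f : Finset (Fin (r + 1)) → MvPolynomial (Fin (r + 1)) K)
    (h : ∀ T, lieOp k c f T = 0) (T : Finset (Fin (r + 1))) (hT : T.card = r) :
    f T = cocyc k c (f (Finset.univ.erase k)) T ∧ euler k (f (Finset.univ.erase k)) = 0 := by
  have hu : euler k (f (Finset.univ.erase k)) = 0 := by
    have := h (Finset.univ.erase k)
    rw [lieOp, if_neg (Finset.notMem_erase k _), add_zero, Finset.compl_erase, Finset.compl_univ,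
      insert_empty_eq, Finset.erase_singleton, Finset.card_empty, Nat.cast_zero, zero_smul,
      add_zero] at this
    exact this
  have huniv : ∀ S : Finset (Fin (r + 1)), k ∉ S → S.card = r → S = Finset.univ.erase k := by
    intro S hk hS
    refine Finset.eq_of_subset_of_card_le
      (fun i hi => Finset.mem_erase.2 ⟨fun h => hk (h ▸ hi), Finset.mem_univ i⟩) ?_
    rw [hS, Finset.card_erase_of_mem (Finset.mem_univ k), Finset.card_univ, Fintype.card_fin]
    exact le_rfl
  refine ⟨?_, hu⟩
  by_cases hk : k ∈ T
  · have hne : T ≠ Finset.univ.erase k := fun h => Finset.notMem_erase k _ (h ▸ hk)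
    rw [cocyc, if_neg hne, if_pos ⟨hk, hT⟩, ← sub_eq_zero, sub_neg_eq_add]
    refine eq_zero_of_euler k one_ne_zero _ ?_
    have hl := h T
    have hc : (Tᶜ.erase k).card = 1 := by
      rw [Finset.erase_eq_of_notMem (fun h => Finset.mem_compl.1 h hk), Finset.card_compl,
        Fintype.card_fin, hT]
      omega
    rw [lieOp, if_pos hk, hc, Finset.sum_congr rfl fun i hi => by
      rw [huniv _ (notMem_insert_erase hk hi) ((card_insert_erase_of_mem hk hi).trans hT)]] at hl
    have he : euler k (∑ i ∈ Tᶜ, (sgn T k * sgn (T.erase k) i) • c i •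
        f (Finset.univ.erase k)) = 0 := by
      rw [map_sum]
      refine Finset.sum_eq_zero fun i _ => ?_
      rw [map_zsmul, map_smul, hu, smul_zero, smul_zero]
    rw [map_add, he, add_zero, smul_add, ← add_assoc]
    rw [Nat.cast_one, one_smul] at hl ⊢
    rw [one_smul]
    exact hl
  · have := huniv T hk hT
    rw [cocyc, if_pos this, this]

end CharZero

variable {r : ℕ} {k : Fin (r + 1)} {c : Fin (r + 1) → K}

/-- The coboundaries of top degree. -/
lemma mem_bd_top {N : OpModule K (r + 1)} (z : N.cube.Term (r + 1)) (g : Fin (r + 1) → N.carrier)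
    (h : ∑ i, N.D i (g i) = N.fam z Finset.univ) : z ∈ N.cube.bd (r + 1) := by
  classical
  -- The sign attached to the component omitting i cancels the sign of the Koszul differential.
  refine mem_bd_of_kd z (fun S => ∑ i, if S = Finset.univ.erase i then sgn Finset.univ i • g i
    else 0) (fun S hS => Finset.sum_eq_zero fun i _ => if_neg ?_) fun S hS => ?_
  · rintro rfl
    refine hS ?_
    rw [Finset.card_erase_add_one (Finset.mem_univ i), Finset.card_univ, Fintype.card_fin]
  · have hS : S = Finset.univ := by
      rw [← Finset.card_eq_iff_eq_univ, hS, Fintype.card_fin]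
    rw [hS, ← h, kd]
    refine Finset.sum_congr rfl fun i _ => ?_
    rw [Finset.sum_eq_single_of_mem i (Finset.mem_univ i), if_pos rfl, map_zsmul, smul_smul,
      sgn_mul_self, one_smul]
    intro j _ hji
    refine if_neg fun h => hji ?_
    by_contra hne
    have : j ∈ Finset.univ.erase i := Finset.mem_erase.2 ⟨hne, Finset.mem_univ j⟩
    rw [h] at this
    exact Finset.notMem_erase j _ this

/-- The polynomials which represent coboundaries of top degree. -/
def topBd (N : OpModule K n) : Submodule K N.carrier :=
  LinearMap.range (∑ i, N.D i ∘ₗ LinearMap.proj (R := K) (φ := fun _ : Fin n => N.carrier) i)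

lemma mem_topBd {N : OpModule K n} (i : Fin n) (x : N.carrier) : N.D i x ∈ topBd N := by
  classical
  refine ⟨Pi.single i x, ?_⟩
  rw [LinearMap.sum_apply, Finset.sum_eq_single_of_mem i (Finset.mem_univ i)]
  · simp
  · intro j _ hji
    simp [Pi.single_eq_of_ne hji]

lemma mem_bd_of_mem_topBd {N : OpModule K (r + 1)} (z : N.cube.Term (r + 1))
    (h : N.fam z Finset.univ ∈ topBd N) : z ∈ N.cube.bd (r + 1) := by
  obtain ⟨g, hg⟩ := h
  refine mem_bd_top z g (Eq.trans ?_ hg)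
  rw [LinearMap.sum_apply]
  rfl

/-- The linear form in the operator of index k is itself a combination of the other operators X_i,
so G has its image in the sum of the images of all operators. -/
lemma G_mem_topBd {G : MvPolynomial (Fin (r + 1)) K →ₗ[K] MvPolynomial (Fin (r + 1)) K}
    (hG : ∀ i ≠ k, ∀ f, G (X i * f) = X i * G f) (f : MvPolynomial (Fin (r + 1)) K) :
    (G f : MvPolynomial (Fin (r + 1)) K) ∈ topBd (polyModule k c G hG) := by
  have h1 : polyOp k c G k f ∈ topBd (polyModule k c G hG) :=
    mem_topBd (N := polyModule k c G hG) k f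
  have h2 : ∀ i ∈ Finset.univ.erase k, c i • (X i * f) ∈ topBd (polyModule k c G hG) := by
    intro i hi
    refine Submodule.smul_mem _ _ ?_
    have := mem_topBd (N := polyModule k c G hG) i f
    change polyOp k c G i f ∈ _ at this
    rwa [polyOp_of_ne (Finset.ne_of_mem_erase hi)] at this
  have h3 := Submodule.add_mem _ h1 (Submodule.sum_mem _ h2)
  have h4 : polyOp k c G k f + ∑ i ∈ Finset.univ.erase k, c i • (X i * f) = G f := by
    rw [polyOp_self, Finset.sum_mul, sub_add_eq_add_sub, sub_eq_iff_eq_add]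
    congr 1
    refine Finset.sum_congr rfl fun i _ => ?_
    rw [smul_eq_C_mul, mul_assoc]
  rwa [h4] at h3

end PolyModel
end

noncomputable section
open CategoryTheory

/-! ### The two models: G = ∂_k for a line, G = X_k for the origin -/

section PolyModel

open ModuleCube OpModule MvPolynomial

variable {K : Type u} [Field K]

lemma kd_cocyc_eq {r : ℕ} {k : Fin (r + 1)} {c : Fin (r + 1) → K}
    {G : MvPolynomial (Fin (r + 1)) K →ₗ[K] MvPolynomial (Fin (r + 1)) K}
    {u : MvPolynomial (Fin (r + 1)) K} (hu : G u = 0) (T : Finset (Fin (r + 1)))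
    (hT : T.card = r + 1) : kd (polyOp k c G) (cocyc k c u) T = 0 := by
  have : T = Finset.univ := by rw [← Finset.card_eq_iff_eq_univ, hT, Fintype.card_fin]
  rw [this, kd_cocyc, hu, smul_zero]

lemma cocyc_C {r : ℕ} (k : Fin (r + 1)) (c : Fin (r + 1) → K) (a : K) (T : Finset (Fin (r + 1))) :
    cocyc k c (C a) T = a • cocyc k c 1 T := by
  have h : (C a : MvPolynomial (Fin (r + 1)) K) = a • 1 := by rw [smul_eq_C_mul, mul_one]
  rw [h, cocyc, cocyc]
  split_ifs
  · rfl
  · rw [smul_neg, Finset.smul_sum]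
    refine congrArg _ (Finset.sum_congr rfl fun i _ => ?_)
    rw [smul_comm a, smul_comm a]
  · rw [smul_zero]

/-- In degree `r` every class is represented by the cocycle of a polynomial killed by `G` and by
the Euler operator. -/
lemma exists_cocyc [CharZero K] {r : ℕ} {k : Fin (r + 1)} {c : Fin (r + 1) → K}
    {G : MvPolynomial (Fin (r + 1)) K →ₗ[K] MvPolynomial (Fin (r + 1)) K}
    (hG : ∀ i ≠ k, ∀ f, G (X i * f) = X i * G f)
    (hG' : ∀ i ≠ k, ∀ f, pderiv i (G f) = G (pderiv i f))
    {z : (polyModule k c G hG).cube.Term r} (hz : z ∈ (polyModule k c G hG).cube.Z r) :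
    ∃ u, G u = 0 ∧ euler k u = 0 ∧
      z - (polyModule k c G hG).term r (cocyc k c u) ∈ (polyModule k c G hG).cube.bd r := by
  obtain ⟨f, hf1, hf2, hf3, hf4⟩ := exists_cohomologous hG hG' le_rfl hz
  have hc : (Finset.univ.erase k).card = r := by
    rw [Finset.card_erase_of_mem (Finset.mem_univ k), Finset.card_univ, Fintype.card_fin]
    rfl
  refine ⟨f (Finset.univ.erase k), ?_, (eq_cocyc f hf3 _ hc).2, ?_⟩
  · have h1 := hf2 Finset.univ
    rw [kd_congr (N := polyModule k c G hG) (g := cocyc k c (f (Finset.univ.erase k))) fun i hi =>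
      (eq_cocyc f hf3 _ (by
        rw [Finset.card_erase_of_mem hi, Finset.card_univ, Fintype.card_fin]
        rfl)).1] at h1
    have h2 := h1.symm.trans (kd_cocyc k c G (f (Finset.univ.erase k)))
    have h3 := congrArg (fun x => sgn Finset.univ k • x) h2
    simp only [smul_smul, sgn_mul_self, one_smul, smul_zero] at h3
    exact h3.symm
  · have : (polyModule k c G hG).term r (cocyc k c (f (Finset.univ.erase k))) =
        (polyModule k c G hG).term r f :=
      funext fun S => (eq_cocyc f hf3 S.1 S.2).1.symm
    rwa [this]

section Pderiv

lemma pderiv_X_mul {n : ℕ} {i k : Fin n} (h : i ≠ k) (f : MvPolynomial (Fin n) K) :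
    (pderiv k).toLinearMap (X i * f) = X i * (pderiv k).toLinearMap f := by
  change pderiv k (X i * f) = X i * pderiv k f
  rw [Derivation.leibniz, pderiv_X_of_ne h, smul_zero, add_zero, smul_eq_mul]

lemma pderiv_surjective [CharZero K] {n : ℕ} (k : Fin n) (f : MvPolynomial (Fin n) K) :
    ∃ g, pderiv k g = f := by
  induction f using MvPolynomial.induction_on' with
  | monomial s a =>
    refine ⟨monomial (s + Finsupp.single k 1) (a * ((s k : K) + 1)⁻¹), ?_⟩
    rw [pderiv_monomial, add_tsub_cancel_right]
    congr 1
    have : (s k : K) + 1 ≠ 0 := by exact_mod_cast Nat.succ_ne_zero (s k)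
    simp [this]
  | add p q hp hq =>
    obtain ⟨g, rfl⟩ := hp
    obtain ⟨g', rfl⟩ := hq
    exact ⟨g + g', map_add _ _ _⟩

lemma coeff_X_mul_pderiv {n : ℕ} (k : Fin n) (s : Fin n →₀ ℕ) (f : MvPolynomial (Fin n) K) :
    coeff s (X k * pderiv k f) = s k * coeff s f := by
  induction f using MvPolynomial.induction_on' with
  | monomial t a =>
    rw [X_mul_pderiv_monomial, coeff_smul, coeff_monomial, nsmul_eq_mul]
    split_ifs with h
    · rw [h]
    · simp
  | add p q hp hq => rw [map_add, mul_add, coeff_add, coeff_add, hp, hq, mul_add]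

/-- The Euler operator detects the degree in the variables other than X_k, and X_k ∂_k detects the
exponent of X_k; in characteristic zero only the constant monomial survives both. -/
lemma eq_C_of_euler_of_pderiv [CharZero K] {n : ℕ} {k : Fin n} {u : MvPolynomial (Fin n) K}
    (h : euler k u = 0) (h' : pderiv k u = 0) : u = C (coeff 0 u) := by
  ext s
  rw [coeff_C]
  split_ifs with hs
  · rw [hs]
  · by_contra hne
    have h1 := congrArg (coeff s) h
    rw [coeff_euler, coeff_zero, mul_eq_zero, or_iff_left hne, Nat.cast_eq_zero, degAway,
      Finset.sum_eq_zero_iff] at h1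
    have h2 := coeff_X_mul_pderiv k s u
    rw [h', mul_zero, coeff_zero, eq_comm, mul_eq_zero, or_iff_left hne, Nat.cast_eq_zero] at h2
    refine hs (Finsupp.ext fun i => ?_) |>.elim
    by_cases hi : i = k
    · rw [hi, h2]
      rfl
    · exact (h1 i (Finset.mem_erase.2 ⟨hi, Finset.mem_univ i⟩)).symm

/-- In degree r the polynomial u is killed by Euler and by ∂_k, hence is constant. The cocycle of 1
is no coboundary, because at the set omitting k coboundaries lie in the ideal of the X_i with i ≠ k.
In top degree ∂_k is already surjective. -/
theorem hasDims_pderiv [CharZero K] {r : ℕ} (hr : 0 < r) (k : Fin (r + 1)) (c : Fin (r + 1) → K) :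
    (polyModule k c (pderiv k).toLinearMap fun _ h => pderiv_X_mul h).HasDims 1 0 := by
  let N := polyModule k c (pderiv k).toLinearMap fun _ h => pderiv_X_mul h
  have hG' : ∀ i ≠ k, ∀ f : MvPolynomial (Fin (r + 1)) K,
      pderiv i ((pderiv k).toLinearMap f) = (pderiv k).toLinearMap (pderiv i f) :=
    fun i _ f => pderiv_comm i k f
  have hv : N.term r (cocyc k c 1) ∈ N.cube.Z r := term_mem_Z fun T hT =>
    kd_cocyc_eq (G := (pderiv k).toLinearMap) (by exact pderiv_one) T hT
  have hfin : Module.finrank K (N.cube.H r) = 1 := by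
    refine finrank_eq_one_iff'.2 ⟨N.cube.cls r ⟨_, hv⟩, ?_, fun w => ?_⟩
    · rw [Ne, cls_eq_zero_iff]
      intro h
      obtain ⟨r, rfl⟩ : ∃ q, r = q + 1 := ⟨r - 1, by omega⟩
      obtain ⟨g, hg⟩ := exists_kd_of_mem_bd h
      have hc : (Finset.univ.erase k).card = r + 1 := by
        rw [Finset.card_erase_of_mem (Finset.mem_univ k), Finset.card_univ, Fintype.card_fin]
        rfl
      have h1 : (1 : MvPolynomial (Fin (r + 2)) K) =
          kd (polyOp k c (pderiv k).toLinearMap) g (Finset.univ.erase k) := by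
        refine Eq.trans ?_ (hg _ hc)
        refine Eq.trans ?_ (fam_term (N := N) (cocyc k c 1) hc).symm
        exact (if_pos rfl).symm
      have h2 := congrArg constantCoeff h1
      rw [kd, map_one, map_sum, Finset.sum_eq_zero fun i hi => by
        rw [polyOp_of_ne (Finset.ne_of_mem_erase hi), map_zsmul, map_mul, constantCoeff_X, zero_mul,
          smul_zero]] at h2
      exact one_ne_zero h2
    · obtain ⟨⟨z, hz⟩, rfl⟩ := N.cube.cls_surjective r w
      obtain ⟨u, hu, hu', h⟩ := exists_cocyc (c := c) (fun _ h => pderiv_X_mul h) hG' hz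
      have hC := eq_C_of_euler_of_pderiv hu' hu
      refine ⟨coeff 0 u, ?_⟩
      rw [← map_smul, eq_comm, ← sub_eq_zero, ← map_sub, cls_eq_zero_iff]
      have : N.term r (cocyc k c u) = coeff 0 u • N.term r (cocyc k c 1) := by
        funext S
        refine Eq.trans ?_ (cocyc_C k c (coeff 0 u) S.1)
        rw [← hC]
        rfl
      rw [this] at h
      exact h
  have htop : Subsingleton (N.cube.H (r + 1)) := by
    rw [subsingleton_H_iff]
    intro z _
    refine mem_bd_of_mem_topBd z ?_
    obtain ⟨g, hg⟩ := pderiv_surjective k (N.fam z Finset.univ)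
    rw [← hg]
    exact G_mem_topBd (fun _ h => pderiv_X_mul h) g
  exact ⟨fun p hp => polyModule_low _ hG' hp, Module.finite_of_finrank_pos (by rw [hfin]; exact one_pos),
    hfin, inferInstance, Module.finrank_zero_of_subsingleton⟩

end Pderiv

section MulX

lemma mulLeft_X_mul {n : ℕ} (i k : Fin n) (f : MvPolynomial (Fin n) K) :
    LinearMap.mulLeft K (X k) (X i * f) = X i * LinearMap.mulLeft K (X k) f := by
  simp only [LinearMap.mulLeft_apply]
  ring

/-- In degree r the condition X_k u = 0 forces u = 0. In top degree the images of the operators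
together fill the ideal of all variables, and the constant coefficient identifies the quotient with
K. -/
theorem hasDims_mulLeft_X [CharZero K] {r : ℕ} (k : Fin (r + 1)) (c : Fin (r + 1) → K) :
    (polyModule k c (LinearMap.mulLeft K (X k)) fun i _ => mulLeft_X_mul i k).HasDims 0 1 := by
  let N := polyModule k c (LinearMap.mulLeft K (X k)) fun i _ => mulLeft_X_mul i k
  have hG' : ∀ i ≠ k, ∀ f : MvPolynomial (Fin (r + 1)) K,
      pderiv i (LinearMap.mulLeft K (X k) f) = LinearMap.mulLeft K (X k) (pderiv i f) :=
    fun i hi f => by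
      simp only [LinearMap.mulLeft_apply]
      exact pderiv_X_mul hi.symm f
  have hsub : Subsingleton (N.cube.H r) := by
    rw [subsingleton_H_iff]
    intro z hz
    obtain ⟨u, hu, -, h⟩ := exists_cocyc (c := c) (fun i _ => mulLeft_X_mul i k) hG' hz
    have hu0 : u = 0 := (mul_eq_zero.1 hu).resolve_left (X_ne_zero k)
    have h0 : N.term r (cocyc k c u) = 0 := by
      funext S
      refine Eq.trans (?_ : cocyc k c u S.1 = (0 : K) • cocyc k c 1 S.1) (zero_smul _ _)
      rw [hu0, ← cocyc_C, C_0]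
    rw [h0, sub_zero] at h
    exact h
  have hv : ∀ z : N.cube.Term (r + 1), z ∈ N.cube.Z (r + 1) := fun z =>
    LinearMap.mem_ker.2 (funext fun S => absurd S.2 (by
      have := S.1.card_le_univ
      rw [Fintype.card_fin] at this
      omega))
  have htop : ∀ f : MvPolynomial (Fin (r + 1)) K, f - C (constantCoeff f) ∈ topBd N := by
    intro f
    induction f using MvPolynomial.induction_on with
    | C a => rw [constantCoeff_C, sub_self]; exact Submodule.zero_mem _
    | add p q hp hq =>
      rw [map_add, C_add, add_sub_add_comm]
      exact Submodule.add_mem _ hp hq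
    | mul_X p i _ =>
      rw [map_mul, constantCoeff_X, mul_zero, C_0, sub_zero, mul_comm]
      by_cases hi : i = k
      · rw [hi]
        exact G_mem_topBd (fun i _ => mulLeft_X_mul i k) p
      · have := mem_topBd (N := N) i p
        change polyOp k c _ i p ∈ _ at this
        rwa [polyOp_of_ne hi] at this
  have hfin : Module.finrank K (N.cube.H (r + 1)) = 1 := by
    refine finrank_eq_one_iff'.2 ⟨N.cube.cls (r + 1) ⟨N.term (r + 1) fun _ => (1 : MvPolynomial (Fin (r + 1)) K), hv _⟩,
      ?_, fun w => ?_⟩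
    · rw [Ne, cls_eq_zero_iff]
      intro h
      obtain ⟨g, hg⟩ := exists_kd_of_mem_bd h
      have hc : (Finset.univ : Finset (Fin (r + 1))).card = r + 1 := by
        rw [Finset.card_univ, Fintype.card_fin]
      have h1 : (1 : MvPolynomial (Fin (r + 1)) K) =
          kd (polyOp k c (LinearMap.mulLeft K (X k))) g Finset.univ := by
        refine Eq.trans ?_ (hg _ hc)
        exact (fam_term (N := N) (fun _ => (1 : MvPolynomial (Fin (r + 1)) K)) hc).symm
      have h2 := congrArg constantCoeff h1
      rw [kd, map_one, map_sum, Finset.sum_eq_zero fun i hi => by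
        rw [map_zsmul]
        by_cases hi : i = k
        · rw [hi, polyOp_self, LinearMap.mulLeft_apply, map_sub, map_mul, map_mul, map_sum]
          simp
        · rw [polyOp_of_ne hi, map_mul, constantCoeff_X, zero_mul, smul_zero]] at h2
      exact one_ne_zero h2
    · obtain ⟨⟨z, hz⟩, rfl⟩ := N.cube.cls_surjective (r + 1) w
      let x : MvPolynomial (Fin (r + 1)) K := N.fam z Finset.univ
      refine ⟨constantCoeff x, ?_⟩
      rw [← map_smul, eq_comm, ← sub_eq_zero, ← map_sub, cls_eq_zero_iff]
      refine mem_bd_of_mem_topBd _ ?_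
      have hc : (Finset.univ : Finset (Fin (r + 1))).card = r + 1 := by
        rw [Finset.card_univ, Fintype.card_fin]
      have h1 : N.fam (z - constantCoeff x • N.term (r + 1) fun _ => (1 : MvPolynomial (Fin (r + 1)) K))
          Finset.univ = x - C (constantCoeff x) := by
        refine (fam_apply (N := N) _ ⟨Finset.univ, hc⟩).trans ?_
        have h2 : x = z ⟨Finset.univ, hc⟩ := fam_apply (N := N) z ⟨Finset.univ, hc⟩
        have h3 : C (constantCoeff x) = constantCoeff x • (1 : MvPolynomial (Fin (r + 1)) K) := by
          rw [smul_eq_C_mul, mul_one]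
        rw [h3]
        exact congrArg (fun y => y - constantCoeff x • (1 : MvPolynomial (Fin (r + 1)) K)) h2.symm
      have h4 := htop x
      rw [← h1] at h4
      exact h4
  exact ⟨fun p hp => polyModule_low _ hG' hp, inferInstance, Module.finrank_zero_of_subsingleton,
    Module.finite_of_finrank_pos (by rw [hfin]; exact one_pos), hfin⟩

end MulX

end PolyModel
end

noncomputable section
open CategoryTheory

/-! ### Partial fractions with respect to linear coordinates -/

section Laurent

open MvPolynomial

variable {K : Type u} [Field K] {n : ℕ}

/-- The linear coordinates `X i - c i * X k`, for `i ≠ k`, and `X k`. -/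
def lin (k : Fin n) (c : Fin n → K) (i : Fin n) : MvPolynomial (Fin n) K :=
  if i = k then X k else X i - C (c i) * X k

/-- The monomial `T i` of the ring of Laurent polynomials. -/
def laurentT (K : Type u) [Field K] (i : Fin n) : AddMonoidAlgebra K (Fin n → ℤ) :=
  AddMonoidAlgebra.single (Pi.single i 1) 1

/-- The embedding of the polynomial ring into the ring of Laurent polynomials which sends the
linear coordinates to the monomials `T i`. -/
def toLaurent (k : Fin n) (c : Fin n → K) :
    MvPolynomial (Fin n) K →ₐ[K] AddMonoidAlgebra K (Fin n → ℤ) :=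
  aeval fun i => if i = k then laurentT K k else laurentT K i + c i • laurentT K k

variable (k : Fin n) (c : Fin n → K)

lemma toLaurent_lin (i : Fin n) : toLaurent k c (lin k c i) = laurentT K i := by
  rw [lin]
  split_ifs with h
  · rw [h, toLaurent, aeval_X, if_pos rfl]
  · rw [← smul_eq_C_mul, map_sub, map_smul, toLaurent, aeval_X, aeval_X, if_pos rfl, if_neg h,
      add_sub_cancel_right]

lemma coeff_mul_single_group (x : AddMonoidAlgebra K (Fin n → ℤ)) (m e : Fin n → ℤ) (a : K) :
    (x * AddMonoidAlgebra.single m a).coeff e = x.coeff (e - m) * a :=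
  AddMonoidAlgebra.coeff_mul_single_eq_coeff_mul _ fun _ _ => eq_sub_iff_add_eq.symm

lemma coeff_mul_laurentT_eq_zero {x : AddMonoidAlgebra K (Fin n → ℤ)} {i : Fin n}
    (hx : ∀ e : Fin n → ℤ, e i < 0 → x.coeff e = 0) (j : Fin n) (e : Fin n → ℤ) (he : e i < 0) :
    (x * laurentT K j).coeff e = 0 := by
  rw [laurentT, coeff_mul_single_group, hx, zero_mul]
  rw [Pi.sub_apply, Pi.single_apply]
  split_ifs <;> omega

lemma coeff_toLaurent_of_neg {i : Fin n} (f : MvPolynomial (Fin n) K) (e : Fin n → ℤ)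
    (he : e i < 0) : (toLaurent k c f).coeff e = 0 := by
  induction f using MvPolynomial.induction_on generalizing e with
  | C a =>
    rw [toLaurent, aeval_C]
    refine Finsupp.single_eq_of_ne ?_
    rintro rfl
    exact lt_irrefl _ he
  | add p q hp hq =>
    rw [map_add, AddMonoidAlgebra.coeff_add, Finsupp.add_apply, hp e he, hq e he, add_zero]
  | mul_X p j hp =>
    rw [map_mul]
    nth_rewrite 2 [toLaurent]
    rw [aeval_X]
    split_ifs
    · exact coeff_mul_laurentT_eq_zero hp k e he
    · rw [mul_add, mul_smul_comm, AddMonoidAlgebra.coeff_add, Finsupp.add_apply,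
        AddMonoidAlgebra.coeff_smul, Finsupp.smul_apply, coeff_mul_laurentT_eq_zero hp _ e he,
        coeff_mul_laurentT_eq_zero hp _ e he, smul_zero, add_zero]

variable {k c} {A : Finset (Fin n)} {Y : MvPolynomial (Fin n) K}

lemma toLaurent_prod (B : Finset (Fin n)) :
    toLaurent k c (∏ i ∈ B, lin k c i) =
      AddMonoidAlgebra.single (∑ i ∈ B, Pi.single i (1 : ℤ)) 1 := by
  rw [map_prod, Finset.prod_congr rfl fun i _ => toLaurent_lin k c i]
  refine (AddMonoidAlgebra.prod_single B _ _).trans ?_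
  rw [Finset.prod_const_one]

lemma isUnit_single (m : Fin n → ℤ) :
    IsUnit (AddMonoidAlgebra.single m 1 : AddMonoidAlgebra K (Fin n → ℤ)) := by
  refine IsUnit.of_mul_eq_one (AddMonoidAlgebra.single (-m) 1) ?_
  rw [AddMonoidAlgebra.single_mul_single, add_neg_cancel, mul_one]
  rfl

/-- The embedding of a localization into the ring of Laurent polynomials. -/
def awayLaurent (hY : Y = ∏ i ∈ A, lin k c i) :
    Localization.Away Y →ₐ[K] AddMonoidAlgebra K (Fin n → ℤ) :=
  IsLocalization.liftAlgHom (M := Submonoid.powers Y) (f := toLaurent k c) (by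
    rintro ⟨_, N, rfl⟩
    rw [map_pow, hY, toLaurent_prod]
    exact (isUnit_single _).pow N)

lemma awayLaurent_algebraMap (hY : Y = ∏ i ∈ A, lin k c i) (f : MvPolynomial (Fin n) K) :
    awayLaurent hY (algebraMap _ _ f) = toLaurent k c f :=
  IsLocalization.lift_eq _ f

/-- The elements of a localization with a power of `f` as denominator. -/
def fracSub (Y f : MvPolynomial (Fin n) K) : Submodule K (Localization.Away Y) where
  carrier := {z | ∃ (N : ℕ) (r : MvPolynomial (Fin n) K), algebraMap _ _ (f ^ N) * z = algebraMap _ _ r}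
  zero_mem' := ⟨0, 0, by simp⟩
  add_mem' := by
    rintro x y ⟨N, r, h⟩ ⟨N', r', h'⟩
    refine ⟨N + N', f ^ N' * r + f ^ N * r', ?_⟩
    rw [map_add, map_mul, map_mul, ← h, ← h', pow_add, map_mul]
    ring
  smul_mem' := by
    rintro a x ⟨N, r, h⟩
    exact ⟨N, a • r, by
      rw [mul_smul_comm, h]
      exact (map_smul (IsScalarTower.toAlgHom K (MvPolynomial (Fin n) K) (Localization.Away Y)) a r).symm⟩

lemma exists_awayToAway_of_mem_fracSub {Y f : MvPolynomial (Fin n) K} (hd : f ∣ Y)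
    {z : Localization.Away Y} (h : z ∈ fracSub Y f) : ∃ x, awayToAway hd x = z := by
  obtain ⟨N, r, h⟩ := h
  obtain ⟨u, hu⟩ := (isUnit_algebraMap_away f).pow N
  refine ⟨↑u⁻¹ * algebraMap _ _ r, ?_⟩
  have h1 : algebraMap _ (Localization.Away Y) (f ^ N) * awayToAway hd (↑u⁻¹ : Localization.Away f)
      = 1 := by
    have := congrArg (awayToAway hd) (u.mul_inv)
    rwa [hu, map_mul, map_one, ← map_pow, AlgHom.commutes] at this
  rw [map_mul, AlgHom.commutes, ← h, mul_left_comm, ← mul_assoc, h1, one_mul]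

lemma awayToAway_mem_fracSub {Y f : MvPolynomial (Fin n) K} (hd : f ∣ Y) (x : Localization.Away f) :
    awayToAway hd x ∈ fracSub Y f := by
  obtain ⟨N, r, hr⟩ := IsLocalization.Away.surj f x
  refine ⟨N, r, ?_⟩
  have := congrArg (awayToAway hd) hr
  rw [map_mul, ← map_pow, AlgHom.commutes, AlgHom.commutes] at this
  rw [← this, mul_comm]

/-- Clearing a denominator made of coordinates other than the i-th does not change the exponent at
i, and polynomials have no negative exponents. -/
lemma coeff_awayLaurent_of_mem_fracSub (hY : Y = ∏ i ∈ A, lin k c i) {i : Fin n}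
    {z : Localization.Away Y} (hz : z ∈ fracSub Y (∏ j ∈ A.erase i, lin k c j)) (e : Fin n → ℤ)
    (he : e i < 0) : (awayLaurent hY z).coeff e = 0 := by
  obtain ⟨N, r, h⟩ := hz
  have h1 := congrArg (awayLaurent hY) h
  rw [map_mul, awayLaurent_algebraMap, awayLaurent_algebraMap, map_pow, toLaurent_prod,
    AddMonoidAlgebra.single_pow, one_pow, mul_comm] at h1
  have h2 := congrArg (fun x => x.coeff (e + N • ∑ j ∈ A.erase i, Pi.single j (1 : ℤ))) h1
  rw [coeff_mul_single_group, add_sub_cancel_right, mul_one] at h2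
  rw [h2]
  refine coeff_toLaurent_of_neg k c r _ (i := i) ?_
  rw [Pi.add_apply, Pi.smul_apply, Finset.sum_apply, Finset.sum_eq_zero, smul_zero, add_zero]
  · exact he
  · intro j hj
    exact Pi.single_eq_of_ne (Finset.ne_of_mem_erase hj).symm _

end Laurent
end

noncomputable section
open CategoryTheory

/-! ### Fractions as a polynomial model -/

section PartialFractions

open MvPolynomial

variable {K : Type u} [Field K] {n : ℕ} {k : Fin n} {c : Fin n → K} {A : Finset (Fin n)}

/-- The inverse of a linear coordinate. -/
def linInv (k : Fin n) (c : Fin n → K) (Y : MvPolynomial (Fin n) K) (i : Fin n) :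
    Localization.Away Y :=
  -- This is 0 for a coordinate which is not a unit; it is used only for i ∈ A, where the coordinate
  -- divides Y.
  Ring.inverse (algebraMap _ _ (lin k c i))

/-- The factors of the elements `fracMonomial`. -/
def fracFactor (k : Fin n) (c : Fin n → K) (A : Finset (Fin n)) (Y : MvPolynomial (Fin n) K)
    (i : Fin n) (a : ℕ) : Localization.Away Y :=
  -- The a-th derivative of 1 / y: with this scalar, differentiation raises a by one with no further
  -- factor, so it becomes multiplication by a variable.
  if i ∈ A then ((-1) ^ a * a.factorial : K) • linInv k c Y i ^ (a + 1)
  else algebraMap _ _ (lin k c i) ^ a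

/-- The product of `(-1)^a a! / y^(a+1)`, for the coordinates `y` in `A`, and of `y^a` for the
others, where `a` is the exponent of the corresponding variable in a given monomial. -/
def fracMonomial (k : Fin n) (c : Fin n → K) (A : Finset (Fin n)) (Y : MvPolynomial (Fin n) K)
    (s : Fin n →₀ ℕ) : Localization.Away Y :=
  ∏ i, fracFactor k c A Y i (s i)

/-- The linear map which sends monomials to `fracMonomial`. -/
def fracMap (k : Fin n) (c : Fin n → K) (A : Finset (Fin n)) (Y : MvPolynomial (Fin n) K) :
    MvPolynomial (Fin n) K →ₗ[K] Localization.Away Y :=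
  (basisMonomials (Fin n) K).constr K (fracMonomial k c A Y)

variable {Y : MvPolynomial (Fin n) K}

lemma fracMap_monomial (s : Fin n →₀ ℕ) (a : K) :
    fracMap k c A Y (monomial s a) = a • fracMonomial k c A Y s := by
  have : monomial s a = a • (basisMonomials (Fin n) K s) := by
    rw [coe_basisMonomials, smul_monomial, smul_eq_mul, mul_one]
  rw [this, map_smul, fracMap, Module.Basis.constr_basis]

lemma linInv_mul (hY : Y = ∏ i ∈ A, lin k c i) {i : Fin n} (hi : i ∈ A) :
    linInv k c Y i * algebraMap _ _ (lin k c i) = 1 :=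
  Ring.inverse_mul_cancel _ (IsLocalization.Away.isUnit_of_dvd Y
    (hY ▸ Finset.dvd_prod_of_mem (lin k c) hi))

lemma fracMonomial_eq_mul {s s' : Fin n →₀ ℕ} {j : Fin n} (h : ∀ i ≠ j, s' i = s i) :
    fracMonomial k c A Y s' =
      (∏ i ∈ Finset.univ.erase j, fracFactor k c A Y i (s i)) * fracFactor k c A Y j (s' j) := by
  rw [fracMonomial, ← Finset.prod_erase_mul _ _ (Finset.mem_univ j)]
  congr 1
  exact Finset.prod_congr rfl fun i hi => by rw [h i (Finset.ne_of_mem_erase hi)]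

/-! #### Independence -/

/-- The exponents of the Laurent monomial of `fracMonomial`. -/
def fracExp (A : Finset (Fin n)) (s : Fin n →₀ ℕ) (i : Fin n) : ℤ :=
  if i ∈ A then -(s i + 1) else s i

lemma fracExp_injective : Function.Injective (fracExp A) := by
  intro s s' h
  ext i
  have := congrFun h i
  rw [fracExp, fracExp] at this
  split_ifs at this <;> omega

lemma awayLaurent_fracFactor (hY : Y = ∏ i ∈ A, lin k c i) (i : Fin n) (s : Fin n →₀ ℕ) :
    awayLaurent hY (fracFactor k c A Y i (s i)) = AddMonoidAlgebra.single
      (Pi.single i (fracExp A s i)) (if i ∈ A then (-1) ^ s i * ((s i).factorial : K) else 1) := by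
  rw [fracFactor, fracExp]
  split_ifs with h
  · have h1 := congrArg (awayLaurent hY) (linInv_mul hY h)
    rw [map_mul, awayLaurent_algebraMap, toLaurent_lin, map_one] at h1
    have h2 : awayLaurent hY (linInv k c Y i) =
        AddMonoidAlgebra.single (Pi.single i (-1 : ℤ)) 1 := by
      have h3 := congrArg (· * AddMonoidAlgebra.single (Pi.single i (-1 : ℤ)) (1 : K)) h1
      rw [mul_assoc, laurentT, AddMonoidAlgebra.single_mul_single, one_mul, one_mul,
        ← Pi.single_add, add_neg_cancel, Pi.single_zero] at h3
      exact (mul_one _).symm.trans h3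
    rw [map_smul, map_pow, h2, AddMonoidAlgebra.single_pow, one_pow,
      AddMonoidAlgebra.smul_single, smul_eq_mul, mul_one, ← Pi.single_smul]
    congr 2
    simp
  · rw [map_pow, awayLaurent_algebraMap, toLaurent_lin, laurentT, AddMonoidAlgebra.single_pow,
      one_pow, ← Pi.single_smul]
    congr 2
    simp

/-- The coefficient of the Laurent monomial of `fracMonomial`. -/
def fracCoeff (K : Type u) [Field K] (A : Finset (Fin n)) (s : Fin n →₀ ℕ) : K :=
  ∏ i, if i ∈ A then (-1) ^ s i * (s i).factorial else 1

lemma fracCoeff_ne_zero [CharZero K] (s : Fin n →₀ ℕ) : fracCoeff K A s ≠ 0 := by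
  refine Finset.prod_ne_zero_iff.2 fun i _ => ?_
  split_ifs
  · exact mul_ne_zero (pow_ne_zero _ (neg_ne_zero.2 one_ne_zero))
      (Nat.cast_ne_zero.2 (Nat.factorial_ne_zero _))
  · exact one_ne_zero

lemma awayLaurent_fracMonomial (hY : Y = ∏ i ∈ A, lin k c i) (s : Fin n →₀ ℕ) :
    awayLaurent hY (fracMonomial k c A Y s) =
      AddMonoidAlgebra.single (fracExp A s) (fracCoeff K A s) := by
  rw [fracMonomial, map_prod, Finset.prod_congr rfl fun i _ => awayLaurent_fracFactor hY i s,
    AddMonoidAlgebra.prod_single, Finset.univ_sum_single]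
  rfl

lemma coeff_awayLaurent_fracMap (hY : Y = ∏ i ∈ A, lin k c i) (f : MvPolynomial (Fin n) K)
    (s : Fin n →₀ ℕ) :
    (awayLaurent hY (fracMap k c A Y f)).coeff (fracExp A s) = coeff s f * fracCoeff K A s := by
  classical
  induction f using MvPolynomial.induction_on' with
  | monomial t a =>
    rw [fracMap_monomial, map_smul, awayLaurent_fracMonomial, AddMonoidAlgebra.coeff_smul,
      Finsupp.smul_apply, AddMonoidAlgebra.coeff_single, Finsupp.single_apply, coeff_monomial]
    by_cases h : t = s
    · rw [if_pos h, if_pos (congrArg _ h), h, smul_eq_mul]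
    · rw [if_neg h, if_neg (fracExp_injective.ne h), smul_zero, zero_mul]
  | add p q hp hq =>
    rw [map_add, map_add, AddMonoidAlgebra.coeff_add, Finsupp.add_apply, hp, hq, coeff_add, add_mul]

/-- The elements of a localization in which one of the coordinates is not a denominator. -/
def fracSup (k : Fin n) (c : Fin n → K) (A : Finset (Fin n)) (Y : MvPolynomial (Fin n) K) :
    Submodule K (Localization.Away Y) :=
  ⨆ i ∈ A, fracSub Y (∏ j ∈ A.erase i, lin k c j)

/-- All exponents at A in a `fracMonomial` are negative, while an element of `fracSup` has no such
Laurent monomial. Distinct monomials have distinct exponents, and their coefficients are nonzero in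
characteristic zero. -/
theorem eq_zero_of_fracMap_mem [CharZero K] (hY : Y = ∏ i ∈ A, lin k c i)
    {f : MvPolynomial (Fin n) K} (hf : fracMap k c A Y f ∈ fracSup k c A Y) : f = 0 := by
  let N : Submodule K (Localization.Away Y) :=
    { carrier := {z | ∀ e : Fin n → ℤ, (∀ i ∈ A, e i < 0) → (awayLaurent hY z).coeff e = 0}
      zero_mem' := fun e _ => by rw [map_zero]; rfl
      add_mem' := fun hx hy e he => by
        rw [map_add, AddMonoidAlgebra.coeff_add, Finsupp.add_apply, hx e he, hy e he, add_zero]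
      smul_mem' := fun a x hx e he => by
        rw [map_smul, AddMonoidAlgebra.coeff_smul, Finsupp.smul_apply, hx e he, smul_zero] }
  have hN : fracSup k c A Y ≤ N := iSup₂_le fun i hi z hz e he =>
    coeff_awayLaurent_of_mem_fracSub hY hz e (he i hi)
  ext s
  have := hN hf (fracExp A s) fun i hi => by
    rw [fracExp, if_pos hi]
    omega
  rw [coeff_awayLaurent_fracMap] at this
  exact (mul_eq_zero.1 this).resolve_right (fracCoeff_ne_zero s)

/-! #### Generation -/

lemma aeval_lin_surjective (k : Fin n) (c : Fin n → K) :
    Function.Surjective (aeval (lin k c) : MvPolynomial (Fin n) K →ₐ[K] MvPolynomial (Fin n) K) := by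
  rw [← AlgHom.range_eq_top, eq_top_iff, ← adjoin_range_X, Algebra.adjoin_le_iff]
  have h : ∀ i, lin k c i ∈ (aeval (lin k c) :
      MvPolynomial (Fin n) K →ₐ[K] MvPolynomial (Fin n) K).range := fun i => ⟨X i, aeval_X _ _⟩
  have hk : X k ∈ (aeval (lin k c) : MvPolynomial (Fin n) K →ₐ[K] MvPolynomial (Fin n) K).range := by
    have := h k
    rwa [lin, if_pos rfl] at this
  rintro _ ⟨i, rfl⟩
  by_cases hi : i = k
  · rw [hi]
    exact hk
  · have := h i
    rw [lin, if_neg hi, ← smul_eq_C_mul] at this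
    have h2 := add_mem this (Subalgebra.smul_mem _ hk (c i))
    rwa [sub_add_cancel] at h2

lemma linInv_pow_mul (hY : Y = ∏ i ∈ A, lin k c i) {i : Fin n} (hi : i ∈ A) {a N : ℕ} (h : a ≤ N) :
    linInv k c Y i ^ N * algebraMap _ _ (lin k c i) ^ a = linInv k c Y i ^ (N - a) := by
  obtain ⟨b, rfl⟩ := Nat.exists_eq_add_of_le h
  rw [Nat.add_sub_cancel_left, pow_add, mul_right_comm, ← mul_pow, linInv_mul hY hi, one_pow,
    one_mul]

/-- Products of powers of coordinates with a common denominator. -/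
lemma exists_sub_fracMap_mem_monomial [CharZero K] (hY : Y = ∏ i ∈ A, lin k c i) (N : ℕ) (s : Fin n →₀ ℕ) :
    ∃ f, (∏ i ∈ A, linInv k c Y i) ^ N * algebraMap _ _ (∏ i, lin k c i ^ s i) -
      fracMap k c A Y f ∈ fracSup k c A Y := by
  -- If some numerator exponent reaches N, that coordinate disappears from the denominator and the
  -- fraction lies in `fracSup`. Otherwise it is a multiple of a single `fracMonomial`.
  by_cases h : ∃ i ∈ A, N ≤ s i
  · obtain ⟨i, hi, hs⟩ := h
    refine ⟨0, ?_⟩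
    rw [map_zero, sub_zero]
    refine Submodule.mem_iSup_of_mem i (Submodule.mem_iSup_of_mem hi ?_)
    refine ⟨N, (∏ j ∈ Finset.univ.erase i, lin k c j ^ s j) * lin k c i ^ (s i - N), ?_⟩
    rw [map_pow, map_prod, ← mul_assoc, ← mul_pow, ← Finset.prod_erase_mul A _ hi, ← mul_assoc,
      ← Finset.prod_mul_distrib, Finset.prod_congr rfl fun j hj => by
        rw [mul_comm, linInv_mul hY (Finset.mem_of_mem_erase hj)], Finset.prod_const_one, one_mul,
      ← Finset.prod_erase_mul _ _ (Finset.mem_univ i), map_mul, map_mul, map_pow, map_pow]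
    conv_lhs => rw [← Nat.add_sub_cancel' hs]
    rw [pow_add, mul_left_comm, ← mul_assoc (_ ^ N) (_ ^ N), ← mul_pow, linInv_mul hY hi, one_pow,
      one_mul]
  · push Not at h
    -- The fraction has y^(s i - N) and the basis element y^(-(t i + 1)), whence t i = N - 1 - s i.
    let t : Fin n →₀ ℕ := Finsupp.equivFunOnFinite.symm fun i =>
      if i ∈ A then N - 1 - s i else s i
    refine ⟨monomial t (fracCoeff K A t)⁻¹, ?_⟩
    convert Submodule.zero_mem _
    rw [sub_eq_zero, fracMap_monomial, eq_comm, inv_smul_eq_iff₀ (fracCoeff_ne_zero t), fracCoeff,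
      fracMonomial, map_prod]
    have e1 : (∏ i ∈ A, linInv k c Y i) ^ N = ∏ i, if i ∈ A then linInv k c Y i ^ N else 1 := by
      rw [← Finset.prod_pow, Finset.prod_ite_mem, Finset.univ_inter]
    rw [e1, ← Finset.prod_mul_distrib, ← Finset.prod_smul]
    refine Finset.prod_congr rfl fun i _ => ?_
    rw [fracFactor]
    have ht : t i = if i ∈ A then N - 1 - s i else s i := rfl
    rw [ht]
    split_ifs with hi
    · have := h i hi
      rw [map_pow, linInv_pow_mul hY hi this.le]
      congr 2
      omega
    · rw [one_smul, one_mul, map_pow]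

/-- A fraction r / Y^N becomes a combination of the monomial fractions above once r is rewritten as
a polynomial in the linear coordinates. -/
theorem exists_sub_fracMap_mem [CharZero K] (hY : Y = ∏ i ∈ A, lin k c i) (x : Localization.Away Y) :
    ∃ f, x - fracMap k c A Y f ∈ fracSup k c A Y := by
  obtain ⟨N, r, hr⟩ := IsLocalization.Away.surj Y x
  have hx : x = (∏ i ∈ A, linInv k c Y i) ^ N * algebraMap _ _ r := by
    rw [← hr, ← mul_assoc, mul_right_comm, ← mul_pow]
    have h1 : algebraMap _ (Localization.Away Y) Y = ∏ i ∈ A, algebraMap _ _ (lin k c i) := by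
      rw [← map_prod]
      exact congrArg _ hY
    rw [h1, ← Finset.prod_mul_distrib, Finset.prod_congr rfl fun j hj => linInv_mul hY hj,
      Finset.prod_const_one, one_pow, one_mul]
  obtain ⟨g, rfl⟩ := aeval_lin_surjective k c r
  clear hr
  rw [hx]
  clear hx
  induction g using MvPolynomial.induction_on' with
  | monomial s a =>
    obtain ⟨f, hf⟩ := exists_sub_fracMap_mem_monomial (k := k) (c := c) hY N s
    refine ⟨a • f, ?_⟩
    have h1 : aeval (lin k c) (monomial s a) = a • ∏ i, lin k c i ^ s i := by
      rw [aeval_monomial, Finsupp.prod_fintype _ _ (fun i => pow_zero _), Algebra.smul_def]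
    have h2 := map_smul (IsScalarTower.toAlgHom K (MvPolynomial (Fin n) K) (Localization.Away Y)) a
      (∏ i, lin k c i ^ s i)
    simp only [IsScalarTower.coe_toAlgHom'] at h2
    rw [h1, h2, map_smul, mul_smul_comm, ← smul_sub]
    exact Submodule.smul_mem _ _ hf
  | add p q hp hq =>
    obtain ⟨f, hf⟩ := hp
    obtain ⟨f', hf'⟩ := hq
    refine ⟨f + f', ?_⟩
    rw [map_add, map_add, map_add, mul_add, add_sub_add_comm]
    exact Submodule.add_mem _ hf hf'

/-! #### Operators -/

lemma leibniz_prod {S : Type*} [CommRing S] [Algebra K S] (D : Derivation K S S) {ι : Type*}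
    [DecidableEq ι] (s : Finset ι) (f : ι → S) :
    D (∏ i ∈ s, f i) = ∑ i ∈ s, (∏ j ∈ s.erase i, f j) * D (f i) := by
  induction s using Finset.induction_on with
  | empty => simp
  | insert i s hi ih =>
    rw [Finset.prod_insert hi, Derivation.leibniz, ih, Finset.sum_insert hi, Finset.erase_insert hi,
      smul_eq_mul, smul_eq_mul, Finset.mul_sum, add_comm]
    congr 1
    refine Finset.sum_congr rfl fun j hj => ?_
    have hij : i ≠ j := fun h => hi (h ▸ hj)
    rw [Finset.erase_insert_of_ne hij, Finset.prod_insert fun h => hi (Finset.mem_of_mem_erase h),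
      mul_assoc]

/-- The operator corresponding to the derivative with respect to a coordinate. -/
def fracOp (A : Finset (Fin n)) (i : Fin n) : MvPolynomial (Fin n) K →ₗ[K] MvPolynomial (Fin n) K :=
  if i ∈ A then LinearMap.mulLeft K (X i) else (pderiv i).toLinearMap

lemma der_fracFactor (hY : Y = ∏ i ∈ A, lin k c i)
    (D : Derivation K (Localization.Away Y) (Localization.Away Y)) {i : Fin n} {d : K}
    (hD : D (algebraMap _ _ (lin k c i)) = d • 1) (a : ℕ) :
    D (fracFactor k c A Y i a) = d • if i ∈ A then fracFactor k c A Y i (a + 1)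
      else (a : K) • fracFactor k c A Y i (a - 1) := by
  by_cases hi : i ∈ A
  · simp only [fracFactor, if_pos hi]
    rw [Derivation.map_smul, Derivation.leibniz_pow,
      Derivation.leibniz_of_mul_eq_one D (linInv_mul hY hi), hD, Nat.add_sub_cancel]
    simp only [smul_eq_mul, nsmul_eq_mul, mul_smul_comm, mul_one, smul_neg, mul_neg, smul_smul,
      Nat.factorial_succ, pow_succ, Nat.cast_mul, Nat.cast_add, Nat.cast_one]
    have h : ((a : Localization.Away Y) + 1) = ((a : K) + 1) • (1 : Localization.Away Y) := by
      rw [Algebra.smul_def, mul_one, map_add, map_natCast, map_one]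
    rw [h, smul_mul_assoc, one_mul, smul_smul, ← neg_smul]
    congr 1
    · ring
    · ring
  · simp only [fracFactor, if_neg hi]
    rw [Derivation.leibniz_pow, hD]
    simp only [smul_eq_mul, mul_smul_comm, mul_one]
    rw [← Nat.cast_smul_eq_nsmul K, smul_comm]

lemma fracMap_fracOp_monomial (s : Fin n →₀ ℕ) (j : Fin n) :
    (∏ i ∈ Finset.univ.erase j, fracFactor k c A Y i (s i)) * (if j ∈ A then
      fracFactor k c A Y j (s j + 1) else (s j : K) • fracFactor k c A Y j (s j - 1)) =
      fracMap k c A Y (fracOp A j (monomial s 1)) := by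
  rw [fracOp]
  split_ifs
  · have h1 : LinearMap.mulLeft K (X j) (monomial s (1 : K)) =
        monomial (s + Finsupp.single j 1) 1 := by
      rw [LinearMap.mulLeft_apply, mul_comm, X, monomial_mul, mul_one]
    rw [h1, fracMap_monomial, one_smul, fracMonomial_eq_mul (s := s) (j := j) fun i hi => by
      rw [Finsupp.add_apply, Finsupp.single_eq_of_ne hi, add_zero]]
    simp
  · have h1 : (pderiv j).toLinearMap (monomial s (1 : K)) =
        monomial (s - Finsupp.single j 1) (s j : K) := by
      refine (pderiv_monomial).trans ?_
      rw [one_mul]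
    rw [h1, fracMap_monomial, fracMonomial_eq_mul (s := s) (j := j) fun i hi => by
      rw [Finsupp.tsub_apply, Finsupp.single_eq_of_ne hi, tsub_zero], mul_smul_comm]
    simp

/-- The Fourier transform: D acts as the sum of d_i ∂/∂y_i, where d_i is its constant value on y_i,
and ∂/∂y_i corresponds to X_i for i ∈ A and to ∂_i otherwise. -/
theorem der_fracMap (hY : Y = ∏ i ∈ A, lin k c i)
    (D : Derivation K (Localization.Away Y) (Localization.Away Y)) (d : Fin n → K)
    (hD : ∀ i, D (algebraMap _ _ (lin k c i)) = d i • 1) (f : MvPolynomial (Fin n) K) :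
    D (fracMap k c A Y f) = fracMap k c A Y (∑ i, d i • fracOp A i f) := by
  have : D.toLinearMap ∘ₗ fracMap k c A Y = fracMap k c A Y ∘ₗ ∑ i, d i • fracOp A i := by
    refine (basisMonomials (Fin n) K).ext fun s => ?_
    rw [coe_basisMonomials]
    simp only [LinearMap.comp_apply, LinearMap.sum_apply, LinearMap.smul_apply, map_sum, map_smul]
    change D (fracMap k c A Y (monomial s 1)) = _
    rw [fracMap_monomial, one_smul, fracMonomial, leibniz_prod]
    refine Finset.sum_congr rfl fun j _ => ?_
    rw [der_fracFactor hY D (hD j), mul_smul_comm, fracMap_fracOp_monomial]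
  have := LinearMap.congr_fun this f
  simpa [LinearMap.sum_apply] using this

/-- A coordinate outside A acts on the model as a variable, hence as a nonzerodivisor; this drives
the regular sequence argument for the vanishing below top degree. -/
lemma lin_mul_fracMap {j : Fin n} (hj : j ∉ A) (f : MvPolynomial (Fin n) K) :
    algebraMap _ _ (lin k c j) * fracMap k c A Y f = fracMap k c A Y (X j * f) := by
  have : LinearMap.mulLeft K (algebraMap _ _ (lin k c j)) ∘ₗ fracMap k c A Y =
      fracMap k c A Y ∘ₗ LinearMap.mulLeft K (X j) := by
    refine (basisMonomials (Fin n) K).ext fun s => ?_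
    rw [coe_basisMonomials]
    simp only [LinearMap.comp_apply]
    have h1 : LinearMap.mulLeft K (X j) (monomial s (1 : K)) =
        monomial (s + Finsupp.single j 1) 1 := by
      rw [LinearMap.mulLeft_apply, mul_comm, X, monomial_mul, mul_one]
    rw [h1, fracMap_monomial, fracMap_monomial, one_smul, one_smul, LinearMap.mulLeft_apply,
      fracMonomial_eq_mul (s := s) (s' := s) (j := j) fun _ _ => rfl,
      fracMonomial_eq_mul (s := s) (j := j) fun i hi => by
      rw [Finsupp.add_apply, Finsupp.single_eq_of_ne hi, add_zero], mul_left_comm]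
    congr 1
    rw [fracFactor, fracFactor, if_neg hj, if_neg hj, Finsupp.add_apply, Finsupp.single_eq_same,
      pow_succ, mul_comm]
  exact LinearMap.congr_fun this f

end PartialFractions
end

noncomputable section
open CategoryTheory

namespace ModuleCube

/-! ### Cohomology in the top degree -/

section Top

variable {K : Type u} [Field K] {ι : Type} [LinearOrder ι] {C : ModuleCube K ι}

/-- An element over the largest subset as a cochain. -/
def topTerm (C : ModuleCube K ι) (U : Finset ι) : C.M U →ₗ[K] (C.res ∅ U).Term U.card :=
  LinearMap.pi fun S => resLift (LinearMap.proj (R := K) (φ := fun S => C.M S) S.1 ∘ₗ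
    LinearMap.single K (fun S => C.M S) U) fun x h => by
      exact Pi.single_eq_of_ne (fun hS => h ⟨Finset.empty_subset _, hS.le⟩) x

lemma resVal_topTerm (U : Finset ι) (x : C.M U) (S : {S : Finset ι // S.card = U.card}) :
    resVal (topTerm C U x S) = (Pi.single U x : ∀ S, C.M S) S.1 := rfl

lemma mem_Z_of_card {U : Finset ι} (z : (C.res ∅ U).Term U.card) : z ∈ (C.res ∅ U).Z U.card :=
  LinearMap.mem_ker.2 (funext fun T => res_eq_zero (fun h => by
    have := Finset.card_le_card h.2
    have := T.2
    omega) _)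

/-- The class of an element over the largest subset. -/
def topCls (C : ModuleCube K ι) (U : Finset ι) : C.M U →ₗ[K] (C.res ∅ U).H U.card :=
  (C.res ∅ U).cls U.card ∘ₗ LinearMap.codRestrict _ (topTerm C U) fun _ => mem_Z_of_card _

lemma topTerm_eq {U : Finset ι} (z : (C.res ∅ U).Term U.card) :
    topTerm C U (resVal (z ⟨U, rfl⟩)) = z := by
  funext ⟨S, hS⟩
  by_cases h : S ⊆ U
  · obtain rfl := Finset.eq_of_subset_of_card_le h hS.ge
    exact resVal_injective ((resVal_topTerm _ _ _).trans (Pi.single_eq_same _ _))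
  · exact (res_eq_zero (fun h' => h h'.2) _).trans (res_eq_zero (fun h' => h h'.2) _).symm

lemma topCls_surjective (U : Finset ι) : Function.Surjective (topCls C U) := by
  intro x
  obtain ⟨⟨z, hz⟩, rfl⟩ := (C.res ∅ U).cls_surjective _ x
  refine ⟨resVal (z ⟨U, rfl⟩), ?_⟩
  exact congrArg ((C.res ∅ U).cls U.card) (Subtype.ext (topTerm_eq z))

lemma cls_card_eq {U : Finset ι} (z : (C.res ∅ U).Z U.card) :
    (C.res ∅ U).cls U.card z = topCls C U (resVal (z.1 ⟨U, rfl⟩)) :=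
  congrArg _ (Subtype.ext (topTerm_eq z.1).symm)

/-- The top cohomology is a cokernel. The family g may be arbitrary, because d g at U only involves
the subsets of U with one element removed. -/
lemma topCls_eq_zero_iff {U : Finset ι} (x : C.M U) :
    topCls C U x = 0 ↔ ∃ g : ∀ S, C.M S, C.d g U = x := by
  refine (cls_eq_zero_iff _ _ _).trans ?_
  change topTerm C U x ∈ _ ↔ _
  have key : ∀ q (hq : U.card = q) (w : (C.res ∅ U).Term q),
      w ∈ (C.res ∅ U).bd q ↔ ∃ g : ∀ S, C.M S, C.d g U = resVal (w ⟨U, hq⟩) := by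
    intro q hq w
    cases q with
    | zero =>
      obtain rfl := Finset.card_eq_zero.1 hq
      have h0 : ∀ g : ∀ S, C.M S, C.d g ∅ = 0 := fun g => d_eq_zero g (by simp)
      simp only [h0]
      constructor
      · intro h
        exact ⟨0, by rw [(Submodule.mem_bot K).1 h, Pi.zero_apply, map_zero]⟩
      · rintro ⟨-, h⟩
        refine (Submodule.mem_bot K).2 (funext fun S => ?_)
        obtain ⟨S, hS⟩ := S
        obtain rfl := Finset.card_eq_zero.1 hS
        exact resVal_injective (h.symm.trans (map_zero _).symm)
    | succ q =>
      constructor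
      · rintro ⟨y, rfl⟩
        refine ⟨fun S => resVal ((C.res ∅ U).extend y S), ?_⟩
        rw [← resVal_d _ _ subset_rfl, d_extend rfl y ⟨U, hq⟩]
      · rintro ⟨g, hg⟩
        let g' : ∀ S, (C.res ∅ U).M S := fun S => if h : S ⊆ U then
          resMk (g S) (fun h' => absurd ⟨Finset.empty_subset _, h⟩ h') else 0
        refine ⟨fun S => g' S.1, funext fun T => ?_⟩
        rw [d_restrict rfl g' T]
        obtain ⟨T, hT⟩ := T
        by_cases h : T ⊆ U
        · obtain rfl := Finset.eq_of_subset_of_card_le h (by rw [hT, hq])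
          refine resVal_injective ?_
          rw [resVal_d _ _ subset_rfl, ← hg]
          rw [d, d]
          refine Finset.sum_congr rfl fun i _ => ?_
          have : resVal (g' (T.erase i.1)) = g (T.erase i.1) := by
            simp only [g']
            rw [dif_pos (Finset.erase_subset _ _), resVal_mk]
          rw [this]
        · exact (res_eq_zero (fun h' => h h'.2) _).trans (res_eq_zero (fun h' => h h'.2) _).symm
  refine (key U.card rfl _).trans (exists_congr fun g => ?_)
  rw [resVal_topTerm, Pi.single_eq_same]

lemma resMap_H_topCls (α : Hom C C) (U : Finset ι) (x : C.M U) :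
    (resMap α ∅ U).H U.card (topCls C U x) = topCls C U (α.app U x) := by
  refine Hom.H_cls _ _ _ _ fun S => resVal_injective ?_
  change resVal (topTerm C U (α.app U x) S) = α.app S.1 (resVal (topTerm C U x S))
  rw [resVal_topTerm, resVal_topTerm]
  obtain ⟨S, hS⟩ := S
  by_cases h : S = U
  · subst h
    rw [Pi.single_eq_same, Pi.single_eq_same]
  · rw [Pi.single_eq_of_ne h, Pi.single_eq_of_ne h, map_zero]

lemma subsingleton_res_H_of_card_lt (B U : Finset ι) {p : ℕ} (hp : U.card < p) :
    Subsingleton ((C.res B U).H p) := by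
  rw [subsingleton_H_iff]
  intro z _
  have : z = 0 := funext fun S => res_eq_zero (fun h => by
    have := Finset.card_le_card h.2
    have := S.2
    omega) _
  rw [this]
  exact Submodule.zero_mem _

lemma subsingleton_res_H_of_lt_card (B U : Finset ι) {p : ℕ} (hp : p < B.card) :
    Subsingleton ((C.res B U).H p) := by
  rw [subsingleton_H_iff]
  intro z _
  have : z = 0 := funext fun S => res_eq_zero (fun h => by
    have := Finset.card_le_card h.1
    have := S.2
    omega) _
  rw [this]
  exact Submodule.zero_mem _

end Top

/-! ### Adjoining a nonzerodivisor to the family -/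

section Regular

variable {K : Type u} [Field K] {R : Type*} [CommRing R] {ι : Type} [LinearOrder ι] {C : ModuleCube K ι}
  [∀ S, Module R (C.M S)] {t : ι → R}

/-- A top class which lifts after adding an index `k` is annihilated by a power of `t k`. -/
lemma IsCech.exists_pow_smul_eq_d_of_d_insert (hC : IsCech C t) {U : Finset ι} {k : ι} (hk : k ∉ U) (f : ∀ S, C.M S)
    (hf : C.d f (insert k U) = 0) : ∃ (N : ℕ) (g : ∀ S, C.M S), C.d g U = t k ^ N • f U := by
  obtain ⟨N, y, hy⟩ := hC.exists_uniform_lift U k f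
  let g : ∀ S, C.M S := fun S => sgn S k • y S
  have h1 := hC.φ_d_eq hk f g (t k ^ N) fun {S T'} h hS => by
    rw [map_zsmul, hy h hS]
  rw [hf, smul_zero, smul_zero, sub_zero, ← hC.φ_smul, ← sub_eq_zero, ← map_sub] at h1
  obtain ⟨M, hM⟩ := hC.exists_kill k rfl _ h1
  refine ⟨M + N, fun S => t k ^ M • g S, ?_⟩
  rw [hC.d_smul, pow_add, mul_smul, ← sub_eq_zero, ← smul_sub]
  exact hM

/-- Adjoining a nonzerodivisor on the top cohomology preserves the vanishing below the top. -/
theorem IsCech.subsingleton_res_insert_H_card (hC : IsCech C t) {U : Finset ι} {k : ι} (hk : k ∉ U)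
    (hU : ∀ p < U.card, Subsingleton ((C.res ∅ U).H p))
    (hreg : ∀ x : C.M U, (∃ g : ∀ S, C.M S, C.d g U = t k • x) → ∃ g : ∀ S, C.M S, C.d g U = x)
    {p : ℕ} (hp : p < (insert k U).card) : Subsingleton ((C.res ∅ (insert k U)).H p) := by
  rw [Finset.card_insert_of_notMem hk] at hp
  -- The part with k is the localization at t k of the cohomology for U, one degree higher; since p
  -- ≤ |U|, it vanishes in degree p.
  have h1 : Subsingleton ((C.res (insert k ∅) (insert k U)).H p) := by
    cases p with
    | zero => exact subsingleton_res_H_of_lt_card _ _ (by simp)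
    | succ p =>
      exact hC.subsingleton_res_insert_H ∅ U hk (Finset.notMem_empty k) p (hU p (by omega))
  let s := resSES C ∅ U k hk
  -- The projection to the cohomology for U is zero. Only degree |U| is at issue: a class in the
  -- image is killed by a power of t k, and t k is a nonzerodivisor there.
  have h2 : ∀ x : (C.res ∅ (insert k U)).H p, s.g.H p x = 0 := by
    intro x
    by_cases hpU : p = U.card
    · subst hpU
      obtain ⟨z, rfl⟩ := (C.res ∅ (insert k U)).cls_surjective _ x
      rw [Hom.H_cls s.g U.card z ⟨_, s.g.mem_Z _ z.2⟩ fun _ => rfl, cls_card_eq, topCls_eq_zero_iff]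
      let f : ∀ S, C.M S := fun S => resVal ((C.res ∅ (insert k U)).extend z.1 S)
      have hf : C.d f (insert k U) = 0 := by
        rw [← resVal_d _ _ subset_rfl, d_extend rfl z.1 ⟨insert k U, Finset.card_insert_of_notMem hk⟩,
          LinearMap.mem_ker.1 z.2, Pi.zero_apply, map_zero]
      have hfU : f U = resVal (z.1 ⟨U, rfl⟩) :=
        congrArg resVal (extend_apply z.1 ⟨U, rfl⟩)
      have hval : resVal (s.g.app U (z.1 ⟨U, rfl⟩)) = f U := by
        refine (resVal_resProj ∅ (Finset.subset_insert k U) _ _).trans ?_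
        rw [if_pos subset_rfl, hfU]
      obtain ⟨N, hN⟩ := hC.exists_pow_smul_eq_d_of_d_insert hk f hf
      have hfinal : ∃ g : ∀ S, C.M S, C.d g U = f U := by
        induction N with
        | zero => simpa using hN
        | succ N ih =>
          refine ih (hreg _ ?_)
          rwa [smul_smul, ← pow_succ']
      rw [← hval] at hfinal
      exact hfinal
    · have := hU p (by omega)
      exact Subsingleton.elim _ _
  refine subsingleton_of_forall_eq 0 fun x => ?_
  obtain ⟨y, rfl⟩ := (s.exact₂ p x).1 (h2 x)
  rw [Subsingleton.elim y 0, map_zero]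

end Regular

end ModuleCube
end

noncomputable section
open CategoryTheory

/-! ### Čech cohomology of linear coordinates with the partial derivatives -/

section CechModel

open ModuleCube OpModule MvPolynomial

variable {K : Type u} [Field K] {n : ℕ} {ι : Type} [LinearOrder ι]

/-- The cohomology of a subquotient of the Čech cube, with the partial derivatives. -/
abbrev resOp (t : ι → MvPolynomial (Fin n) K) (B U : Finset ι) (p : ℕ) : OpModule K n where
  carrier := ((awayCube K t).res B U).H p
  D i := (resMap (awayDer t (pderiv i)) B U).H p
  comm i l x := Hom.H_comm (fun _ y => resVal_injective
    (locDerivation_comm _ _ _ (pderiv_comm i l) (resVal y))) p x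

variable {k : Fin n} {c : Fin n → K} {t : ι → MvPolynomial (Fin n) K} {j : Fin n ↪ ι}

omit [LinearOrder ι] in
lemma prod_map_lin (hj : ∀ i, t (j i) = lin k c i) (A : Finset (Fin n)) :
    ∏ s ∈ A.map j, t s = ∏ i ∈ A, lin k c i := by
  rw [Finset.prod_map]
  exact Finset.prod_congr rfl fun i _ => hj i

/-- Top coboundaries are exactly the sums of fractions in which one of the coordinates is not
inverted. This turns the two partial fraction theorems into a description of the top cohomology. -/
lemma ker_topCls (hj : ∀ i, t (j i) = lin k c i) (A : Finset (Fin n)) :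
    LinearMap.ker (topCls (awayCube K t) (A.map j)) = fracSup k c A (∏ s ∈ A.map j, t s) := by
  have hA : ∀ i, ∏ s ∈ (A.map j).erase (j i), t s = ∏ l ∈ A.erase i, lin k c l := fun i => by
    rw [← prod_map_lin hj, Finset.map_erase]
  apply le_antisymm
  · intro x hx
    obtain ⟨g, rfl⟩ := (topCls_eq_zero_iff x).1 hx
    refine (fracSup k c A (∏ s ∈ A.map j, t s)).sum_mem fun s _ =>
      (fracSup k c A (∏ s ∈ A.map j, t s)).toAddSubgroup.zsmul_mem ?_ _
    obtain ⟨i, hi, hs⟩ := Finset.mem_map.1 s.2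
    refine Submodule.mem_iSup_of_mem i (Submodule.mem_iSup_of_mem hi ?_)
    rw [← hA, hs]
    exact awayToAway_mem_fracSub (prod_dvd_of_insert t (Finset.insert_erase s.2)) _
  · refine iSup₂_le fun i hi x hx => ?_
    have hji : j i ∈ A.map j := Finset.mem_map_of_mem j hi
    rw [← hA] at hx
    obtain ⟨y, hy⟩ := exists_awayToAway_of_mem_fracSub
      (prod_dvd_of_insert t (Finset.insert_erase hji)) hx
    refine (topCls_eq_zero_iff x).2 ⟨Pi.single ((A.map j).erase (j i))
      (sgn (A.map j) (j i) • (show (awayCube K t).M _ from y)), ?_⟩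
    rw [d_eq_single _ hji, Pi.single_eq_same, map_zsmul, smul_smul, sgn_mul_self, one_smul]
    · exact hy
    · intro s hs hne
      refine Pi.single_eq_of_ne (fun h => hne ?_) _
      by_contra h'
      have : s ∈ (A.map j).erase (j i) := Finset.mem_erase.2 ⟨h', hs⟩
      rw [← h] at this
      exact Finset.notMem_erase s _ this

/-- The model of the top cohomology. -/
def fracCls (k : Fin n) (c : Fin n → K) (t : ι → MvPolynomial (Fin n) K) (j : Fin n ↪ ι)
    (A : Finset (Fin n)) :
    MvPolynomial (Fin n) K →ₗ[K] ((awayCube K t).res ∅ (A.map j)).H (A.map j).card :=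
  topCls (awayCube K t) (A.map j) ∘ₗ fracMap k c A (∏ s ∈ A.map j, t s)

/-- Independence and generation modulo `fracSup`, which is the space of coboundaries. -/
lemma fracCls_bijective [CharZero K] (hj : ∀ i, t (j i) = lin k c i) (A : Finset (Fin n)) :
    Function.Bijective (fracCls k c t j A) := by
  have hY := prod_map_lin hj A
  constructor
  · rw [injective_iff_map_eq_zero]
    intro f hf
    have : fracMap k c A (∏ s ∈ A.map j, t s) f ∈
        LinearMap.ker (topCls (awayCube K t) (A.map j)) := hf
    rw [ker_topCls hj] at this
    exact eq_zero_of_fracMap_mem hY this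
  · intro x
    obtain ⟨y, rfl⟩ := topCls_surjective _ x
    obtain ⟨f, hf⟩ := exists_sub_fracMap_mem (k := k) (c := c) hY y
    rw [← ker_topCls hj] at hf
    refine ⟨f, ?_⟩
    rw [eq_comm, ← sub_eq_zero]
    exact (map_sub (topCls (awayCube K t) (A.map j)) y _).symm.trans hf

/-- The coordinates form a regular sequence in cohomological form: for i ∉ A, the i-th coordinate
acts on the top cohomology for A as X_i on the polynomial model, so adjoining it creates nothing
below the new top degree. -/
theorem subsingleton_res_H_lin [CharZero K] (hj : ∀ i, t (j i) = lin k c i) (A : Finset (Fin n))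
    {p : ℕ} (hp : p < A.card) : Subsingleton (((awayCube K t).res ∅ (A.map j)).H p) := by
  induction A using Finset.induction_on generalizing p with
  | empty => exact absurd hp (Nat.not_lt_zero p)
  | insert i A hi ih =>
    rw [Finset.map_insert]
    refine (isCech_awayCube t).subsingleton_res_insert_H_card
      (fun h => hi ((Finset.mem_map' j).1 h)) (fun p hp => ih (by rwa [Finset.card_map] at hp)) ?_ ?_
    · rintro x ⟨g, hg⟩
      obtain ⟨f, hf⟩ := (fracCls_bijective hj A).2 (topCls (awayCube K t) (A.map j) x)
      obtain ⟨F, hF⟩ : ∃ F : (awayCube K t).M (A.map j),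
        F = fracMap k c A (∏ s ∈ A.map j, t s) f := ⟨_, rfl⟩
      have hf : topCls (awayCube K t) (A.map j) F = topCls (awayCube K t) (A.map j) x := by
        rw [hF]
        exact hf
      rw [← sub_eq_zero, ← map_sub] at hf
      obtain ⟨g', hg'⟩ := (topCls_eq_zero_iff _).1 hf
      have h1 : (awayCube K t).d (fun S => g S + t (j i) • g' S) (A.map j) = t (j i) • F := by
        rw [d_add, (isCech_awayCube t).d_smul, hg, hg', smul_sub, add_sub_cancel]
      have h2 := (topCls_eq_zero_iff _).2 ⟨_, h1⟩
      have h3 : t (j i) • F = fracMap k c A (∏ s ∈ A.map j, t s) (X i * f) := by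
        rw [← lin_mul_fracMap hi, hF, ← hj]
        exact Algebra.smul_def (t (j i)) (fracMap k c A (∏ s ∈ A.map j, t s) f)
      rw [h3] at h2
      have h4 := (injective_iff_map_eq_zero _).1 (fracCls_bijective hj A).1 _ h2
      have hf0 : f = 0 := (mul_eq_zero.1 h4).resolve_left (X_ne_zero i)
      refine (topCls_eq_zero_iff x).1 ?_
      have hF0 : F = 0 := by
        rw [hF, hf0]
        exact map_zero (fracMap k c A (∏ s ∈ A.map j, t s))
      rw [hF0, zero_sub, map_neg, neg_eq_zero] at hf
      exact hf
    · rw [← Finset.map_insert, Finset.card_map]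
      exact hp

lemma pderiv_lin (i l : Fin n) : pderiv i (lin k c l) =
    (if i = k then (if l = k then 1 else -c l) else if l = i then 1 else 0 : K) •
      (1 : MvPolynomial (Fin n) K) := by
  rw [lin]
  by_cases hl : l = k
  · rw [if_pos hl]
    by_cases hi : i = k
    · rw [if_pos hi, if_pos hl, hi, pderiv_X_self, one_smul]
    · rw [if_neg hi, pderiv_X_of_ne (Ne.symm hi), if_neg (fun h => hi (h.symm.trans hl)), zero_smul]
  · rw [if_neg hl, map_sub, pderiv_C_mul]
    by_cases hi : i = k
    · rw [if_pos hi, if_neg hl, hi, pderiv_X_of_ne hl, pderiv_X_self, zero_sub, mul_one, neg_smul,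
        smul_eq_C_mul, mul_one]
    · rw [if_neg hi, pderiv_X_of_ne (Ne.symm hi), mul_zero, sub_zero]
      by_cases hli : l = i
      · rw [if_pos hli, hli, pderiv_X_self, one_smul]
      · rw [if_neg hli, pderiv_X_of_ne hli, zero_smul]

/-- The chain rule for y_i = X_i - c_i X_k and y_k = X_k: the derivative in X_i is ∂/∂y_i for i ≠ k,
and the one in X_k is ∂/∂y_k - ∑ c_i ∂/∂y_i. This is the origin of `polyOp`. -/
lemma sum_fracOp {A : Finset (Fin n)} (hA : ∀ l ≠ k, l ∈ A) (i : Fin n) (f : MvPolynomial (Fin n) K) :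
    ∑ l, (if i = k then (if l = k then 1 else -c l) else if l = i then 1 else 0 : K) •
      fracOp A l f = polyOp k c (fracOp A k) i f := by
  have hne : ∀ l ≠ k, fracOp A l f = X l * f := fun l hl => by
    rw [fracOp, if_pos (hA l hl), LinearMap.mulLeft_apply]
  by_cases hi : i = k
  · rw [hi, polyOp_self, ← Finset.add_sum_erase _ _ (Finset.mem_univ k), if_pos rfl, if_pos rfl,
      one_smul, sub_eq_add_neg, Finset.sum_mul, ← Finset.sum_neg_distrib]
    congr 1
    refine Finset.sum_congr rfl fun l hl => ?_
    have := Finset.ne_of_mem_erase hl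
    rw [if_pos rfl, if_neg this, hne l this, neg_smul, smul_eq_C_mul, mul_assoc]
  · rw [polyOp_of_ne hi, Finset.sum_eq_single_of_mem i (Finset.mem_univ i), if_neg hi, if_pos rfl,
      one_smul, hne i hi]
    intro l _ hl
    rw [if_neg hi, if_neg hl, zero_smul]

/-- The model as a map of modules with operators. -/
def fracHom (hj : ∀ i, t (j i) = lin k c i) {A : Finset (Fin n)} (hA : ∀ l ≠ k, l ∈ A)
    (hG : ∀ i ≠ k, ∀ f : MvPolynomial (Fin n) K, fracOp A k (X i * f) = X i * fracOp A k f) :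
    OpModule.Hom (polyModule k c (fracOp A k) hG) (resOp t ∅ (A.map j) (A.map j).card) where
  lin := fracCls k c t j A
  comm i f := by
    refine Eq.trans ?_ (resMap_H_topCls (awayDer t (pderiv i)) (A.map j) _).symm
    refine congrArg (topCls (awayCube K t) (A.map j)) ?_
    refine Eq.trans ?_ (der_fracMap (prod_map_lin hj A)
      (locDerivation (Submonoid.powers (∏ s ∈ A.map j, t s)) (pderiv i))
      (fun l => if i = k then (if l = k then 1 else -c l) else if l = i then 1 else 0)
      (fun l => ?_) f).symm
    · rw [sum_fracOp hA]
      rfl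
    · rw [locDerivation_algebraMap, pderiv_lin]
      refine (map_smul (IsScalarTower.toAlgHom K (MvPolynomial (Fin n) K)
        (Localization.Away (∏ s ∈ A.map j, t s))) _ _).trans ?_
      rw [map_one]

/-- Support on a line: the coordinates other than y_k are inverted, so ∂/∂y_k stays a derivative. -/
theorem hasDims_resOp_erase [CharZero K] {r : ℕ} (hr : 0 < r) {k : Fin (r + 1)}
    {c : Fin (r + 1) → K} {t : ι → MvPolynomial (Fin (r + 1)) K} {j : Fin (r + 1) ↪ ι}
    (hj : ∀ i, t (j i) = lin k c i) :
    (resOp t ∅ ((Finset.univ.erase k).map j) r).HasDims 1 0 := by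
  have hc : ((Finset.univ.erase k).map j).card = r := by
    rw [Finset.card_map, Finset.card_erase_of_mem (Finset.mem_univ k), Finset.card_univ,
      Fintype.card_fin]
    rfl
  have hG : fracOp (K := K) (Finset.univ.erase k) k = (pderiv k).toLinearMap :=
    if_neg (Finset.notMem_erase k _)
  have key : (resOp t ∅ ((Finset.univ.erase k).map j)
      ((Finset.univ.erase k).map j).card).HasDims 1 0 := by
    refine HasDims.of_bijective (fracHom hj (fun l hl => Finset.mem_erase.2 ⟨hl, Finset.mem_univ l⟩)
      (hG.symm ▸ fun _ h => pderiv_X_mul h)) (fracCls_bijective hj _) ?_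
    have := hasDims_pderiv hr k c
    convert this
  rw [hc] at key
  exact key

/-- Support at the origin: all coordinates are inverted, so every ∂/∂y_i becomes a multiplication.
-/
theorem hasDims_resOp_univ [CharZero K] {r : ℕ} {k : Fin (r + 1)}
    {c : Fin (r + 1) → K} {t : ι → MvPolynomial (Fin (r + 1)) K} {j : Fin (r + 1) ↪ ι}
    (hj : ∀ i, t (j i) = lin k c i) :
    (resOp t ∅ (Finset.univ.map j) (r + 1)).HasDims 0 1 := by
  have hc : (Finset.univ.map j).card = r + 1 := by
    rw [Finset.card_map, Finset.card_univ, Fintype.card_fin]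
  have hG : fracOp (K := K) Finset.univ k = LinearMap.mulLeft K (X k) :=
    if_pos (Finset.mem_univ k)
  have key : (resOp t ∅ (Finset.univ.map j) (Finset.univ.map j).card).HasDims 0 1 := by
    refine HasDims.of_bijective (fracHom hj (fun l _ => Finset.mem_univ l)
      (hG.symm ▸ fun i _ => mulLeft_X_mul i k)) (fracCls_bijective hj _) ?_
    have := hasDims_mulLeft_X k c
    convert this
  rw [hc] at key
  exact key

end CechModel
end

noncomputable section
open CategoryTheory

section Comparison

open ModuleCube OpModule MvPolynomial

variable {K : Type u} [Field K] {n : ℕ} {ι : Type} [LinearOrder ι]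
  {t : ι → MvPolynomial (Fin n) K}

/-! ### Change of the family of elements -/

/-- The projection as a map of modules with operators. -/
def projOp (t : ι → MvPolynomial (Fin n) K) (B : Finset ι) {U U' : Finset ι} (h : U ⊆ U') (p : ℕ) :
    OpModule.Hom (resOp t B U' p) (resOp t B U p) where
  lin := (resProj B h).H p
  comm i x := Hom.H_comm (fun S y => resVal_injective (by
    rw [resVal_resProj, resVal_resMap, resVal_resMap, resVal_resProj]
    split_ifs
    · rfl
    · rw [map_zero])) p x

/-- The inclusion as a map of modules with operators. -/
def inclOp (t : ι → MvPolynomial (Fin n) K) {B B' : Finset ι} (h : B ⊆ B') (U : Finset ι) (p : ℕ) :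
    OpModule.Hom (resOp t B' U p) (resOp t B U p) where
  lin := (resIncl h U).H p
  comm i x := Hom.H_comm (α := resMap (awayDer t (pderiv i)) _ _) (β := resIncl h U)
    (γ := resIncl h U) (δ := resMap (awayDer t (pderiv i)) _ _) (fun _ _ => resVal_injective rfl) p x

/-- The connecting homomorphism as a map of modules with operators. -/
def deltaOp (t : ι → MvPolynomial (Fin n) K) (B U : Finset ι) (k : ι) (hk : k ∉ U) (p : ℕ) :
    OpModule.Hom (resOp t B U p) (resOp t (insert k B) (insert k U) (p + 1)) where
  lin := (resSES (awayCube K t) B U k hk).δ p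
  comm i x := ((resSES (awayCube K t) B U k hk).δ_naturality (resSES (awayCube K t) B U k hk)
    (resMap (awayDer t (pderiv i)) _ _) (resMap (awayDer t (pderiv i)) _ _)
    (resMap (awayDer t (pderiv i)) _ _) (fun S y => resVal_injective rfl)
    (fun S y => (resVal_injective (by
      refine (resVal_resProj B (Finset.subset_insert k U) S _).trans ?_
      rw [resVal_resMap, resVal_resMap]
      refine Eq.trans ?_ (congrArg _ (resVal_resProj B (Finset.subset_insert k U) S _).symm)
      split_ifs
      · rfl
      · rw [map_zero]))) p x).symm

/-- The connecting homomorphisms are compatible with the projections. -/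
lemma projOp_deltaOp {B U U' : Finset ι} (h : U ⊆ U') {k : ι} (hk : k ∉ U') (p : ℕ)
    (x : (resOp t B U' p).carrier) :
    (projOp t (insert k B) (Finset.insert_subset_insert k h) (p + 1)).lin
      ((deltaOp t B U' k hk p).lin x) =
      (deltaOp t B U k (fun hU => hk (h hU)) p).lin ((projOp t B h p).lin x) := by
  refine (resSES (awayCube K t) B U' k hk).δ_naturality
    (resSES (awayCube K t) B U k fun hU => hk (h hU)) (resProj _ (Finset.insert_subset_insert k h))
    (resProj _ (Finset.insert_subset_insert k h)) (resProj _ h) (fun S y => resVal_injective ?_)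
    (fun S y => resVal_injective ?_) p x
  · refine (resVal_resIncl (Finset.subset_insert k B) _ _ _).trans ?_
    rw [resVal_resProj, resVal_resProj]
    refine if_congr Iff.rfl ?_ rfl
    exact (resVal_resIncl (Finset.subset_insert k B) _ _ _).symm
  · refine (resVal_resProj B (Finset.subset_insert k U) S _).trans ?_
    rw [resVal_resProj, resVal_resProj]
    have e : resVal ((resSES (awayCube K t) B U' k hk).g.app S y) = if S ⊆ U' then resVal y else 0 :=
      resVal_resProj B (Finset.subset_insert k U') S y
    rw [e]
    by_cases hS : S ⊆ U
    · rw [if_pos hS, if_pos hS, if_pos (hS.trans h), if_pos (hS.trans (Finset.subset_insert k U))]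
    · rw [if_neg hS, if_neg hS]

/-- Elements which belong to the radical of the others can be dropped. -/
theorem projOp_bijective_of_mem_radical (B : Finset ι) {U U' : Finset ι} (h : U ⊆ U')
    (hrad : ∀ s ∈ U', s ∉ U → ∏ i ∈ insert s B, t i ∈ (Ideal.span (t '' {i | i ∈ U ∧ i ∉ B})).radical)
    (p : ℕ) : Function.Bijective (projOp t B h p).lin := by
  obtain ⟨m, hm⟩ : ∃ m, (U' \ U).card = m := ⟨_, rfl⟩
  induction m generalizing U' with
  | zero =>
    obtain rfl : U = U' :=
      Finset.Subset.antisymm h (Finset.sdiff_eq_empty_iff_subset.1 (Finset.card_eq_zero.1 hm))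
    have : ∀ x, (projOp t B h p).lin x = x := fun x => Hom.H_id (resProj B h) (fun S y => by
      refine resVal_injective ?_
      rw [resVal_resProj]
      split_ifs with hS
      · rfl
      · exact (resVal_eq_zero (fun h => hS h.2) y).symm) p x
    rw [show ⇑(projOp t B h p).lin = id from funext this]
    exact Function.bijective_id
  | succ m ih =>
    obtain ⟨k, hk⟩ := Finset.card_pos.1 (by rw [hm]; omega : 0 < (U' \ U).card)
    obtain ⟨hkU', hkU⟩ := Finset.mem_sdiff.1 hk
    obtain ⟨V, hkV, rfl⟩ : ∃ V, k ∉ V ∧ insert k V = U' :=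
      ⟨U'.erase k, Finset.notMem_erase k U', Finset.insert_erase hkU'⟩
    have hUV : U ⊆ V := fun i hi => (Finset.mem_insert.1 (h hi)).resolve_left fun e => hkU (e ▸ hi)
    have ih' := ih hUV (fun s hs => hrad s (Finset.mem_insert_of_mem hs)) (by
      rw [Finset.insert_sdiff_of_notMem _ hkU, Finset.card_insert_of_notMem (fun h =>
        hkV (Finset.mem_sdiff.1 h).1)] at hm
      omega)
    -- The subsets containing k contribute nothing, by the radical hypothesis. The long exact
    -- sequence then makes dropping k an isomorphism, and the difference is removed one index at a
    -- time.
    have hac : ∀ q, Subsingleton (((awayCube K t).res (insert k B) (insert k V)).H q) := fun q => by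
      refine (isCech_awayCube t).subsingleton_res_H_of_mem_radical _ _
        (Ideal.radical_mono (Ideal.span_mono (Set.image_mono ?_)) (hrad k hkU' hkU)) q
      rintro i ⟨hi, hiB⟩
      refine ⟨Finset.mem_insert_of_mem (hUV hi), fun h => ?_⟩
      rcases Finset.mem_insert.1 h with rfl | h
      · exact hkU hi
      · exact hiB h
    have hb : Function.Bijective ((resProj (C := awayCube K t) B (Finset.subset_insert k V)).H p) := by
      let s := resSES (awayCube K t) B V k hkV
      have := hac p
      have := hac (p + 1)
      constructor
      · rw [injective_iff_map_eq_zero]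
        intro x hx
        obtain ⟨y, rfl⟩ := (s.exact₂ p x).1 hx
        rw [Subsingleton.elim y 0, map_zero]
      · intro x
        exact (s.exact₃ p x).1 (Subsingleton.elim _ _)
    have hcomp : ∀ x, (projOp t B h p).lin x =
        (projOp t B hUV p).lin ((resProj B (Finset.subset_insert k V)).H p x) := fun x => by
      refine Eq.trans ?_ (Hom.H_comp (resProj B (Finset.subset_insert k V)) (resProj B hUV) p x)
      refine Hom.H_congr (fun S y => resVal_injective ?_) p x
      refine (resVal_resProj B h S y).trans
        (Eq.trans ?_ (resVal_resProj B hUV S ((resProj B (Finset.subset_insert k V)).app S y)).symm)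
      rw [resVal_resProj]
      by_cases hS : S ⊆ U
      · rw [if_pos hS, if_pos hS, if_pos (hS.trans hUV)]
      · rw [if_neg hS, if_neg hS]
    rw [show ⇑(projOp t B h p).lin = (projOp t B hUV p).lin ∘
      (resProj B (Finset.subset_insert k V)).H p from funext hcomp]
    exact ih'.comp hb

/-- Elements which vanish at the common zeros of the others can be dropped. -/
theorem projOp_bijective [IsAlgClosed K] (B : Finset ι) {U U' : Finset ι} (h : U ⊆ U')
    (hzero : ∀ s ∈ U', s ∉ U → ∀ x, (∀ i ∈ U, i ∉ B → eval x (t i) = 0) →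
      eval x (t s) = 0 ∨ ∃ b ∈ B, eval x (t b) = 0)
    (p : ℕ) : Function.Bijective (projOp t B h p).lin := by
  refine projOp_bijective_of_mem_radical B h (fun s hs hsU => ?_) p
  -- The Nullstellensatz. The product over {s} ∪ B vanishes at a point as soon as t s or some t b
  -- does, which is the disjunction in the hypothesis.
  have hN := vanishingIdeal_zeroLocus_eq_radical (k := K) (K := K)
    (Ideal.span (t '' {i | i ∈ U ∧ i ∉ B}))
  rw [← hN]
  intro x hx
  have hx' : ∀ i ∈ U, i ∉ B → eval x (t i) = 0 := fun i hi hiB => by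
    have := hx (t i) (Ideal.subset_span ⟨i, ⟨hi, hiB⟩, rfl⟩)
    rwa [aeval_eq_eval] at this
  rw [aeval_eq_eval, map_prod, Finset.prod_eq_zero_iff]
  rcases hzero s hs hsU x hx' with h | ⟨b, hb, h⟩
  · exact ⟨s, Finset.mem_insert_self s B, h⟩
  · exact ⟨b, Finset.mem_insert_of_mem hb, h⟩

/-! ### Change of the index set -/

/-- The cohomology of the Čech cube, with the partial derivatives. -/
abbrev cechOp (a : ι → MvPolynomial (Fin n) K) (p : ℕ) : OpModule K n where
  carrier := (awayCube K a).H p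
  D i := (awayDer a (pderiv i)).H p
  comm i l x := Hom.H_comm (fun _ y => locDerivation_comm _ _ _ (pderiv_comm i l) y) p x

/-- The comparison of the Čech cube of a subfamily with the subquotient. -/
def reindexOp {κ : Type} [LinearOrder κ] [Fintype κ] (e : κ ↪o ι) (t : ι → MvPolynomial (Fin n) K)
    (a : κ → MvPolynomial (Fin n) K) (h : ∀ i, t (e i) = a i) (p : ℕ) :
    OpModule.Hom (resOp t ∅ (Finset.univ.map e.toEmbedding) p) (cechOp a p) where
  lin := (awayReindex (K := K) e t a h).H p
  comm i x := (awayReindex (K := K) e t a h).H_comm _ _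
    (fun S y => awayReindex_der e t a h (pderiv i) S y) p x

lemma reindexOp_bijective {κ : Type} [LinearOrder κ] [Fintype κ] (e : κ ↪o ι)
    (t : ι → MvPolynomial (Fin n) K) (a : κ → MvPolynomial (Fin n) K) (h : ∀ i, t (e i) = a i)
    (p : ℕ) : Function.Bijective (reindexOp e t a h p).lin :=
  ((awayReindex (K := K) e t a h).H p).bijective

end Comparison
end

noncomputable section
open CategoryTheory

/-! ### Points of projective space -/

section Points

open MvPolynomial

variable {K : Type u} [Field K] {n : ℕ}

/-- The family `t` has the cone over `Z` as its set of common zeros. -/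
def IsCone {ι : Type*} (t : ι → MvPolynomial (Fin n) K) (U : Finset ι)
    (Z : Set (Projectivization K (Fin n → K))) : Prop :=
  -- For x = 0 the right-hand side is vacuous, so the equations are required to vanish at the
  -- origin.
  ∀ x : Fin n → K, (∀ s ∈ U, eval x (t s) = 0) ↔ ∀ hx : x ≠ 0, Projectivization.mk K x hx ∈ Z

lemma exists_coordinates (p : Projectivization K (Fin n → K)) : ∃ (k : Fin n) (c : Fin n → K),
    c k = 1 ∧ ∃ hc : c ≠ 0, Projectivization.mk K c hc = p := by
  obtain ⟨k, hk⟩ := Function.ne_iff.1 p.rep_nonzero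
  have hk : p.rep k ≠ 0 := hk
  have h1 : ((p.rep k)⁻¹ • p.rep) k = 1 := by
    rw [Pi.smul_apply, smul_eq_mul, inv_mul_cancel₀ hk]
  have h2 : (p.rep k)⁻¹ • p.rep ≠ 0 := fun h => by
    rw [h] at h1
    exact zero_ne_one h1
  refine ⟨k, (p.rep k)⁻¹ • p.rep, h1, h2, ?_⟩
  conv_rhs => rw [← p.mk_rep]
  exact (Projectivization.mk_eq_mk_iff' K _ _ _ _).2 ⟨_, rfl⟩

lemma eval_lin_of_ne {k i : Fin n} (hi : i ≠ k) (c x : Fin n → K) :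
    eval x (lin k c i) = x i - c i * x k := by
  rw [lin, if_neg hi, map_sub, map_mul, eval_C, eval_X, eval_X]

lemma eval_lin_self (k : Fin n) (c x : Fin n → K) : eval x (lin k c k) = x k := by
  rw [lin, if_pos rfl, eval_X]

/-- As c k = 1, the equations say x = x_k • c: x lies on the line through c, the origin included. -/
lemma eval_lin_eq_zero_iff {k : Fin n} {c : Fin n → K} (hc : c k = 1) (hc0 : c ≠ 0)
    (x : Fin n → K) : (∀ i ≠ k, eval x (lin k c i) = 0) ↔
      ∀ hx : x ≠ 0, Projectivization.mk K x hx = Projectivization.mk K c hc0 := by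
  have h1 : (∀ i ≠ k, eval x (lin k c i) = 0) ↔ x k • c = x := by
    constructor
    · intro h
      ext i
      rw [Pi.smul_apply, smul_eq_mul]
      by_cases hi : i = k
      · rw [hi, hc, mul_one]
      · have := h i hi
        rw [eval_lin_of_ne hi, sub_eq_zero] at this
        rw [this, mul_comm]
    · intro h i hi
      rw [eval_lin_of_ne hi, sub_eq_zero]
      conv_lhs => rw [← h]
      rw [Pi.smul_apply, smul_eq_mul, mul_comm]
  rw [h1]
  constructor
  · intro h hx
    exact (Projectivization.mk_eq_mk_iff' K _ _ _ _).2 ⟨_, h⟩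
  · intro h
    by_cases hx : x = 0
    · rw [hx, Pi.zero_apply, zero_smul]
    · obtain ⟨a, ha⟩ := (Projectivization.mk_eq_mk_iff' K _ _ _ _).1 (h hx)
      have hk := congrFun ha k
      rw [Pi.smul_apply, hc, smul_eq_mul, mul_one] at hk
      rw [← hk, ha]

/-- A linear form which separates two points. -/
lemma exists_linear_separating {p q : Projectivization K (Fin n → K)} (h : q ≠ p) :
    ∃ l : MvPolynomial (Fin n) K, eval 0 l = 0 ∧
      (∀ x (hx : x ≠ 0), Projectivization.mk K x hx = q → eval x l = 0) ∧
      ∀ x (hx : x ≠ 0), Projectivization.mk K x hx = p → eval x l ≠ 0 := by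
  obtain ⟨k, c, hc, hc0, rfl⟩ := exists_coordinates q
  have hq := eval_lin_eq_zero_iff hc hc0
  have hp : ¬ ∀ i ≠ k, eval p.rep (lin k c i) = 0 := fun h' => h (by
    have := (hq p.rep).1 h' p.rep_nonzero
    rw [← this, p.mk_rep])
  push Not at hp
  obtain ⟨i, hi, hpi⟩ := hp
  refine ⟨lin k c i, ?_, fun x hx e => ?_, fun x hx e => ?_⟩
  · rw [eval_lin_of_ne hi, Pi.zero_apply, Pi.zero_apply, mul_zero, sub_zero]
  · exact (hq x).2 (fun _ => e) i hi
  · intro hx0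
    rw [← p.mk_rep] at e
    obtain ⟨a, ha⟩ := (Projectivization.mk_eq_mk_iff' K _ _ _ _).1 e.symm
    rw [eval_lin_of_ne hi] at hpi hx0
    refine hpi ?_
    rw [← ha, Pi.smul_apply, Pi.smul_apply, smul_eq_mul, smul_eq_mul, mul_left_comm, ← mul_sub, hx0,
      mul_zero]

/-- A product of linear forms, one for each point of Z and none vanishing at p. At the origin the
product vanishes because it has a factor, which is why Z must be non-empty. -/
lemma exists_separating {Z : Finset (Projectivization K (Fin n → K))} (hZ : Z.Nonempty)
    {p : Projectivization K (Fin n → K)} (hp : p ∉ Z) :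
    ∃ h : MvPolynomial (Fin n) K,
      (∀ x, (∀ hx : x ≠ 0, Projectivization.mk K x hx ∈ Z) → eval x h = 0) ∧
      ∀ x (hx : x ≠ 0), Projectivization.mk K x hx = p → eval x h ≠ 0 := by
  choose l h0 hl hl' using fun q : Z => exists_linear_separating (p := p) (q := q.1)
    fun e => hp (e ▸ q.2)
  refine ⟨∏ q, l q, fun x hx => ?_, fun x hx e => ?_⟩
  · rw [map_prod]
    by_cases hx0 : x = 0
    · obtain ⟨q, hq⟩ := hZ
      exact Finset.prod_eq_zero (Finset.mem_univ ⟨q, hq⟩) (by rw [hx0, h0])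
    · exact Finset.prod_eq_zero (Finset.mem_univ ⟨_, hx hx0⟩) (hl ⟨_, hx hx0⟩ x hx0 rfl)
  · rw [map_prod, Finset.prod_ne_zero_iff]
    exact fun q _ => hl' q x hx e

end Points
end

noncomputable section
open CategoryTheory

/-! ### Adding one point -/

section AddPoint

open ModuleCube OpModule MvPolynomial

variable {K : Type u} [Field K] [CharZero K] [IsAlgClosed K] {r : ℕ} {ι : Type} [LinearOrder ι]
  {t : ι → MvPolynomial (Fin (r + 1)) K} {k : Fin (r + 1)} {c : Fin (r + 1) → K}
  {j : Fin (r + 1) ↪ ι} {T : Finset ι}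

/-- The indices of the equations of a line. -/
abbrev lineIdx (k : Fin (r + 1)) (j : Fin (r + 1) ↪ ι) : Finset ι := (Finset.univ.erase k).map j

omit [LinearOrder ι] in
lemma card_lineIdx (k : Fin (r + 1)) (j : Fin (r + 1) ↪ ι) : (lineIdx k j).card = r := by
  rw [Finset.card_map, Finset.card_erase_of_mem (Finset.mem_univ k), Finset.card_univ,
    Fintype.card_fin]
  rfl

omit [CharZero K] [IsAlgClosed K] [LinearOrder ι] in
lemma eval_lineIdx_iff (hj : ∀ i, t (j i) = lin k c i) (x : Fin (r + 1) → K) :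
    (∀ s ∈ lineIdx k j, eval x (t s) = 0) ↔ ∀ i ≠ k, eval x (lin k c i) = 0 := by
  constructor
  · intro h i hi
    rw [← hj]
    exact h _ (Finset.mem_map_of_mem j (Finset.mem_erase.2 ⟨hi, Finset.mem_univ i⟩))
  · intro h s hs
    obtain ⟨i, hi, rfl⟩ := Finset.mem_map.1 hs
    rw [hj]
    exact h i (Finset.ne_of_mem_erase hi)

omit [CharZero K] in
-- The line lies in the zero set of T, so joining T to its equations does not change the common
-- zeros.
lemma projOp_line_bijective (hj : ∀ i, t (j i) = lin k c i)
    (hb : ∀ x, (∀ i ≠ k, eval x (lin k c i) = 0) → ∀ s ∈ T, eval x (t s) = 0) (p : ℕ) :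
    Function.Bijective
      (projOp t ∅ (Finset.subset_union_right : lineIdx k j ⊆ T ∪ lineIdx k j) p).lin := by
  refine projOp_bijective ∅ _ (fun s hs _ x hx => Or.inl ?_) p
  have hx' : ∀ s ∈ lineIdx k j, eval x (t s) = 0 := fun s hs => hx s hs (Finset.notMem_empty s)
  rcases Finset.mem_union.1 hs with h | h
  · exact hb x ((eval_lineIdx_iff hj x).1 hx') s h
  · exact hx' s h

lemma hasDims_union_line (hr : 0 < r) (hj : ∀ i, t (j i) = lin k c i)
    (hb : ∀ x, (∀ i ≠ k, eval x (lin k c i) = 0) → ∀ s ∈ T, eval x (t s) = 0) :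
    (resOp t ∅ (T ∪ lineIdx k j) r).HasDims 1 0 :=
  HasDims.of_bijective' _ (projOp_line_bijective hj hb r) (hasDims_resOp_erase hr hj)

lemma subsingleton_union_line (hj : ∀ i, t (j i) = lin k c i)
    (hb : ∀ x, (∀ i ≠ k, eval x (lin k c i) = 0) → ∀ s ∈ T, eval x (t s) = 0) {p : ℕ} (hp : p ≠ r) :
    Subsingleton (((awayCube K t).res ∅ (T ∪ lineIdx k j)).H p) := by
  refine (Equiv.ofBijective _ (projOp_line_bijective hj hb p)).subsingleton_congr.2 ?_
  rcases lt_or_gt_of_ne hp with h | h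
  · refine subsingleton_res_H_lin hj _ ?_
    rw [← Finset.card_map j, card_lineIdx]
    exact h
  · exact subsingleton_res_H_of_card_lt _ _ (by rw [card_lineIdx]; exact h)

/-- One point: T, the equations of the line, and their union have the same zeros, so T inherits the
linear model and its cohomology in degree r + 1 vanishes. -/
theorem hasDims_of_line (hr : 0 < r) (hj : ∀ i, t (j i) = lin k c i)
    (hb : ∀ x, (∀ s ∈ T, eval x (t s) = 0) ↔ ∀ i ≠ k, eval x (lin k c i) = 0) :
    Subsingleton (((awayCube K t).res ∅ T).H (r + 1)) ∧ (resOp t ∅ T r).HasDims 1 0 := by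
  have hbij : ∀ p, Function.Bijective
      (projOp t ∅ (Finset.subset_union_left : T ⊆ T ∪ lineIdx k j) p).lin := by
    refine fun p => projOp_bijective ∅ _ (fun s hs _ x hx => Or.inl ?_) p
    have hx' : ∀ s ∈ T, eval x (t s) = 0 := fun s hs => hx s hs (Finset.notMem_empty s)
    rcases Finset.mem_union.1 hs with h | h
    · exact hx' s h
    · exact (eval_lineIdx_iff hj x).2 ((hb x).1 hx') s h
  have hb' := fun x => (hb x).2
  exact ⟨(Equiv.ofBijective _ (hbij (r + 1))).subsingleton_congr.1
    (subsingleton_union_line hj hb' (by omega)),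
    HasDims.of_bijective _ (hbij r) (hasDims_union_line hr hj hb')⟩

variable {h : ι}

/-- The punctured line. -/
lemma hasDims_punctured_line (hr : 0 < r) (hj : ∀ i, t (j i) = lin k c i)
    (hb : ∀ x, (∀ i ≠ k, eval x (lin k c i) = 0) → ∀ s ∈ T, eval x (t s) = 0)
    (hline : ∀ x, (∀ i ≠ k, eval x (lin k c i) = 0) → eval x (t h) = 0 → x k = 0)
    (hzero : eval 0 (t h) = 0) (hW : h ∉ T ∪ lineIdx k j) :
    (resOp t (insert h ∅) (insert h (T ∪ lineIdx k j)) (r + 1)).HasDims 1 1 ∧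
      Function.Surjective ((deltaOp t ∅ (T ∪ lineIdx k j) h hW r).cube.H r) := by
  let W := T ∪ lineIdx k j
  -- V contains both {h} ∪ W and all the linear coordinates. All three families have only the origin
  -- as common zero, so the cohomology of {h} ∪ W is that of the origin.
  let V := insert h (T ∪ Finset.univ.map j)
  have hbY : lineIdx k j ⊆ Finset.univ.map j := Finset.map_subset_map.2 (Finset.erase_subset _ _)
  have hWV : insert h W ⊆ V :=
    Finset.insert_subset_insert h (Finset.union_subset_union_right hbY)
  have hYV : Finset.univ.map j ⊆ V :=
    Finset.subset_union_right.trans (Finset.subset_insert _ _)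
  have bW : ∀ p, Function.Bijective (projOp t ∅ hWV p).lin := by
    refine fun p => projOp_bijective ∅ _ (fun s hs _ x hx => Or.inl ?_) p
    have hx' : ∀ s ∈ insert h W, eval x (t s) = 0 := fun s hs => hx s hs (Finset.notMem_empty s)
    have hl := (eval_lineIdx_iff hj x).1 fun s hs =>
      hx' s (Finset.mem_insert_of_mem (Finset.mem_union_right _ hs))
    rcases Finset.mem_insert.1 hs with rfl | hs
    · exact hx' s (Finset.mem_insert_self s W)
    · rcases Finset.mem_union.1 hs with hs | hs
      · exact hx' s (Finset.mem_insert_of_mem (Finset.mem_union_left _ hs))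
      · obtain ⟨i, -, rfl⟩ := Finset.mem_map.1 hs
        rw [hj]
        by_cases hi : i = k
        · rw [hi, eval_lin_self]
          exact hline x hl (hx' h (Finset.mem_insert_self h W))
        · exact hl i hi
  have bY : ∀ p, Function.Bijective (projOp t ∅ hYV p).lin := by
    refine fun p => projOp_bijective ∅ _ (fun s hs _ x hx => Or.inl ?_) p
    have hx' : ∀ i, eval x (lin k c i) = 0 := fun i => by
      rw [← hj]
      exact hx _ (Finset.mem_map_of_mem j (Finset.mem_univ i)) (Finset.notMem_empty _)
    have hx0 : x = 0 := by
      have hk := hx' k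
      rw [eval_lin_self] at hk
      ext i
      by_cases hi : i = k
      · rw [hi, hk]
        rfl
      · have := hx' i
        rwa [eval_lin_of_ne hi, hk, mul_zero, sub_zero] at this
    rcases Finset.mem_insert.1 hs with rfl | hs
    · rw [hx0, hzero]
    · rcases Finset.mem_union.1 hs with hs | hs
      · exact hb x (fun i _ => hx' i) s hs
      · obtain ⟨i, -, rfl⟩ := Finset.mem_map.1 hs
        rw [hj]
        exact hx' i
  have hE : (resOp t ∅ (insert h W) (r + 1)).HasDims 0 1 :=
    HasDims.of_bijective _ (bW _) (HasDims.of_bijective' _ (bY _) (hasDims_resOp_univ hj))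
  have hE' : Subsingleton (((awayCube K t).res ∅ (insert h W)).H r) := by
    refine (Equiv.ofBijective _ (bW r)).subsingleton_congr.1
      ((Equiv.ofBijective _ (bY r)).subsingleton_congr.2 (subsingleton_res_H_lin hj _ ?_))
    rw [Finset.card_univ, Fintype.card_fin]
    exact Nat.lt_succ_self r
  have hW' := subsingleton_union_line hj hb (Nat.succ_ne_self r)
  -- In degrees r and r + 1 this sequence reads 0 → H^r at the line → its localization at h →
  -- H^{r+1} at the origin → 0, since the origin has no cohomology in degree r and the line none in
  -- degree r + 1. The dimensions are (1, 0) + (0, 1).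
  let s := resSES (awayCube K t) ∅ W h hW
  let f := deltaOp t ∅ W h hW r
  let g := inclOp t (Finset.subset_insert h ∅) (insert h W) (r + 1)
  have hf : Function.Injective f.lin := by
    rw [injective_iff_map_eq_zero]
    intro x hx
    obtain ⟨y, rfl⟩ := (s.exact₃ r x).1 hx
    rw [Subsingleton.elim y 0, map_zero]
  have hfg : Function.Exact f.lin g.lin := s.exact₁ r
  have hg : Function.Surjective g.lin := fun x => (s.exact₂ (r + 1) x).1 (Subsingleton.elim _ _)
  have hsub := hE.subsingleton
  exact ⟨HasDims.of_exact f g hf hfg hg (hasDims_union_line hr hj hb) hE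
    fun x => ⟨0, Subsingleton.elim _ _⟩, surjective_H_of_exact f g hf hfg hg r hsub⟩

/-- Here T cuts out the old cone together with a new line, and adding h removes the line. Inverting
h sees only the punctured line, with dimensions (1, 1). The dimensions add because the de Rham
classes of degree r on the punctured line extend over T: they come from the whole line. -/
theorem hasDims_add_point {α β : ℕ} (hr : 0 < r) (hj : ∀ i, t (j i) = lin k c i)
    (hb : ∀ x, (∀ i ≠ k, eval x (lin k c i) = 0) → ∀ s ∈ T, eval x (t s) = 0)
    (hT : ∀ x, (∀ s ∈ T, eval x (t s) = 0) →
      (∀ i ≠ k, eval x (lin k c i) = 0) ∨ eval x (t h) = 0)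
    (hline : ∀ x, (∀ i ≠ k, eval x (lin k c i) = 0) → eval x (t h) = 0 → x k = 0)
    (hzero : eval 0 (t h) = 0) (hW : h ∉ T ∪ lineIdx k j)
    (h₁ : Subsingleton (((awayCube K t).res ∅ (insert h T)).H (r + 1)))
    (h₂ : (resOp t ∅ (insert h T) r).HasDims α β) :
    Subsingleton (((awayCube K t).res ∅ T).H (r + 1)) ∧
      (resOp t ∅ T r).HasDims (α + 1) (β + 1) := by
  let W := T ∪ lineIdx k j
  have hTW : T ⊆ W := Finset.subset_union_left
  have hhT : h ∉ T := fun h' => hW (hTW h')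
  obtain ⟨hQ, hsurj⟩ := hasDims_punctured_line hr hj hb hline hzero hW
  -- Where h is nonzero, the zeros of T lie on the line; so after inverting h the equations of the
  -- line may be added to T.
  have bq : ∀ p, Function.Bijective
      (projOp t (insert h ∅) (Finset.insert_subset_insert h hTW) p).lin := by
    refine fun p => projOp_bijective _ _ (fun s hs hsT x hx => ?_) p
    have hx' : ∀ s ∈ T, eval x (t s) = 0 := fun s hs => hx s (Finset.mem_insert_of_mem hs) fun h' =>
      hhT ((Finset.mem_singleton.1 h') ▸ hs)
    rcases hT x hx' with hl | hl
    · rcases Finset.mem_insert.1 hs with rfl | hs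
      · exact absurd (Finset.mem_insert_self s T) hsT
      · rcases Finset.mem_union.1 hs with hs | hs
        · exact Or.inl (hx' s hs)
        · exact Or.inl ((eval_lineIdx_iff hj x).2 hl s hs)
    · exact Or.inr ⟨h, Finset.mem_insert_self h ∅, hl⟩
  have hsub : ∀ p, p ≠ r → Subsingleton
      (((awayCube K t).res (insert h ∅) (insert h T)).H (p + 1)) := fun p hp =>
    (Equiv.ofBijective _ (bq (p + 1))).subsingleton_congr.1
      ((isCech_awayCube t).subsingleton_res_insert_H ∅ W hW (Finset.notMem_empty h) p
        (subsingleton_union_line hj hb hp))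
  -- Degree r of the part with h is the localization of degree r - 1, which vanishes on the line; r
  -- > 0 provides that degree.
  have hsub_r : Subsingleton (((awayCube K t).res (insert h ∅) (insert h T)).H r) := by
    obtain ⟨q, rfl⟩ : ∃ q, r = q + 1 := ⟨r - 1, by omega⟩
    exact hsub q (by omega)
  have hsub_r2 := hsub (r + 1) (by omega)
  let s := resSES (awayCube K t) ∅ T h hhT
  let f := projOp t ∅ (Finset.subset_insert h T) r
  let g := deltaOp t ∅ T h hhT r
  constructor
  · refine subsingleton_of_forall_eq 0 fun x => ?_
    obtain ⟨y, rfl⟩ := (s.exact₃ (r + 1) x).1 (Subsingleton.elim _ _)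
    rw [Subsingleton.elim y 0, map_zero]
  · have hf : Function.Injective f.lin := by
      rw [injective_iff_map_eq_zero]
      intro x hx
      obtain ⟨y, rfl⟩ := (s.exact₂ r x).1 hx
      rw [Subsingleton.elim y 0, map_zero]
    have hfg : Function.Exact f.lin g.lin := s.exact₃ r
    have hg : Function.Surjective g.lin := fun x => (s.exact₁ r x).1 (Subsingleton.elim _ _)
    have hQ' := HasDims.of_bijective _ (bq (r + 1)) hQ
    refine HasDims.of_exact f g hf hfg hg h₂ hQ' fun y => ?_
    obtain ⟨y, rfl⟩ := (Hom.equivH _ (bq (r + 1)) r).surjective y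
    obtain ⟨x, rfl⟩ := hsurj y
    -- The class x on the line is mapped to the larger zero set of T; naturality of the connecting
    -- map shows that it restricts to the given class on the punctured line.
    refine ⟨(projOp t ∅ hTW r).cube.H r x, ?_⟩
    rw [OpModule.Hom.equivH_apply]
    refine ModuleCube.Hom.H_comm (fun S y => ?_) r x
    exact (projOp_deltaOp hTW hW r y).symm

end AddPoint
end

noncomputable section
open CategoryTheory

/-! ### Cones over finitely many points -/

section Cone

open ModuleCube OpModule MvPolynomial

variable {K : Type u} [Field K] {r : ℕ}

/-- The vanishing and the dimensions for the cone over a finite set of points. -/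
def ConeDims (Z : Finset (Projectivization K (Fin (r + 1) → K))) : Prop :=
  -- All finite families of equations are allowed, because the induction adjoins the element h to
  -- the family and so changes the index set.
  ∀ (κ : Type) [LinearOrder κ] [Fintype κ] (a : κ → MvPolynomial (Fin (r + 1)) K),
    IsCone a Finset.univ (Z : Set (Projectivization K (Fin (r + 1) → K))) →
    Subsingleton ((awayCube K a).H (r + 1)) ∧ (cechOp a r).HasDims Z.card (Z.card - 1)

/-- The induction hypothesis concerns full index sets, whereas the exact sequences use subfamilies
of one large family; reindexing by U mediates. -/
lemma ConeDims.res {Z : Finset (Projectivization K (Fin (r + 1) → K))} (hZ : ConeDims Z) {ι : Type}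
    [LinearOrder ι] {t : ι → MvPolynomial (Fin (r + 1)) K} {U : Finset ι} (hU : IsCone t U Z) :
    Subsingleton (((awayCube K t).res ∅ U).H (r + 1)) ∧
      (resOp t ∅ U r).HasDims Z.card (Z.card - 1) := by
  let e : U ↪o ι := OrderEmbedding.subtype _
  have hmap : Finset.univ.map e.toEmbedding = U := U.attach_map_val
  obtain ⟨h1, h2⟩ := hZ U (fun i => t i.1) (fun x => by
    rw [← hU x]
    exact ⟨fun h s hs => h ⟨s, hs⟩ (Finset.mem_univ _), fun h s _ => h s.1 s.2⟩)
  have hb := reindexOp_bijective e t (fun i : U => t i.1) fun _ => rfl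
  have h3 := (Equiv.ofBijective _ (hb (r + 1))).subsingleton_congr.2 h1
  have h4 := HasDims.of_bijective' _ (hb r) h2
  rw [hmap] at h3 h4
  exact ⟨h3, h4⟩

/-- The index set with the equations of a line and one more element adjoined. -/
abbrev BigIdx (κ : Type) (r : ℕ) : Type := κ ⊕ₗ Fin (r + 2)

/-- The given elements, followed by the equations of a line and one more element. -/
def bigFamily {κ : Type} (a : κ → MvPolynomial (Fin (r + 1)) K) (k : Fin (r + 1))
    (c : Fin (r + 1) → K) (h : MvPolynomial (Fin (r + 1)) K) (x : BigIdx κ r) :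
    MvPolynomial (Fin (r + 1)) K :=
  Sum.elim a (Fin.snoc (α := fun _ => MvPolynomial (Fin (r + 1)) K) (lin k c) h) (ofLex x)

/-- The embedding of the given indices. -/
def bigEmb (κ : Type) [LinearOrder κ] (r : ℕ) : κ ↪o BigIdx κ r :=
  OrderEmbedding.ofMapLEIff (fun x => toLex (Sum.inl x)) fun _ _ => Sum.Lex.inl_le_inl_iff

/-- The embedding of the indices of the equations of a line. -/
def bigLine (κ : Type) (r : ℕ) : Fin (r + 1) ↪ BigIdx κ r where
  toFun i := toLex (Sum.inr i.castSucc)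
  inj' _ _ h := Fin.castSucc_injective _ (Sum.inr_injective (toLex.injective h))

/-- The last index. -/
def bigLast (κ : Type) (r : ℕ) : BigIdx κ r := toLex (Sum.inr (Fin.last _))

lemma bigFamily_emb {κ : Type} [LinearOrder κ] (a : κ → MvPolynomial (Fin (r + 1)) K) (k c h)
    (i : κ) : bigFamily a k c h (bigEmb κ r i) = a i := rfl

lemma bigFamily_line {κ : Type} (a : κ → MvPolynomial (Fin (r + 1)) K) (k c h)
    (i : Fin (r + 1)) : bigFamily a k c h (bigLine κ r i) = lin k c i :=
  Fin.snoc_castSucc (α := fun _ => MvPolynomial (Fin (r + 1)) K) _ _ _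

lemma bigFamily_last {κ : Type} (a : κ → MvPolynomial (Fin (r + 1)) K) (k c h) :
    bigFamily a k c h (bigLast κ r) = h :=
  Fin.snoc_last (α := fun _ => MvPolynomial (Fin (r + 1)) K) _ _

lemma bigLast_notMem {κ : Type} [LinearOrder κ] [Fintype κ] (k : Fin (r + 1)) :
    bigLast κ r ∉ Finset.univ.map (bigEmb κ r).toEmbedding ∪ lineIdx k (bigLine κ r) := by
  rw [Finset.mem_union, not_or]
  constructor
  · intro h
    obtain ⟨i, -, hi⟩ := Finset.mem_map.1 h
    exact Sum.inl_ne_inr (toLex.injective hi)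
  · intro h
    obtain ⟨i, -, hi⟩ := Finset.mem_map.1 h
    exact (Fin.castSucc_lt_last i).ne (Sum.inr_injective (toLex.injective hi))

/-- Induction on the points. The given family is embedded into one that also contains the equations
of the new line and a separating h, so that all the families to be compared are subfamilies of a
single one. -/
theorem coneDims [CharZero K] [IsAlgClosed K] (hr : 0 < r)
    {Z : Finset (Projectivization K (Fin (r + 1) → K))} (hZ : Z.Nonempty) : ConeDims Z := by
  have hV : ∀ {κ : Type} [LinearOrder κ] [Fintype κ] (a : κ → MvPolynomial (Fin (r + 1)) K) (k c h)
      (x : Fin (r + 1) → K), (∀ s ∈ Finset.univ.map (bigEmb κ r).toEmbedding,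
        eval x (bigFamily a k c h s) = 0) ↔ ∀ s ∈ Finset.univ, eval x (a s) = 0 := by
    intro κ _ _ a k c h x
    rw [Finset.forall_mem_map]
    rfl
  induction hZ using Finset.Nonempty.cons_induction with
  | singleton p =>
    intro κ _ _ a ha
    obtain ⟨k, c, hc, hc0, rfl⟩ := exists_coordinates p
    have hb := reindexOp_bijective (bigEmb κ r) (bigFamily a k c 0) a fun i => bigFamily_emb a k c 0 i
    obtain ⟨h1, h2⟩ := hasDims_of_line hr (T := Finset.univ.map (bigEmb κ r).toEmbedding)
      (bigFamily_line a k c 0) fun x => by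
        rw [hV, ha x, eval_lin_eq_zero_iff hc hc0]
        simp
    exact ⟨(Equiv.ofBijective _ (hb (r + 1))).subsingleton_congr.1 h1,
      HasDims.of_bijective _ (hb r) h2⟩
  | cons p Z hp hZ ih =>
    intro κ _ _ a ha
    obtain ⟨h, hh, hh'⟩ := exists_separating hZ hp
    obtain ⟨k, c, hc, hc0, rfl⟩ := exists_coordinates p
    have hl := eval_lin_eq_zero_iff hc hc0
    have hb := reindexOp_bijective (bigEmb κ r) (bigFamily a k c h) a fun i => bigFamily_emb a k c h i
    have ha' : ∀ x, (∀ s ∈ Finset.univ, eval x (a s) = 0) ↔ ∀ hx : x ≠ 0,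
        Projectivization.mk K x hx = Projectivization.mk K c hc0 ∨
          Projectivization.mk K x hx ∈ Z := fun x => by
      rw [ha x]
      simp
    have hcone : IsCone (bigFamily a k c h)
        (insert (bigLast κ r) (Finset.univ.map (bigEmb κ r).toEmbedding))
        (Z : Set (Projectivization K (Fin (r + 1) → K))) := by
      intro x
      rw [Finset.forall_mem_insert, bigFamily_last, hV, ha']
      constructor
      · rintro ⟨h1, h2⟩ hx
        exact (h2 hx).resolve_left fun e => hh' x hx e h1
      · intro h1
        exact ⟨hh x h1, fun hx => Or.inr (h1 hx)⟩
    obtain ⟨i1, i2⟩ := ih.res hcone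
    obtain ⟨h1, h2⟩ := hasDims_add_point hr (T := Finset.univ.map (bigEmb κ r).toEmbedding)
      (h := bigLast κ r) (bigFamily_line a k c h)
      (fun x hx => (hV a k c h x).2 ((ha' x).2 fun hx0 => Or.inl ((hl x).1 hx hx0)))
      (fun x hx => by
        rw [bigFamily_last]
        have h1 := (ha' x).1 ((hV a k c h x).1 hx)
        by_cases hx0 : x = 0
        · exact Or.inl ((hl x).2 fun h => absurd hx0 h)
        · rcases h1 hx0 with h2 | h2
          · exact Or.inl ((hl x).2 fun _ => h2)
          · exact Or.inr (hh x fun _ => h2))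
      (fun x hx hx' => by
        rw [bigFamily_last] at hx'
        by_contra hk
        have hx0 : x ≠ 0 := fun e => hk (by rw [e]; rfl)
        exact hh' x hx0 ((hl x).1 hx hx0) hx')
      (by
        rw [bigFamily_last]
        exact hh 0 fun h => absurd rfl h)
      (bigLast_notMem k) i1 i2
    have hcard : Z.card - 1 + 1 = (Finset.cons (Projectivization.mk K c hc0) Z hp).card - 1 := by
      have := hZ.card_pos
      rw [Finset.card_cons]
      omega
    rw [hcard, ← Finset.card_cons hp] at h2
    exact ⟨(Equiv.ofBijective _ (hb (r + 1))).subsingleton_congr.1 h1,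
      HasDims.of_bijective _ (hb r) h2⟩

end Cone
end

noncomputable section
open CategoryTheory

/-! ### Extension of the base field -/

section ScalarExtension

variable {K : Type u} [Field K] {L : Type v} [Field L] [Algebra K L] {τ : Type*}
  {V V' W W' : Type*} [AddCommGroup V] [Module K V] [AddCommGroup V'] [Module K V']
  [AddCommGroup W'] [Module L W'] [AddCommGroup W] [Module L W]

/-- The map `(v_t) ↦ ∑ e_t j(v_t)` for a basis `e` of `L` over `K` and a semilinear map `j`. -/
def extSum (e : Module.Basis τ K L) (j : V →ₛₗ[algebraMap K L] W) : (τ →₀ V) →+ W :=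
  Finsupp.liftAddHom fun t => (DistribSMul.toAddMonoidHom W (e t)).comp j.toAddMonoidHom

lemma extSum_single (e : Module.Basis τ K L) (j : V →ₛₗ[algebraMap K L] W) (t : τ) (x : V) :
    extSum e j (Finsupp.single t x) = e t • j x := by
  simp [extSum]

/-- The semilinear map `j : V → W` exhibits `W` as the extension of scalars of `V`. -/
def IsScalarExt (e : Module.Basis τ K L) (j : V →ₛₗ[algebraMap K L] W) : Prop :=
  Function.Bijective (extSum e j)

/-- Naturality in the module. It lets injectivity and surjectivity of `extSum` be tested coordinate
by coordinate along the basis e, the decomposition of W into copies of V. -/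
lemma extSum_comm (e : Module.Basis τ K L) {j : V →ₛₗ[algebraMap K L] W}
    {j' : V' →ₛₗ[algebraMap K L] W'} {f : V →ₗ[K] V'} {g : W →ₗ[L] W'}
    (h : ∀ x, g (j x) = j' (f x)) (v : τ →₀ V) :
    g (extSum e j v) = extSum e j' (v.mapRange f (map_zero f)) := by
  induction v using Finsupp.induction_linear with
  | zero => simp
  | add v w hv hw => rw [map_add, map_add, hv, hw, Finsupp.mapRange_add (map_add f), map_add]
  | single t x => rw [extSum_single, Finsupp.mapRange_single, extSum_single, map_smul, h]

lemma extSum_repr_smul (e : Module.Basis τ K L) (j : V →ₛₗ[algebraMap K L] W) (l : L) (x : V) :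
    extSum e j ((e.repr l).mapRange (fun c => c • x) (zero_smul K x)) = l • j x := by
  conv_rhs => rw [← e.linearCombination_repr l]
  induction e.repr l using Finsupp.induction_linear with
  | zero => simp
  | add v w hv hw =>
    rw [Finsupp.mapRange_add (fun a b => add_smul a b x), map_add, hv, hw, map_add, add_smul]
  | single t c =>
    rw [Finsupp.mapRange_single, extSum_single, Finsupp.linearCombination_single, map_smulₛₗ,
      smul_smul, Algebra.smul_def, mul_comm]

/-- A basis over `K` becomes a basis over `L`. -/
lemma IsScalarExt.nonempty_basis {e : Module.Basis τ K L} {j : V →ₛₗ[algebraMap K L] W}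
    (h : IsScalarExt e j) {β : Type*} (b : Module.Basis β K V) :
    Nonempty (Module.Basis β L W) := by
  have hli : LinearIndependent L fun i => j (b i) := by
    rw [linearIndependent_iff]
    intro l hl
    have h0 : l.sum (fun i c => (e.repr c).mapRange (fun c => c • b i) (zero_smul K (b i))) = 0 := by
      refine h.1 ?_
      rw [Finsupp.sum, map_sum, map_zero, ← hl, Finsupp.linearCombination_apply, Finsupp.sum]
      exact Finset.sum_congr rfl fun i _ => extSum_repr_smul e j (l i) (b i)
    have h1 : ∀ i ∈ l.support, e.repr (l i) = 0 := by
      intro i hi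
      ext t
      have h2 := DFunLike.congr_fun h0 t
      rw [Finsupp.sum, Finsupp.finsetSum_apply] at h2
      exact linearIndependent_iff'.1 b.linearIndependent l.support (fun i => e.repr (l i) t) h2 i hi
    ext i
    by_contra hi
    exact hi (e.repr.map_eq_zero_iff.1 (h1 i (Finsupp.mem_support_iff.2 hi)))
  refine ⟨Module.Basis.mk hli ?_⟩
  intro w _
  obtain ⟨v, rfl⟩ := h.2 w
  induction v using Finsupp.induction_linear with
  | zero => simp
  | add v w hv hw =>
    rw [map_add]
    exact add_mem (hv trivial) (hw trivial)
  | single t x =>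
    rw [extSum_single]
    refine Submodule.smul_mem _ _ ?_
    rw [← b.linearCombination_repr x]
    induction b.repr x using Finsupp.induction_linear with
    | zero => simp
    | add v w hv hw =>
      rw [map_add, map_add]
      exact add_mem hv hw
    | single i c =>
      rw [Finsupp.linearCombination_single, map_smulₛₗ]
      exact Submodule.smul_mem _ _ (Submodule.subset_span ⟨i, rfl⟩)

lemma IsScalarExt.injective {e : Module.Basis τ K L} {j : V →ₛₗ[algebraMap K L] W}
    (h : IsScalarExt e j) : Function.Injective j := by
  rw [injective_iff_map_eq_zero]
  intro x hx
  obtain ⟨t⟩ : Nonempty τ := e.index_nonempty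
  have : Finsupp.single t x = 0 := h.1 (by rw [extSum_single, hx, smul_zero, map_zero])
  exact Finsupp.single_eq_zero.1 this

lemma IsScalarExt.finite_finrank {e : Module.Basis τ K L} {j : V →ₛₗ[algebraMap K L] W}
    (h : IsScalarExt e j) [Module.Finite L W] :
    Module.Finite K V ∧ Module.finrank K V = Module.finrank L W := by
  let b := Module.Basis.ofVectorSpace K V
  obtain ⟨bL⟩ := h.nonempty_basis b
  have := Module.Finite.finite_basis bL
  have := Fintype.ofFinite (Module.Basis.ofVectorSpaceIndex K V)
  exact ⟨Module.Finite.of_basis b, by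
    rw [Module.finrank_eq_card_basis b, Module.finrank_eq_card_basis bL]⟩

/-- Extension of scalars commutes with finite products. -/
lemma IsScalarExt.pi {σ : Type*} [Finite σ] {A B : σ → Type*} [∀ i, AddCommGroup (A i)]
    [∀ i, Module K (A i)] [∀ i, AddCommGroup (B i)] [∀ i, Module L (B i)]
    {e : Module.Basis τ K L} {j : ∀ i, A i →ₛₗ[algebraMap K L] B i} (h : ∀ i, IsScalarExt e (j i))
    (J : (∀ i, A i) →ₛₗ[algebraMap K L] ∀ i, B i) (hJ : ∀ x i, J x i = j i (x i)) :
    IsScalarExt e J := by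
  have hc : ∀ i v, extSum e J v i = extSum e (j i) (v.mapRange (fun x => x i) rfl) := fun i v =>
    extSum_comm e (f := LinearMap.proj (R := K) (φ := A) i)
      (g := LinearMap.proj (R := L) (φ := B) i) (fun x => hJ x i) v
  constructor
  · rw [injective_iff_map_eq_zero]
    intro v hv
    ext t i
    have : v.mapRange (fun x => x i) rfl = 0 := (h i).1 (by rw [← hc, hv, map_zero]; rfl)
    exact DFunLike.congr_fun this t
  · intro w
    choose v hv using fun i => (h i).2 (w i)
    refine ⟨Finsupp.ofSupportFinite (fun t i => v i t) ?_, funext fun i => ?_⟩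
    · refine (Set.finite_iUnion fun i => (v i).hasFiniteSupport).subset fun t ht => ?_
      obtain ⟨i, hi⟩ := Function.ne_iff.1 ht
      exact Set.mem_iUnion.2 ⟨i, hi⟩
    · rw [hc, ← hv]
      exact congrArg _ (Finsupp.ext fun t => rfl)

/-- Extension of scalars commutes with subquotients `ker d / im d'`. -/
lemma IsScalarExt.subquotient {V₀ V₁ W₀ W₁ Q Q' : Type*} [AddCommGroup V₀] [Module K V₀]
    [AddCommGroup V₁] [Module K V₁] [AddCommGroup W₀] [Module L W₀] [AddCommGroup W₁] [Module L W₁]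
    [AddCommGroup Q] [Module K Q] [AddCommGroup Q'] [Module L Q']
    {e : Module.Basis τ K L} {j₀ : V₀ →ₛₗ[algebraMap K L] W₀} {j : V →ₛₗ[algebraMap K L] W}
    {j₁ : V₁ →ₛₗ[algebraMap K L] W₁} (h₀ : IsScalarExt e j₀) (h : IsScalarExt e j)
    (h₁ : IsScalarExt e j₁) {d₀ : V₀ →ₗ[K] V} {d : V →ₗ[K] V₁} {d₀' : W₀ →ₗ[L] W}
    {d' : W →ₗ[L] W₁} (hd₀ : ∀ x, d₀' (j₀ x) = j (d₀ x)) (hd : ∀ x, d' (j x) = j₁ (d x))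
    (c : LinearMap.ker d →ₗ[K] Q) (hc : Function.Surjective c)
    (hc0 : ∀ z, c z = 0 ↔ z.1 ∈ LinearMap.range d₀)
    (c' : LinearMap.ker d' →ₗ[L] Q') (hc' : Function.Surjective c')
    (hc0' : ∀ z, c' z = 0 ↔ z.1 ∈ LinearMap.range d₀') :
    ∃ J : Q →ₛₗ[algebraMap K L] Q', IsScalarExt e J ∧
      ∀ (z : LinearMap.ker d) (z' : LinearMap.ker d'), z'.1 = j z.1 → J (c z) = c' z' := by
  let jz : LinearMap.ker d →ₛₗ[algebraMap K L] LinearMap.ker d' :=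
    { toFun := fun z => ⟨j z.1, by
        rw [LinearMap.mem_ker, hd, LinearMap.mem_ker.1 z.2, map_zero]⟩
      map_add' := fun x y => Subtype.ext (map_add j _ _)
      map_smul' := fun x y => Subtype.ext (map_smulₛₗ j _ _) }
  have key : ∀ z w, c z = c w → c' (jz z) = c' (jz w) := by
    intro z w hzw
    rw [← sub_eq_zero, ← map_sub, hc0] at hzw
    obtain ⟨y, hy⟩ := hzw
    rw [← sub_eq_zero, ← map_sub, ← map_sub, hc0']
    exact ⟨j₀ y, by rw [hd₀, hy]; rfl⟩
  -- J lifts a class to an arbitrary cocycle and takes the class of its image; `key` shows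
  -- independence of the lift, hence semilinearity.
  let σ := Function.surjInv hc
  have hσ : ∀ x, c (σ x) = x := Function.surjInv_eq hc
  let J : Q →ₛₗ[algebraMap K L] Q' :=
    { toFun := fun x => c' (jz (σ x))
      map_add' := fun x y => by
        rw [← map_add, ← map_add]
        exact key _ _ (by rw [map_add, hσ, hσ, hσ])
      map_smul' := fun r x => by
        rw [← map_smul, ← map_smulₛₗ]
        exact key _ _ (by rw [map_smul, hσ, hσ]) }
  have hJ : ∀ z, J (c z) = c' (jz z) := fun z => key _ _ (hσ _)
  have hval : ∀ v, (extSum e jz v : W) = extSum e j (v.mapRange Subtype.val rfl) := fun v =>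
    extSum_comm e (f := (LinearMap.ker d).subtype) (g := (LinearMap.ker d').subtype)
      (fun _ => rfl) v
  have hJs : ∀ v, extSum e J (v.mapRange c (map_zero c)) = c' (extSum e jz v) := fun v =>
    (extSum_comm e (fun x => (hJ x).symm) v).symm
  refine ⟨J, ⟨?_, ?_⟩, fun z z' hz => (hJ z).trans (congrArg c' (Subtype.ext hz.symm))⟩
  · rw [injective_iff_map_eq_zero]
    intro q hq
    obtain ⟨v, rfl⟩ : ∃ v : τ →₀ LinearMap.ker d, v.mapRange c (map_zero c) = q :=
      Finsupp.mapRange_surjective c (map_zero c) hc q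
    rw [hJs, hc0', hval] at hq
    obtain ⟨y, hy⟩ := hq
    obtain ⟨u, rfl⟩ := h₀.2 y
    rw [extSum_comm e hd₀] at hy
    ext t
    rw [Finsupp.mapRange_apply, Finsupp.zero_apply, hc0]
    exact ⟨u t, DFunLike.congr_fun (h.1 hy) t⟩
  · intro q
    obtain ⟨w, rfl⟩ := hc' q
    obtain ⟨v, hv⟩ := h.2 w.1
    -- Injectivity for V₁ makes every component of the cocycle a cocycle over K. The injectivity
    -- argument above treats coboundaries in the same way.
    have h0 : v.mapRange d (map_zero d) = 0 := h₁.1 (by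
      rw [← extSum_comm e hd, hv, LinearMap.mem_ker.1 w.2, map_zero])
    have hz : ∀ t, v t ∈ LinearMap.ker d := fun t => DFunLike.congr_fun h0 t
    let z : τ →₀ LinearMap.ker d := Finsupp.onFinset v.support (fun t => ⟨v t, hz t⟩) fun t ht => by
      rw [Finsupp.mem_support_iff]
      exact fun h => ht (Subtype.ext h)
    refine ⟨z.mapRange c (map_zero c), ?_⟩
    rw [hJs]
    refine congrArg c' (Subtype.ext ?_)
    rw [hval, ← hv]
    exact congrArg _ (Finsupp.ext fun t => rfl)

end ScalarExtension

/-! ### Extension of the base field for cubes -/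

namespace ModuleCube

variable {K : Type u} [Field K] {L : Type v} [Field L] [Algebra K L] {τ : Type*}
  {ι : Type} [LinearOrder ι]

/-- A cube over `L` which is the extension of scalars of a cube over `K`. -/
structure ScalarExt (e : Module.Basis τ K L) (C : ModuleCube K ι) (C' : ModuleCube L ι) where
  app : ∀ S, C.M S →ₛₗ[algebraMap K L] C'.M S
  naturality : ∀ {S T : Finset ι} (i : ι) (h : insert i S = T) (x : C.M S),
    app T (C.φ i h x) = C'.φ i h (app S x)
  isScalarExt : ∀ S, IsScalarExt e (app S)

namespace ScalarExt

variable {e : Module.Basis τ K L} {C : ModuleCube K ι} {C' : ModuleCube L ι}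

/-- The map on cochains. -/
def term (E : ScalarExt e C C') (p : ℕ) : C.Term p →ₛₗ[algebraMap K L] C'.Term p where
  toFun f S := E.app S.1 (f S)
  map_add' _ _ := funext fun _ => map_add _ _ _
  map_smul' _ _ := funext fun _ => map_smulₛₗ _ _ _

lemma diff_term (E : ScalarExt e C C') (p : ℕ) (f : C.Term p) :
    C'.diff (rfl : p + 1 = p + 1) (E.term p f) = E.term (p + 1) (C.diff rfl f) := by
  funext T
  change _ = E.app T.1 (C.diff rfl f T)
  rw [diff_apply, diff_apply, map_sum]
  refine Finset.sum_congr rfl fun i _ => ?_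
  rw [map_zsmul, E.naturality]
  rfl

variable [Finite ι]

lemma isScalarExt_term (E : ScalarExt e C C') (p : ℕ) : IsScalarExt e (E.term p) :=
  IsScalarExt.pi (fun S : {S : Finset ι // S.card = p} => E.isScalarExt S.1) _ fun _ _ => rfl

/-- Cohomology is cocycles modulo coboundaries, so the subquotient lemma applies; in degree 0 the
missing incoming differential is replaced by zero. -/
lemma exists_H (E : ScalarExt e C C') (p : ℕ) :
    ∃ J : C.H p →ₛₗ[algebraMap K L] C'.H p, IsScalarExt e J ∧
      ∀ (z : C.Z p) (z' : C'.Z p), z'.1 = E.term p z.1 → J (C.cls p z) = C'.cls p z' := by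
  cases p with
  | zero =>
    refine IsScalarExt.subquotient (E.isScalarExt_term 0) (E.isScalarExt_term 0)
      (E.isScalarExt_term 1) (d₀ := 0) (d₀' := 0) (fun x => by simp) (E.diff_term 0)
      (C.cls 0) (C.cls_surjective 0) (fun z => ?_) (C'.cls 0) (C'.cls_surjective 0) fun z => ?_
    · rw [cls_eq_zero_iff, LinearMap.range_zero]
      rfl
    · rw [cls_eq_zero_iff, LinearMap.range_zero]
      rfl
  | succ p =>
    exact IsScalarExt.subquotient (E.isScalarExt_term p) (E.isScalarExt_term (p + 1))
      (E.isScalarExt_term (p + 1 + 1)) (E.diff_term p) (E.diff_term (p + 1))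
      (C.cls (p + 1)) (C.cls_surjective (p + 1)) (C.cls_eq_zero_iff (p + 1)) (C'.cls (p + 1))
      (C'.cls_surjective (p + 1)) (C'.cls_eq_zero_iff (p + 1))

/-- The map in cohomology. -/
def H (E : ScalarExt e C C') (p : ℕ) : C.H p →ₛₗ[algebraMap K L] C'.H p := (E.exists_H p).choose

lemma isScalarExt_H (E : ScalarExt e C C') (p : ℕ) : IsScalarExt e (E.H p) :=
  (E.exists_H p).choose_spec.1

lemma H_cls (E : ScalarExt e C C') (p : ℕ) (z : C.Z p) (z' : C'.Z p)
    (h : z'.1 = E.term p z.1) : E.H p (C.cls p z) = C'.cls p z' :=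
  (E.exists_H p).choose_spec.2 z z' h

lemma H_comm (E : ScalarExt e C C') (α : Hom C C) (α' : Hom C' C')
    (h : ∀ S x, E.app S (α.app S x) = α'.app S (E.app S x)) (p : ℕ) (x : C.H p) :
    E.H p (α.H p x) = α'.H p (E.H p x) := by
  obtain ⟨z, rfl⟩ := C.cls_surjective p x
  have hz : E.term p z.1 ∈ C'.Z p := by
    rw [LinearMap.mem_ker, E.diff_term, LinearMap.mem_ker.1 z.2, map_zero]
  rw [α.H_cls p z ⟨_, α.mem_Z p z.2⟩ (fun _ => rfl), E.H_cls p z ⟨_, hz⟩ rfl,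
    α'.H_cls p ⟨_, hz⟩ ⟨_, α'.mem_Z p hz⟩ (fun _ => rfl)]
  exact E.H_cls p _ _ (funext fun S => (h S.1 (z.1 S)).symm)

end ScalarExt

end ModuleCube

namespace OpModule

open ModuleCube

variable {K : Type u} [Field K] {L : Type v} [Field L] [Algebra K L] {τ : Type*} {n r : ℕ}

/-- The de Rham cube of an extension of scalars. -/
def scalarExt {e : Module.Basis τ K L} {N : OpModule K n} {N' : OpModule L n}
    (j : N.carrier →ₛₗ[algebraMap K L] N'.carrier) (hj : IsScalarExt e j)
    (h : ∀ i x, j (N.D i x) = N'.D i (j x)) : ScalarExt e N.cube N'.cube where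
  app _ := j
  naturality i _ x := h i x
  isScalarExt _ := hj

/-- A K-basis of the small cohomology becomes an L-basis of the large one, so dimensions and
finiteness descend; vanishing descends because the comparison map is injective. -/
lemma HasDims.of_isScalarExt {e : Module.Basis τ K L} {N : OpModule K (r + 1)}
    {N' : OpModule L (r + 1)} (j : N.carrier →ₛₗ[algebraMap K L] N'.carrier) (hj : IsScalarExt e j)
    (h : ∀ i x, j (N.D i x) = N'.D i (j x)) {α β : ℕ} (hN : N'.HasDims α β) : N.HasDims α β := by
  let E := scalarExt j hj h
  have := hN.finite
  have := hN.finite_top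
  have h1 := (E.isScalarExt_H r).finite_finrank
  have h2 := (E.isScalarExt_H (r + 1)).finite_finrank
  refine ⟨fun p hp => ?_, h1.1, h1.2.trans hN.finrank, h2.1, h2.2.trans hN.finrank_top⟩
  have := hN.low p hp
  exact (E.isScalarExt_H p).injective.subsingleton

end OpModule
end

noncomputable section
open CategoryTheory

/-! ### Extension of the base field for polynomial rings and Čech cohomology -/

section CechScalarExtension

open ModuleCube OpModule MvPolynomial

variable {K : Type u} [Field K] {L : Type v} [Field L] [Algebra K L] {τ : Type*}
  {σ : Type}

/-- The inclusion of polynomial rings, as a semilinear map. -/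
def polyExt (K : Type u) [Field K] (L : Type v) [Field L] [Algebra K L] (σ : Type) :
    MvPolynomial σ K →ₛₗ[algebraMap K L] MvPolynomial σ L where
  toFun := MvPolynomial.map (algebraMap K L)
  map_add' := map_add _
  map_smul' c f := by rw [smul_eq_C_mul, map_mul, map_C, smul_eq_C_mul]

lemma polyExt_apply (f : MvPolynomial σ K) : polyExt K L σ f = MvPolynomial.map (algebraMap K L) f :=
  rfl

/-- Injectivity is the linear independence of e read in each coefficient; for surjectivity each
monomial over L is l times a monomial over K. -/
lemma isScalarExt_polyExt (e : Module.Basis τ K L) : IsScalarExt e (polyExt K L σ) := by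
  constructor
  · rw [injective_iff_map_eq_zero]
    intro v hv
    ext t m
    let k : K →ₛₗ[algebraMap K L] L :=
      { toFun := algebraMap K L
        map_add' := map_add _
        map_smul' := fun c x => by simp }
    have h1 := extSum_comm e (j := polyExt K L σ) (j' := k) (f := lcoeff K m) (g := lcoeff L m)
      (fun f => coeff_map _ _ _) v
    rw [hv, map_zero] at h1
    have h2 : ∀ w : τ →₀ K, extSum e k w = Finsupp.linearCombination K e w := by
      intro w
      induction w using Finsupp.induction_linear with
      | zero => simp
      | add v w hv hw => rw [map_add, map_add, hv, hw]
      | single t c =>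
        rw [extSum_single, Finsupp.linearCombination_single, smul_eq_mul, Algebra.smul_def, mul_comm]
        rfl
    rw [h2] at h1
    exact DFunLike.congr_fun (linearIndependent_iff.1 e.linearIndependent _ h1.symm) t
  · intro w
    induction w using MvPolynomial.induction_on' with
    | monomial m l =>
      refine ⟨_, (extSum_repr_smul e (polyExt K L σ) l (monomial m 1)).trans ?_⟩
      rw [polyExt_apply, map_monomial, map_one, smul_monomial, smul_eq_mul, mul_one]
    | add f g hf hg =>
      obtain ⟨v, rfl⟩ := hf
      obtain ⟨w, rfl⟩ := hg
      exact ⟨v + w, map_add _ _ _⟩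

variable {f f' : MvPolynomial σ K} {g g' : MvPolynomial σ L}

/-- The inclusion of localizations of polynomial rings. -/
def awayExtHom (h : MvPolynomial.map (algebraMap K L) f = g) :
    Localization.Away f →+* Localization.Away g :=
  IsLocalization.Away.lift (g := (algebraMap (MvPolynomial σ L) (Localization.Away g)).comp
    (MvPolynomial.map (algebraMap K L))) f (by
      rw [RingHom.comp_apply, h]
      exact IsLocalization.Away.algebraMap_isUnit g)

lemma awayExtHom_algebraMap (h : MvPolynomial.map (algebraMap K L) f = g) (x : MvPolynomial σ K) :
    awayExtHom h (algebraMap _ _ x) = algebraMap _ _ (MvPolynomial.map (algebraMap K L) x) :=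
  IsLocalization.Away.lift_eq _ _ _

/-- The inclusion of localizations of polynomial rings, as a semilinear map. -/
def awayExt (h : MvPolynomial.map (algebraMap K L) f = g) :
    Localization.Away f →ₛₗ[algebraMap K L] Localization.Away g where
  toFun := awayExtHom h
  map_add' := map_add _
  map_smul' c x := by
    rw [Algebra.smul_def, Algebra.smul_def, map_mul,
      IsScalarTower.algebraMap_apply K (MvPolynomial σ K) (Localization.Away f),
      awayExtHom_algebraMap, algebraMap_eq, map_C,
      IsScalarTower.algebraMap_apply L (MvPolynomial σ L) (Localization.Away g), algebraMap_eq]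

lemma awayExt_algebraMap (h : MvPolynomial.map (algebraMap K L) f = g) (x : MvPolynomial σ K) :
    awayExt h (algebraMap _ _ x) = algebraMap _ _ (MvPolynomial.map (algebraMap K L) x) :=
  awayExtHom_algebraMap h x

lemma awayExt_mul (h : MvPolynomial.map (algebraMap K L) f = g) (x y : Localization.Away f) :
    awayExt h (x * y) = awayExt h x * awayExt h y := map_mul (awayExtHom h) x y

lemma extSum_awayExt_algebraMap (e : Module.Basis τ K L)
    (h : MvPolynomial.map (algebraMap K L) f = g) (v : τ →₀ MvPolynomial σ K) :
    extSum e (awayExt h) (v.mapRange (algebraMap _ _) (map_zero _)) =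
      algebraMap _ (Localization.Away g) (extSum e (polyExt K L σ) v) :=
  (extSum_comm e (f := (IsScalarTower.toAlgHom K (MvPolynomial σ K) (Localization.Away f)).toLinearMap)
    (g := (IsScalarTower.toAlgHom L (MvPolynomial σ L) (Localization.Away g)).toLinearMap)
    (fun x => (awayExt_algebraMap h x).symm) v).symm

lemma extSum_awayExt_mul (e : Module.Basis τ K L) (h : MvPolynomial.map (algebraMap K L) f = g)
    (v : τ →₀ Localization.Away f) (y : Localization.Away f) :
    extSum e (awayExt h) (v.mapRange (y * ·) (mul_zero y)) =
      awayExt h y * extSum e (awayExt h) v :=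
  (extSum_comm e (f := LinearMap.mulLeft K y) (g := LinearMap.mulLeft L (awayExt h y))
    (fun x => (awayExt_mul h y x).symm) v).symm

/-- A finitely supported family of fractions has a common denominator f^n, and f^n maps to the
denominator g^n over L; so the claim reduces to polynomial rings, after a further power f^m to
witness vanishing in the localization. -/
lemma isScalarExt_awayExt (e : Module.Basis τ K L) (h : MvPolynomial.map (algebraMap K L) f = g) :
    IsScalarExt e (awayExt h) := by
  classical
  have hu : ∀ n : ℕ, IsUnit (algebraMap (MvPolynomial σ K) (Localization.Away f) (f ^ n)) := fun n => by
    rw [map_pow]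
    exact (IsLocalization.Away.algebraMap_isUnit f).pow n
  have hu' : ∀ n : ℕ, IsUnit (algebraMap (MvPolynomial σ L) (Localization.Away g) (g ^ n)) := fun n => by
    rw [map_pow]
    exact (IsLocalization.Away.algebraMap_isUnit g).pow n
  constructor
  · rw [injective_iff_map_eq_zero]
    intro v hv
    obtain ⟨⟨_, n, rfl⟩, hn⟩ := IsLocalization.exist_integer_multiples_of_finset
      (Submonoid.powers f) (v.support.image v)
    have hn' : ∀ t, ∃ y, algebraMap (MvPolynomial σ K) (Localization.Away f) y =
        algebraMap _ _ (f ^ n) * v t := by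
      intro t
      by_cases ht : v t = 0
      · exact ⟨0, by rw [ht, map_zero, mul_zero]⟩
      · obtain ⟨y, hy⟩ := hn (v t) (Finset.mem_image_of_mem _ (Finsupp.mem_support_iff.2 ht))
        exact ⟨y, hy.trans (Algebra.smul_def _ _)⟩
    choose y hy using hn'
    let w : τ →₀ MvPolynomial σ K := Finsupp.onFinset v.support
      (fun t => if v t = 0 then 0 else y t) fun t ht => by
        rw [Finsupp.mem_support_iff]
        intro h0
        exact ht (if_pos h0)
    have hw : w.mapRange (algebraMap _ (Localization.Away f)) (map_zero _) =
        v.mapRange (algebraMap _ _ (f ^ n) * ·) (mul_zero _) := by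
      ext t
      rw [Finsupp.mapRange_apply, Finsupp.mapRange_apply, Finsupp.onFinset_apply]
      split_ifs with h0
      · rw [h0, map_zero, mul_zero]
      · exact hy t
    have h1 := extSum_awayExt_algebraMap e h w
    rw [hw, extSum_awayExt_mul, hv, mul_zero] at h1
    obtain ⟨⟨_, m, rfl⟩, hm⟩ := (IsLocalization.map_eq_zero_iff (Submonoid.powers g) _ _).1 h1.symm
    have h2 := extSum_comm e (j := polyExt K L σ) (j' := polyExt K L σ) (f := LinearMap.mulLeft K (f ^ m))
      (g := LinearMap.mulLeft L (g ^ m))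
      (fun x => by simp [polyExt_apply, h]) w
    have h3 := (isScalarExt_polyExt e).1 ((h2.symm.trans hm).trans (map_zero _).symm)
    ext t
    have h4 : f ^ m * w t = 0 := DFunLike.congr_fun h3 t
    have h5 := DFunLike.congr_fun hw t
    rw [Finsupp.mapRange_apply, Finsupp.mapRange_apply] at h5
    refine (hu n).mul_left_cancel ((hu m).mul_left_cancel ?_)
    rw [← h5, ← map_mul, h4, Finsupp.zero_apply, mul_zero, mul_zero, map_zero]
  · intro w
    obtain ⟨⟨x, ⟨_, n, rfl⟩⟩, hx⟩ := IsLocalization.surj (Submonoid.powers g) w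
    obtain ⟨v, rfl⟩ := (isScalarExt_polyExt e).2 x
    obtain ⟨y, hy⟩ := (hu n).exists_right_inv
    refine ⟨(v.mapRange (algebraMap _ _) (map_zero _)).mapRange (y * ·) (mul_zero y), ?_⟩
    rw [extSum_awayExt_mul, extSum_awayExt_algebraMap]
    refine (hu' n).mul_right_cancel (Eq.trans ?_ hx.symm)
    have h1 : awayExt h y * algebraMap (MvPolynomial σ L) (Localization.Away g) (g ^ n) = 1 := by
      have := congrArg (awayExt h) hy
      rw [awayExt_mul, awayExt_algebraMap, map_pow, h, mul_comm] at this
      exact this.trans (map_one (awayExtHom h))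
    rw [mul_right_comm, h1, one_mul]

lemma awayExt_awayToAway (h : MvPolynomial.map (algebraMap K L) f = g)
    (h' : MvPolynomial.map (algebraMap K L) f' = g') (hf : f ∣ f') (hg : g ∣ g')
    (x : Localization.Away f) :
    awayExt h' (awayToAway hf x) = awayToAway hg (awayExt h x) := by
  have : (awayExtHom h').comp (awayToAway hf).toRingHom =
      (awayToAway hg).toRingHom.comp (awayExtHom h) := by
    refine IsLocalization.ringHom_ext (Submonoid.powers f) (RingHom.ext fun y => ?_)
    change awayExtHom h' (awayToAway hf (algebraMap _ _ y)) =
      awayToAway hg (awayExtHom h (algebraMap _ _ y))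
    rw [AlgHom.commutes, awayExtHom_algebraMap, awayExtHom_algebraMap, AlgHom.commutes]
  exact RingHom.congr_fun this x

lemma awayExt_derivation (h : MvPolynomial.map (algebraMap K L) f = g)
    (D : Derivation K (MvPolynomial σ K) (MvPolynomial σ K))
    (D' : Derivation L (MvPolynomial σ L) (MvPolynomial σ L))
    (hD : ∀ x, MvPolynomial.map (algebraMap K L) (D x) = D' (MvPolynomial.map (algebraMap K L) x))
    (x : Localization.Away f) :
    awayExt h (locDerivation (Submonoid.powers f) D x) =
      locDerivation (Submonoid.powers g) D' (awayExt h x) := by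
  obtain ⟨⟨r, ⟨_, n, rfl⟩⟩, hx⟩ := IsLocalization.surj (Submonoid.powers f) x
  dsimp only at hx
  have h1 := congrArg (fun y => locDerivation (Submonoid.powers g) D' (awayExt h y)) hx
  have h2 := congrArg (fun y => awayExt h (locDerivation (Submonoid.powers f) D y)) hx
  simp only [awayExt_mul, map_add, Derivation.leibniz, smul_eq_mul, awayExt_algebraMap,
    locDerivation_algebraMap, hD] at h1 h2
  have hu : IsUnit (algebraMap (MvPolynomial σ L) (Localization.Away g)
      (MvPolynomial.map (algebraMap K L) (f ^ n))) := by
    rw [map_pow, h, map_pow]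
    exact (IsLocalization.Away.algebraMap_isUnit g).pow n
  refine hu.mul_left_cancel ?_
  linear_combination h2 - h1

variable {ι : Type}

lemma map_prod_eq (a : ι → MvPolynomial σ K) (S : Finset ι) :
    MvPolynomial.map (algebraMap K L) (∏ i ∈ S, a i) =
      ∏ i ∈ S, MvPolynomial.map (algebraMap K L) (a i) := map_prod _ _ _

variable [LinearOrder ι]

/-- The Čech cube over the extension field. -/
def cechScalarExt (e : Module.Basis τ K L) (a : ι → MvPolynomial σ K) :
    ScalarExt e (awayCube K a) (awayCube L fun i => MvPolynomial.map (algebraMap K L) (a i)) where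
  app S := awayExt (map_prod_eq a S)
  naturality _ h x := awayExt_awayToAway (map_prod_eq a _) (map_prod_eq a _)
    (prod_dvd_of_insert a h) (prod_dvd_of_insert _ h) x
  isScalarExt _ := isScalarExt_awayExt e _

/-- The dimensions of the de Rham cohomology do not change under extension of the base field. -/
lemma hasDims_cechOp_of_map [Finite ι] {r p α β : ℕ} (a : ι → MvPolynomial (Fin (r + 1)) K)
    (h : (cechOp (fun i => MvPolynomial.map (algebraMap K L) (a i)) p).HasDims α β) :
    (cechOp a p).HasDims α β := by
  let E := cechScalarExt (Module.Basis.ofVectorSpace K L) a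
  exact HasDims.of_isScalarExt (N := cechOp a p)
    (N' := cechOp (fun i => MvPolynomial.map (algebraMap K L) (a i)) p) (E.H p) (E.isScalarExt_H p)
    (fun i x => E.H_comm (awayDer a (pderiv i)) (awayDer _ (pderiv i))
      (fun S y => awayExt_derivation (map_prod_eq a S) _ _ (fun f => pderiv_map.symm) y) p x) h

end CechScalarExtension
end

noncomputable section
open CategoryTheory

/-! ### Homogeneous ideals of height `n - 1` -/

section Geometry

open MvPolynomial

variable {K : Type u} [Field K] {L : Type v} [Field L] [Algebra K L] {n r : ℕ}

lemma aeval_smul_of_isHomogeneous {f : MvPolynomial (Fin n) K} {d : ℕ} (hf : f.IsHomogeneous d)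
    (l : L) (x : Fin n → L) : aeval (l • x) f = l ^ d * aeval x f := by
  rw [aeval_def, aeval_def, eval₂_eq, eval₂_eq, Finset.mul_sum]
  refine Finset.sum_congr rfl fun m hm => ?_
  have hd : ∑ i ∈ m.support, m i = d := by
    have := hf (mem_support_iff.1 hm)
    rw [Finsupp.weight_apply, Finsupp.sum] at this
    simpa using this
  simp only [Pi.smul_apply, smul_eq_mul, mul_pow, Finset.prod_mul_distrib]
  rw [Finset.prod_pow_eq_pow_sum, hd]
  ring

/-- The zeros of a homogeneous ideal are stable under scaling. -/
lemma aeval_smul_eq_zero {I : Ideal (MvPolynomial (Fin n) K)}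
    (hI : I.IsHomogeneous (homogeneousSubmodule (Fin n) K)) {x : Fin n → L}
    (hx : ∀ f ∈ I, aeval x f = 0) (l : L) (f) (hf : f ∈ I) : aeval (l • x) f = 0 := by
  rw [← sum_homogeneousComponent f, map_sum]
  refine Finset.sum_eq_zero fun d _ => ?_
  have h : homogeneousComponent d f ∈ I := by
    rw [← decomposition.decompose'_apply]
    exact hI d hf
  rw [aeval_smul_of_isHomogeneous (homogeneousComponent_isHomogeneous d f), hx _ h, mul_zero]

lemma mk_mem_projVariety {I : Ideal (MvPolynomial (Fin n) K)}
    (hI : I.IsHomogeneous (homogeneousSubmodule (Fin n) K)) {x : Fin n → L} (hx : x ≠ 0) :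
    Projectivization.mk L x hx ∈ projVariety L I ↔ ∀ f ∈ I, aeval x f = 0 := by
  obtain ⟨l, hl⟩ := Projectivization.exists_smul_eq_mk_rep L x hx
  constructor
  · intro h f hf
    have := aeval_smul_eq_zero hI h (l⁻¹ : Lˣ).1 f hf
    rwa [← hl, Units.smul_def, smul_smul, Units.inv_mul, one_smul] at this
  · intro h f hf
    rw [← hl]
    exact aeval_smul_eq_zero hI h l.1 f hf

lemma aeval_eq_zero_of_mem_span {s : Type*} {a : s → MvPolynomial (Fin n) K} {x : Fin n → L}
    (h : ∀ i, aeval x (a i) = 0) : ∀ f ∈ Ideal.span (Set.range a), aeval x f = 0 := by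
  have : Ideal.span (Set.range a) ≤ RingHom.ker (aeval (R := K) x) := by
    rw [Ideal.span_le]
    rintro _ ⟨i, rfl⟩
    exact h i
  exact this

/-- Homogeneity makes the zero set a cone. That the origin belongs to it needs a zero to scale by 0;
the unit ideal has no zeros at all. -/
lemma isCone_projVariety {I : Ideal (MvPolynomial (Fin n) K)}
    (hI : I.IsHomogeneous (homogeneousSubmodule (Fin n) K)) (hne : (projVariety L I).Nonempty)
    {s : Type} [Fintype s] {a : s → MvPolynomial (Fin n) K} (ha : Ideal.span (Set.range a) = I) :
    IsCone (fun i => MvPolynomial.map (algebraMap K L) (a i)) Finset.univ (projVariety L I) := by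
  intro x
  have h1 : (∀ i ∈ Finset.univ, eval x (MvPolynomial.map (algebraMap K L) (a i)) = 0) ↔
      ∀ f ∈ I, aeval x f = 0 := by
    have h2 : ∀ f : MvPolynomial (Fin n) K, eval x (MvPolynomial.map (algebraMap K L) f) =
        aeval x f := fun f => by rw [MvPolynomial.eval_map, aeval_def]
    simp only [h2]
    constructor
    · intro h
      rw [← ha]
      exact aeval_eq_zero_of_mem_span fun i => h i (Finset.mem_univ i)
    · intro h i _
      exact h _ (ha ▸ Ideal.subset_span ⟨i, rfl⟩)
  rw [h1]
  by_cases hx : x = 0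
  · obtain ⟨p, hp⟩ := hne
    have := aeval_smul_eq_zero hI hp 0
    rw [zero_smul] at this
    subst hx
    exact ⟨fun _ h => absurd rfl h, fun _ => this⟩
  · rw [← mk_mem_projVariety hI hx]
    exact ⟨fun h _ => h, fun h => h hx⟩

/-! #### Existence of zeros -/

/-- The substitution of `0` for the first `i` variables. -/
def coordHom (K : Type u) [Field K] (n i : ℕ) :
    MvPolynomial (Fin n) K →ₐ[K] MvPolynomial (Fin n) K :=
  aeval fun l : Fin n => if l.1 < i then 0 else X l

lemma coordHom_X (i : ℕ) (l : Fin n) : coordHom K n i (X l) = if l.1 < i then 0 else X l :=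
  aeval_X _ _

/-- The ideal generated by the first `i` variables. -/
def coordIdeal (K : Type u) [Field K] (n i : ℕ) : Ideal (MvPolynomial (Fin n) K) :=
  RingHom.ker (coordHom K n i)

instance (i : ℕ) : (coordIdeal K n i).IsPrime := RingHom.ker_isPrime _

lemma mem_coordIdeal {i : ℕ} {f : MvPolynomial (Fin n) K} :
    f ∈ coordIdeal K n i ↔ coordHom K n i f = 0 := Iff.rfl

lemma coordIdeal_lt {i : ℕ} (hi : i < n) : coordIdeal K n i < coordIdeal K n (i + 1) := by
  refine lt_of_le_of_ne (fun f hf => ?_) fun h => ?_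
  · have : coordHom K n (i + 1) = (coordHom K n (i + 1)).comp (coordHom K n i) := by
      ext1 l
      rw [AlgHom.comp_apply, coordHom_X, coordHom_X]
      by_cases h : l.1 < i
      · rw [if_pos (by omega), if_pos h, map_zero]
      · rw [if_neg h, coordHom_X]
    rw [mem_coordIdeal, this, AlgHom.comp_apply, mem_coordIdeal.1 hf, map_zero]
  · have h1 : (X ⟨i, hi⟩ : MvPolynomial (Fin n) K) ∈ coordIdeal K n (i + 1) := by
      rw [mem_coordIdeal, coordHom_X, if_pos (Nat.lt_succ_self i)]
    rw [← h, mem_coordIdeal, coordHom_X, if_neg (lt_irrefl i)] at h1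
    exact X_ne_zero _ h1

lemma le_height_coordIdeal {i : ℕ} (hi : i ≤ n) : (i : ℕ∞) ≤ (coordIdeal K n i).height := by
  induction i with
  | zero => exact zero_le
  | succ i ih =>
    push_cast
    exact (add_le_add_left (ih (by omega)) 1).trans
      (Ideal.height_add_one_le_of_lt_of_isPrime (coordIdeal_lt (by omega)))

/-- If the origin is the only possible zero over L, the Nullstellensatz puts the ideal of all
variables, of height at least r + 1, inside the radical of I, hence inside a prime of height r over
I. -/
lemma nonempty_projVariety [IsAlgClosed L] {I : Ideal (MvPolynomial (Fin (r + 1)) K)}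
    (hI : I.IsHomogeneous (homogeneousSubmodule (Fin (r + 1)) K)) (hht : I.height = (r : ℕ∞)) :
    (projVariety L I).Nonempty := by
  by_contra hne
  have h0 : ∀ x : Fin (r + 1) → L, (∀ f ∈ I, aeval x f = 0) → x = 0 := by
    intro x hx
    by_contra hx0
    exact hne ⟨_, (mk_mem_projVariety hI hx0).2 hx⟩
  have h1 : coordIdeal K (r + 1) (r + 1) ≤ I.radical := by
    rw [← vanishingIdeal_zeroLocus_eq_radical (K := L) I]
    intro f hf x hx
    rw [h0 x hx]
    have : aeval (0 : Fin (r + 1) → L) = (aeval (R := K) (0 : Fin (r + 1) → L)).comp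
        (coordHom K (r + 1) (r + 1)) := by
      ext1 l
      rw [AlgHom.comp_apply, aeval_X, coordHom_X, if_pos l.2, map_zero]
      rfl
    rw [this, AlgHom.comp_apply, mem_coordIdeal.1 hf, map_zero]
  obtain ⟨P, hP, hIP, hPh⟩ := Ideal.exists_isPrime_height_eq hht
  have h2 := Ideal.height_mono (h1.trans (hP.radical_le_iff.2 hIP))
  rw [hPh] at h2
  have h3 := (le_height_coordIdeal (K := K) le_rfl).trans h2
  norm_cast at h3
  omega

/-! #### Finiteness of the set of zeros -/

section Flat

attribute [local instance] MvPolynomial.algebraMvPolynomial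

/-- The polynomial extension is a base change of K → L, hence flat, so going-down holds. The height
of a minimal prime over the extended ideal is then at least that of its contraction, which contains
I. -/
lemma height_le_height_map (I : Ideal (MvPolynomial (Fin n) K)) :
    I.height ≤ (I.map (MvPolynomial.map (algebraMap K L))).height := by
  have : Module.Flat (MvPolynomial (Fin n) K) (MvPolynomial (Fin n) L) :=
    Module.Flat.isBaseChange K _ L _
      (Algebra.IsPushout.out (R := K) (S := MvPolynomial (Fin n) K) (R' := L))
  rw [Ideal.height_eq_inf_minimalPrimes (I := I.map _)]
  refine le_iInf₂ fun Q hQ => ?_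
  have := hQ.isPrime
  have h1 := Ideal.height_eq_height_add_of_liesOver_of_hasGoingDown
    (Q.under (MvPolynomial (Fin n) K)) Q
  rw [h1]
  refine (Ideal.height_mono ?_).trans le_self_add
  exact Ideal.map_le_iff_le_comap.1 hQ.1.2

end Flat

/-- The restriction of polynomials to a line. -/
def lineHom (k : Fin n) (c : Fin n → L) : MvPolynomial (Fin n) L →ₐ[L] MvPolynomial (Fin n) L :=
  aeval fun i => C (c i) * X k

lemma lineHom_X (k : Fin n) (c : Fin n → L) (i : Fin n) : lineHom k c (X i) = C (c i) * X k :=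
  aeval_X _ _

lemma eval_lineHom (k : Fin n) (c x : Fin n → L) (f : MvPolynomial (Fin n) L) :
    eval x (lineHom k c f) = eval (x k • c) f := by
  induction f using MvPolynomial.induction_on with
  | C a => rw [← algebraMap_eq, AlgHom.commutes, algebraMap_eq, eval_C, eval_C]
  | add p q hp hq => simp only [map_add, hp, hq]
  | mul_X p i hp =>
    rw [map_mul, map_mul, map_mul, hp, lineHom_X, map_mul, eval_C, eval_X, eval_X, Pi.smul_apply,
      smul_eq_mul, mul_comm (c i)]

/-- The ideal of a line. -/
def lineIdeal (k : Fin n) (c : Fin n → L) : Ideal (MvPolynomial (Fin n) L) :=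
  RingHom.ker (lineHom k c)

lemma mem_lineIdeal {k : Fin n} {c : Fin n → L} {f : MvPolynomial (Fin n) L} :
    f ∈ lineIdeal k c ↔ lineHom k c f = 0 := Iff.rfl

instance (k : Fin n) (c : Fin n → L) : (lineIdeal k c).IsPrime := RingHom.ker_isPrime _

lemma lin_mem_lineIdeal {k : Fin n} {c : Fin n → L} (hc : c k = 1) {i : Fin n} (hi : i ≠ k) :
    lin k c i ∈ lineIdeal k c := by
  rw [mem_lineIdeal, lin, if_neg hi, ← smul_eq_C_mul, map_sub, map_smul, lineHom_X, lineHom_X, hc, C_1, one_mul,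
    smul_eq_C_mul, sub_self]

/-- Modulo the linear equations each X_i is congruent to c_i X_k, so f is congruent to its
restriction to the line. -/
lemma lineIdeal_eq_span {k : Fin n} {c : Fin n → L} (hc : c k = 1) :
    lineIdeal k c = Ideal.span (lin k c '' (Finset.univ.erase k : Finset (Fin n))) := by
  refine le_antisymm (fun f hf => ?_) ?_
  · have h : ∀ f, f - lineHom k c f ∈
        Ideal.span (lin k c '' (Finset.univ.erase k : Finset (Fin n))) := by
      intro f
      induction f using MvPolynomial.induction_on with
      | C a =>
        rw [← algebraMap_eq, AlgHom.commutes, sub_self]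
        exact zero_mem _
      | add p q hp hq =>
        rw [map_add, add_sub_add_comm]
        exact add_mem hp hq
      | mul_X p i hp =>
        rw [map_mul, lineHom_X]
        have h1 : X i - C (c i) * X k ∈
            Ideal.span (lin k c '' (Finset.univ.erase k : Finset (Fin n))) := by
          by_cases hi : i = k
          · rw [hi, hc, C_1, one_mul, sub_self]
            exact zero_mem _
          · refine Ideal.subset_span ⟨i, by simpa using hi, ?_⟩
            rw [lin, if_neg hi]
        have := add_mem (Ideal.mul_mem_right (X i) _ hp) (Ideal.mul_mem_left _
          (lineHom k c p) h1)
        convert this using 1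
        ring
    have h1 := h f
    rwa [mem_lineIdeal.1 hf, sub_zero] at h1
  · rw [Ideal.span_le]
    rintro _ ⟨i, hi, rfl⟩
    exact lin_mem_lineIdeal hc (by simpa using hi)

/-- Krull's height theorem for the r linear generators. -/
lemma height_lineIdeal_le {k : Fin (r + 1)} {c : Fin (r + 1) → L} (hc : c k = 1) :
    (lineIdeal k c).height ≤ (r : ℕ∞) := by
  classical
  have h := Ideal.height_le_card_of_mem_minimalPrimes_span_finset (p := lineIdeal k c)
    (s := (Finset.univ.erase k).image (lin k c)) (by
      rw [Finset.coe_image, ← lineIdeal_eq_span hc, Ideal.minimalPrimes_eq_subsingleton_self]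
      rfl)
  refine h.trans ?_
  norm_cast
  refine Finset.card_image_le.trans ?_
  rw [Finset.card_erase_of_mem (Finset.mem_univ k), Finset.card_univ, Fintype.card_fin,
    Nat.add_sub_cancel]

lemma mem_lineIdeal_of_eval [Infinite L] {k : Fin n} {c : Fin n → L} {f : MvPolynomial (Fin n) L}
    (h : ∀ l : L, eval (l • c) f = 0) : f ∈ lineIdeal k c := by
  refine MvPolynomial.funext fun x => ?_
  rw [eval_lineHom, h, map_zero]

/-- The prime of the line over a point of the variety contains the extended ideal and has height at
most r, which is at most the height of that ideal; so it is a minimal prime over it, and there are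
finitely many of these. A point is recovered from the prime of its line. -/
lemma finite_projVariety [IsAlgClosed L] {I : Ideal (MvPolynomial (Fin (r + 1)) K)}
    (hI : I.IsHomogeneous (homogeneousSubmodule (Fin (r + 1)) K)) (hht : I.height = (r : ℕ∞)) :
    (projVariety L I).Finite := by
  have : Infinite L := IsAlgClosed.instInfinite
  choose k c hc hc0 hp using exists_coordinates (K := L) (n := r + 1)
  refine Set.Finite.of_finite_image (f := fun p => lineIdeal (k p) (c p))
    ((Ideal.finite_minimalPrimes_of_isNoetherianRing _
      (I.map (MvPolynomial.map (algebraMap K L)))).subset ?_) ?_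
  · rintro _ ⟨p, hpI, rfl⟩
    refine Ideal.mem_minimalPrimes_of_height_le ?_
      ((height_lineIdeal_le (hc p)).trans (hht ▸ height_le_height_map I))
    rw [Ideal.map_le_iff_le_comap]
    intro f hf
    rw [Ideal.mem_comap]
    refine mem_lineIdeal_of_eval fun l => ?_
    rw [MvPolynomial.eval_map, ← aeval_def]
    exact aeval_smul_eq_zero hI ((mk_mem_projVariety hI (hc0 p)).1 ((hp p).symm ▸ hpI)) l f hf
  · intro p _ q _ hpq
    dsimp only at hpq
    refine (hp p).symm.trans (Eq.trans ?_ (hp q))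
    refine (eval_lin_eq_zero_iff (hc q) (hc0 q) (c p)).1 (fun i hi => ?_) (hc0 p)
    have h1 := lin_mem_lineIdeal (hc q) hi
    rw [← hpq, mem_lineIdeal] at h1
    -- At the all-ones vector the restriction to the line of p is the value at c p, so the equations
    -- of the line of q hold at c p.
    have h2 := eval_lineHom (k p) (c p) (fun _ => (1 : L)) (lin (k q) (c q) i)
    rw [h1, map_zero, one_smul] at h2
    exact h2.symm

end Geometry
end

theorem theorem2 {K : Type u} [Field K] [CharZero K] {L : Type v} [Field L] [IsAlgClosed L]
    [Algebra K L] (n : ℕ) (hn : 2 ≤ n) (I : Ideal (MvPolynomial (Fin n) K))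
    (hI : I.IsHomogeneous (MvPolynomial.homogeneousSubmodule (Fin n) K))
    (hht : I.height = ((n - 1 : ℕ) : ℕ∞))
    {s : ℕ} (a : Fin s → MvPolynomial (Fin n) K) (ha : Ideal.span (Set.range a) = I) :
    (projVariety L I).Finite ∧ (projVariety L I).Nonempty ∧
    (Module.Finite K (deRhamLocalCohomology a (n - 1) n) ∧
      (Module.finrank K (deRhamLocalCohomology a (n - 1) n) : ℤ) =
        ((projVariety L I).ncard : ℤ) - 1) ∧
    (Module.Finite K (deRhamLocalCohomology a (n - 1) (n - 1)) ∧
      Module.finrank K (deRhamLocalCohomology a (n - 1) (n - 1)) = (projVariety L I).ncard) ∧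
    ∀ i : ℕ, i ≤ n - 2 → Subsingleton (deRhamLocalCohomology a (n - 1) i) := by
  obtain ⟨r, rfl⟩ : ∃ r, n = r + 1 := ⟨n - 1, by omega⟩
  have hr : 0 < r := by omega
  rw [Nat.add_sub_cancel] at hht
  have hfin : (projVariety L I).Finite := finite_projVariety hI hht
  have hne : (projVariety L I).Nonempty := nonempty_projVariety hI hht
  have : CharZero L := charZero_of_injective_algebraMap (algebraMap K L).injective
  have hcone : IsCone (fun i => MvPolynomial.map (algebraMap K L) (a i)) Finset.univ
      (hfin.toFinset : Set (Projectivization L (Fin (r + 1) → L))) := by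
    rw [hfin.coe_toFinset]
    exact isCone_projVariety hI hne ha
  -- The cone computation is made over L, which has characteristic zero with K, and is then carried
  -- down to K.
  have hd := hasDims_cechOp_of_map a
    (coneDims hr (hfin.toFinset_nonempty.2 hne) (Fin s) _ hcone).2
  have hcard : (projVariety L I).ncard = hfin.toFinset.card := Set.ncard_eq_toFinset_card _ hfin
  have hpos : 0 < hfin.toFinset.card := Finset.card_pos.2 (hfin.toFinset_nonempty.2 hne)
  rw [hcard]
  refine ⟨hfin, hne, ⟨hd.finite_top, ?_⟩, ⟨hd.finite, hd.finrank⟩, fun i hi => hd.low i (by omega)⟩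
  -- The truncated subtraction #Z - 1 agrees with the integer one because Z is non-empty.
  exact (congrArg Nat.cast hd.finrank_top).trans (Nat.cast_pred hpos)
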